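/- **Setting.** Let $T>0$, $I=[x_a,x_b]$ with $x_a<x_b$, $\mathsf L=x_b-x_a$ and $Q=[0,T]\times I$. Let $g\in C^5([0,\infty);\mathbb R)$, and let $u\in C^6(Q;\mathbb C)$ satisfy $$u_t={\rm i}\,u_{xx}+{\rm i}\,g(|u|^2)\,u+f\ \text{ on } Q,\qquad u(t,x_a)=u(t,x_b)=0\ \ (0\le t\le T),\qquad u(0,\cdot)=u_0\ \text{ on } I .$$ **Meshes.** For integers $N,J\ge 1$ let $\tau=T/N$, $t_n=n\tau$, $t^{n+1/2}=t_n+\tau/2$, $h=\mathsf L/(J+1)$, $x_j=x_a+jh$. Mesh functions are $v=(v_j)_{j=0}^{J+1}$, and products of mesh functions and functions applied to mesh functions are understood componentwise. $\mathbb C_h^\circ$ denotes the complex mesh functions with $v_0=v_{J+1}=0$. For $v\in\mathbb C_h^\circ$ let $\Delta_hv\in\mathbb C_h^\circ$ be given by $(\Delta_h v)_j=(v_{j-1}-2v_j+v_{j+1})/h^2$, $1\le j\le J$. For a function $z$ on $I$, $\mathring{\mathsf I}_hz\in\mathbb C_h^\circ$ has the values $z(x_j)$, $1\le j\le J$; and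 for $z\in C^2(I;\mathbb C)$, $\mathsf R_h[z]\in\mathbb C_h^\circ$ is determined by $\Delta_h\mathsf R_h[z]=\mathring{\mathsf I}_h(z'')$. Put $u^n=(u(t_n,x_j))_j$, $u^{n+1/2}=(u(t^{n+1/2},x_j))_j$, and $$\|v\|_{1,h}=\Big(h\sum_{j=0}^{J+1}|v_j|^2+h\sum_{j=0}^{J}\Big|\frac{v_{j+1}-v_j}{h}\Big|^2\Big)^{1/2}.$$ **Mollifiers.** For $\delta>0$ let $p_\delta$ be the unique polynomial of degree at most $7$ with $p_\delta(\delta)=\delta$, $p_\delta'(\delta)=1$, $p_\delta''(\delta)=p_\delta'''(\delta)=0$, $p_\delta(2\delta)=2\delta$, $p_\delta'(2\delta)=p_\delta''(2\delta)=p_\delta'''(2\delta)=0$. Let $\mathfrak n_\delta:\mathbb R\to\mathbb R$ be the odd function equal to $x$ on $[0,\delta]$, to $p_\delta(x)$ on $(\delta,2\delta]$ and to $2\delta$ on $(2\delta,\infty)$, and let $\gamma_\delta(z)=\mathfrak n_\delta(\operatorname{Re}z)+{\rm i}\,\mathfrak n_\delta(\operatorname{Im}z)$ for $z\in\mathbb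 C$. **The MRFD scheme with first-order initialization.** Its approximations are $V_\delta^0,\dots,V_\delta^N\in\mathbb C_h^\circ$ and real mesh functions $\Phi_\delta^{n+1/2}$, $0\le n\le N-1$, such that $$V_\delta^0=\mathsf R_h[u_0],\qquad \Phi_\delta^{1/2}=g(|u^0|^2),\qquad \Phi_\delta^{n+1/2}=2\,g(|\gamma_\delta(V_\delta^n)|^2)-\Phi_\delta^{n-1/2}\quad(1\le n\le N-1),$$ and, for $0\le n\le N-1$, $$V_\delta^{n+1}-V_\delta^n={\rm i}\tau\,\Delta_h\Big(\tfrac{V_\delta^{n+1}+V_\delta^n}{2}\Big)+{\rm i}\tau\,\mathfrak n_\delta(\Phi_\delta^{n+1/2})\,\gamma_\delta\Big(\tfrac{V_\delta^{n+1}+V_\delta^n}{2}\Big)+\tau\,\mathring{\mathsf I}_h\Big[\tfrac{f(t_{n+1},\cdot)+f(t_n,\cdot)}{2}\Big].$$ **Theorem.** Let $u_{\max}=\max_Q|u|$, $g_{\max}=\max_Q|g(|u|^2)|$, and let $\delta_\star>0$ satisfy $\delta_\star\ge\max\{u_{\max},g_{\max}\}$. Then there are positive constants $\widehat{\mathsf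 C}^{\mathsf A}_{\delta_\star}$ and $\widehat{\mathsf C}^{\mathsf B}_{\delta_\star}$, independent of $\tau$ and $h$, such that, whenever $\tau\,\widehat{\mathsf C}^{\mathsf A}_{\delta_\star}\le\tfrac12$, all approximations of the MRFD scheme with first-order initialization and $\delta=\delta_\star$ satisfy $$\max_{0\le m\le N-1}\big\|g(|u^{m+1/2}|^2)-\Phi_{\delta_\star}^{m+1/2}\big\|_{1,h}+\max_{0\le m\le N}\big\|u^m-V_{\delta_\star}^m\big\|_{1,h}\le\widehat{\mathsf C}^{\mathsf B}_{\delta_\star}\,(\tau+h^2).$$ -/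

import Mathlib

namespace RelaxNLS

noncomputable section

/-! Meshes and discrete spaces -/

/-- Complex mesh functions `(v_j)`, `j = 0, …, J+1`. -/
abbrev CGrid (J : ℕ) : Type := Fin (J + 2) → ℂ

/-- Real mesh functions `(v_j)`, `j = 0, …, J+1`. -/
abbrev RGrid (J : ℕ) : Type := Fin (J + 2) → ℝ

/-- Time step `τ = T / N`. -/
def timeStep (T : ℝ) (N : ℕ) : ℝ := T / N

/-- Mesh width `h = (x_b - x_a) / (J + 1)`. -/
def meshWidth (xa xb : ℝ) (J : ℕ) : ℝ := (xb - xa) / (J + 1)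

/-- Space nodes `x_j = x_a + j h`. -/
def node (xa xb : ℝ) (J j : ℕ) : ℝ := xa + j * meshWidth xa xb J

/-- Mesh functions that vanish at both end nodes. -/
def VanishesAtEnds {J : ℕ} (v : CGrid J) : Prop := v 0 = 0 ∧ v (Fin.last (J + 1)) = 0

/-- The interpolation operator `I_h` onto all nodes. -/
def interp (xa xb : ℝ) (J : ℕ) (z : ℝ → ℂ) : CGrid J :=
  fun j => z (node xa xb J j)

/-- The interpolation operator onto interior nodes, with value zero at the end nodes. -/
def interp₀ (xa xb : ℝ) (J : ℕ) (z : ℝ → ℂ) : CGrid J :=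
  fun j => if 0 < (j : ℕ) ∧ (j : ℕ) < J + 1 then z (node xa xb J j) else 0

/-- The discrete Laplacian: the central second difference at interior nodes, zero at end nodes. -/
def discLaplacian {J : ℕ} (h : ℝ) (v : CGrid J) : CGrid J :=
  fun j =>
    if hj : 0 < (j : ℕ) ∧ (j : ℕ) < J + 1 then
      (v ⟨(j : ℕ) - 1, by omega⟩ - 2 * v j + v ⟨(j : ℕ) + 1, by omega⟩) / (h : ℂ) ^ 2
    else 0

/-- The discrete derivative `(v_{j+1} - v_j) / h`, `j = 0, …, J`. -/
def discDeriv {J : ℕ} (h : ℝ) (v : CGrid J) : Fin (J + 1) → ℂ :=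
  fun j => (v j.succ - v j.castSucc) / (h : ℂ)

/-- The discrete `L²` norm. -/
def normL2 {J : ℕ} (h : ℝ) (v : CGrid J) : ℝ := √(h * ∑ j, ‖v j‖ ^ 2)

/-- The discrete `H¹` seminorm. -/
def seminormH1 {J : ℕ} (h : ℝ) (v : CGrid J) : ℝ := √(h * ∑ j, ‖discDeriv h v j‖ ^ 2)

/-- The discrete `H¹` norm. -/
def normH1 {J : ℕ} (h : ℝ) (v : CGrid J) : ℝ := √(normL2 h v ^ 2 + seminormH1 h v ^ 2)

/-! The discrete elliptic projection -/

/-- `R` vanishes at the ends and `Δ_h R` is the interior interpolant of `v''`; derivatives are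
taken within the closed interval. -/
def IsEllipticProj (xa xb : ℝ) (J : ℕ) (v : ℝ → ℂ) (R : CGrid J) : Prop :=
  VanishesAtEnds R ∧
    discLaplacian (meshWidth xa xb J) R =
      interp₀ xa xb J (iteratedDerivWithin 2 v (Set.Icc xa xb))

theorem meshWidth_pos {xa xb : ℝ} (hab : xa < xb) (J : ℕ) : 0 < meshWidth xa xb J :=
  div_pos (sub_pos.2 hab) (by positivity)

/-- The elliptic projection exists and is unique. -/
theorem existsUnique_isEllipticProj {xa xb : ℝ} (hab : xa < xb) (J : ℕ) (v : ℝ → ℂ) :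
    ∃! R : CGrid J, IsEllipticProj xa xb J v R := by
  have hh : ((meshWidth xa xb J : ℝ) : ℂ) ≠ 0 :=
    Complex.ofReal_ne_zero.2 (meshWidth_pos hab J).ne'
  unfold IsEllipticProj
  generalize meshWidth xa xb J = h at hh
  generalize iteratedDerivWithin 2 v (Set.Icc xa xb) = z
  have hJ : ((J : ℂ) + 1) ≠ 0 := by exact_mod_cast Nat.succ_ne_zero J
  let c : ℕ → ℂ := fun i => (h : ℂ) ^ 2 * z (node xa xb J i)
  let w : ℕ → ℂ := fun j => ∑ i ∈ Finset.range j, ((j : ℂ) - i) * c i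
  have hw1 : ∀ j, w (j + 1) - w j = ∑ i ∈ Finset.range (j + 1), c i := by
    intro j
    simp only [w]
    rw [Finset.sum_range_succ, Finset.sum_range_succ, add_sub_right_comm,
      ← Finset.sum_sub_distrib]
    congr 1
    · exact Finset.sum_congr rfl fun i _ => by push_cast; ring
    · push_cast; ring
  have hw2 : ∀ j, w j - 2 * w (j + 1) + w (j + 2) = c (j + 1) := by
    intro j
    have h1 := hw1 j
    have h2 := hw1 (j + 1)
    rw [Finset.sum_range_succ, ← h1] at h2
    linear_combination h2
  refine ⟨fun j => w j - (j : ℕ) / ((J : ℂ) + 1) * w (J + 1), ⟨⟨?_, ?_⟩, ?_⟩, ?_⟩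
  · simp [w]
  · simp [div_self hJ]
  · funext j
    simp only [discLaplacian, interp₀]
    split_ifs with hj
    · obtain ⟨k, hk⟩ : ∃ k, (j : ℕ) = k + 1 := ⟨(j : ℕ) - 1, by omega⟩
      have h3 := hw2 k
      have e : c (k + 1) = (h : ℂ) ^ 2 * z (node xa xb J (k + 1 : ℕ)) := rfl
      rw [div_eq_iff (pow_ne_zero 2 hh)]
      simp only [hk, Nat.add_sub_cancel]
      rw [e] at h3
      push_cast
      linear_combination h3
    · rfl
  · rintro R ⟨⟨hR0, hR1⟩, hR⟩
    set Q : CGrid J := fun j => w j - (j : ℕ) / ((J : ℂ) + 1) * w (J + 1) with hQ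
    let d : ℕ → ℂ := fun j => if hj : j < J + 2 then R ⟨j, hj⟩ - Q ⟨j, hj⟩ else 0
    have hd0 : d 0 = 0 := by
      have h0 : R ⟨0, by omega⟩ = 0 := hR0
      simp only [d]
      rw [dif_pos (by omega), h0]
      simp [hQ, w]
    have hdJ : d (J + 1) = 0 := by
      have : R ⟨J + 1, by omega⟩ = 0 := hR1
      simp [d, this, hQ, div_self hJ]
    have hd2 : ∀ k, k < J → d k - 2 * d (k + 1) + d (k + 2) = 0 := by
      intro k hk
      have h3 := congrFun hR ⟨k + 1, by omega⟩
      simp only [discLaplacian, interp₀] at h3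
      rw [dif_pos ⟨by omega, by omega⟩, if_pos ⟨by omega, by omega⟩,
        div_eq_iff (pow_ne_zero 2 hh)] at h3
      have h4 := hw2 k
      have e : c (k + 1) = (h : ℂ) ^ 2 * z (node xa xb J (k + 1 : ℕ)) := rfl
      rw [e] at h4
      simp only [Nat.add_sub_cancel] at h3
      simp only [d, hQ]
      rw [dif_pos (by omega), dif_pos (by omega), dif_pos (by omega)]
      push_cast
      linear_combination h3 - h4
    have hlin : ∀ k, k < J + 1 → d k = k * d 1 ∧ d (k + 1) = (k + 1) * d 1 := by
      intro k
      induction k with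
      | zero => intro _; simp [hd0]
      | succ k ih =>
        intro hk
        obtain ⟨h1, h2⟩ := ih (by omega)
        have h3 := hd2 k (by omega)
        refine ⟨by push_cast; exact h2, ?_⟩
        push_cast
        linear_combination h3 - h1 + 2 * h2
    have hd1 : d 1 = 0 := by
      have h1 := (hlin J (by omega)).2
      rw [hdJ] at h1
      exact (mul_eq_zero.1 h1.symm).resolve_left hJ
    funext j
    have h5 : d j = 0 := by
      rcases Nat.lt_or_ge (j : ℕ) (J + 1) with hj | hj
      · rw [(hlin j hj).1, hd1, mul_zero]
      · have : (j : ℕ) = J + 1 := by omega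
        rw [this, hdJ]
    have h6 : d j = R j - Q j := by simp [d]
    exact sub_eq_zero.1 (h6 ▸ h5)

/-- The discrete elliptic projection `R_h[v]`: the mesh function singled out by
`IsEllipticProj` (it exists and is unique by `existsUnique_isEllipticProj`). -/
def ellipticProj (xa xb : ℝ) (J : ℕ) (v : ℝ → ℂ) : CGrid J :=
  Classical.epsilon (IsEllipticProj xa xb J v)

theorem ellipticProj_spec {xa xb : ℝ} (hab : xa < xb) (J : ℕ) (v : ℝ → ℂ) :
    IsEllipticProj xa xb J v (ellipticProj xa xb J v) :=
  Classical.epsilon_spec (existsUnique_isEllipticProj hab J v).exists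

/-! The mollifier -/

/-- The Hermite polynomial `p_δ` of degree at most seven, written in the variable
`s = (x - δ) / δ`; see `hermitePoly_spec` for the conditions that determine it. -/
def hermitePoly (δ : ℝ) : Polynomial ℝ :=
  let s : Polynomial ℝ := Polynomial.C δ⁻¹ * (Polynomial.X - Polynomial.C δ)
  Polynomial.C δ * (1 + s + 15 * s ^ 4 - 39 * s ^ 5 + 34 * s ^ 6 - 10 * s ^ 7)

/-- `p_δ` has degree at most seven and satisfies the eight interpolation conditions
`p(δ) = δ`, `p'(δ) = 1`, `p''(δ) = p'''(δ) = 0`, `p(2δ) = 2δ`, `p'(2δ) = p''(2δ) = p'''(2δ) = 0`. -/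
theorem hermitePoly_spec {δ : ℝ} (hδ : 0 < δ) :
    (hermitePoly δ).natDegree ≤ 7 ∧
    (hermitePoly δ).eval δ = δ ∧
    (hermitePoly δ).derivative.eval δ = 1 ∧
    (hermitePoly δ).derivative.derivative.eval δ = 0 ∧
    (hermitePoly δ).derivative.derivative.derivative.eval δ = 0 ∧
    (hermitePoly δ).eval (2 * δ) = 2 * δ ∧
    (hermitePoly δ).derivative.eval (2 * δ) = 0 ∧
    (hermitePoly δ).derivative.derivative.eval (2 * δ) = 0 ∧
    (hermitePoly δ).derivative.derivative.derivative.eval (2 * δ) = 0 := by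
  have h0 : δ ≠ 0 := hδ.ne'
  have e : 2 * δ - δ = δ := by ring
  refine ⟨?_, ?_, ?_, ?_, ?_, ?_, ?_, ?_, ?_⟩
  · have hs : (Polynomial.C δ⁻¹ * (Polynomial.X - Polynomial.C δ)).natDegree ≤ 1 := by
      compute_degree
    have hp : ∀ (k n : ℕ), n ≤ 7 →
        ((k : Polynomial ℝ) * (Polynomial.C δ⁻¹ * (Polynomial.X - Polynomial.C δ)) ^ n).natDegree
          ≤ 7 := by
      intro k n hn
      refine Polynomial.natDegree_mul_le.trans ?_
      have := Polynomial.natDegree_pow_le_of_le n hs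
      rw [Polynomial.natDegree_natCast]
      omega
    have hsub : ∀ p q : Polynomial ℝ, p.natDegree ≤ 7 → q.natDegree ≤ 7 →
        (p - q).natDegree ≤ 7 := fun p q h1 h2 =>
      (Polynomial.natDegree_sub_le_of_le h1 h2).trans (max_self 7).le
    refine (Polynomial.natDegree_C_mul_le _ _).trans ?_
    refine hsub _ _ ?_ (by exact_mod_cast hp 10 7 le_rfl)
    refine Polynomial.natDegree_add_le_of_degree_le ?_ (by exact_mod_cast hp 34 6 (by norm_num))
    refine hsub _ _ ?_ (by exact_mod_cast hp 39 5 (by norm_num))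
    refine Polynomial.natDegree_add_le_of_degree_le ?_ (by exact_mod_cast hp 15 4 (by norm_num))
    exact Polynomial.natDegree_add_le_of_degree_le (by simp) (hs.trans (by norm_num))
  all_goals
    simp [hermitePoly, Polynomial.derivative_pow, Polynomial.derivative_mul, e, h0]
  all_goals try norm_num
  all_goals try (field_simp; try norm_num)

/-- The real mollifier `𝔫_δ` on the half-line `x ≥ 0`. -/
def mollifierNonneg (δ x : ℝ) : ℝ :=
  if x ≤ δ then x else if x ≤ 2 * δ then (hermitePoly δ).eval x else 2 * δ

/-- The real mollifier `𝔫_δ`: the odd extension of `mollifierNonneg`. -/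
def mollifier (δ x : ℝ) : ℝ :=
  if 0 ≤ x then mollifierNonneg δ x else -mollifierNonneg δ (-x)

/-- The complex mollifier `γ_δ(z) = 𝔫_δ(Re z) + i 𝔫_δ(Im z)`. -/
def cMollifier (δ : ℝ) (z : ℂ) : ℂ :=
  (mollifier δ z.re : ℂ) + Complex.I * (mollifier δ z.im : ℂ)

/-! The continuous problem -/

/-- The closed space-time rectangle `Q = [0,T] × [x_a,x_b]`. -/
def rect (T xa xb : ℝ) : Set (ℝ × ℝ) := Set.Icc 0 T ×ˢ Set.Icc xa xb

/-- `u` solves `u_t = i u_xx + i g(|u|²) u + f` on `Q`, with homogeneous Dirichlet boundary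
values and initial value `u₀`. Derivatives are taken within `[0,T]` and `[x_a,x_b]`, so they are
one-sided at the ends. -/
structure IsNLSSolution (T xa xb : ℝ) (g : ℝ → ℝ) (f : ℝ → ℝ → ℂ) (u₀ : ℝ → ℂ)
    (u : ℝ → ℝ → ℂ) : Prop where
  pde : ∀ t ∈ Set.Icc 0 T, ∀ x ∈ Set.Icc xa xb,
    derivWithin (fun s => u s x) (Set.Icc 0 T) t =
      Complex.I * iteratedDerivWithin 2 (u t) (Set.Icc xa xb) x +
        Complex.I * (g (‖u t x‖ ^ 2) : ℂ) * u t x + f t x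
  boundary : ∀ t ∈ Set.Icc 0 T, u t xa = 0 ∧ u t xb = 0
  initial : ∀ x ∈ Set.Icc xa xb, u 0 x = u₀ x

/-- `u_max`, the maximum of `|u|` over `Q`. -/
def uMax (T xa xb : ℝ) (u : ℝ → ℝ → ℂ) : ℝ :=
  sSup ((fun p : ℝ × ℝ => ‖u p.1 p.2‖) '' rect T xa xb)

/-- `g_max`, the maximum of `|g(|u|²)|` over `Q`. -/
def gMax (T xa xb : ℝ) (g : ℝ → ℝ) (u : ℝ → ℝ → ℂ) : ℝ :=
  sSup ((fun p : ℝ × ℝ => |g (‖u p.1 p.2‖ ^ 2)|) '' rect T xa xb)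

/-! The modified relaxation finite difference scheme -/

/-- `V n` (`0 ≤ n ≤ N`) and `Φ n`, which stands for `Φ^{n+1/2}` (`0 ≤ n ≤ N-1`), are
approximations produced by the modified relaxation finite difference scheme with parameter `δ`,
started from `Φ^{1/2} = g(|u⁰|²)`. Values of `V` and `Φ` at larger indices play no role. -/
structure IsMRFD (T xa xb : ℝ) (N J : ℕ) (δ : ℝ) (g : ℝ → ℝ) (f : ℝ → ℝ → ℂ) (u₀ : ℝ → ℂ)
    (V : ℕ → CGrid J) (Φ : ℕ → RGrid J) : Prop where
  vanishes : ∀ n ≤ N, VanishesAtEnds (V n)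
  V_zero : V 0 = ellipticProj xa xb J u₀
  Φ_zero : ∀ j, Φ 0 j = g (‖interp xa xb J u₀ j‖ ^ 2)
  Φ_step : ∀ n, 1 ≤ n → n < N → ∀ j, Φ n j = 2 * g (‖cMollifier δ (V n j)‖ ^ 2) - Φ (n - 1) j
  V_step : ∀ n < N, ∀ j,
    V (n + 1) j - V n j =
      Complex.I * (timeStep T N : ℂ) *
          discLaplacian (meshWidth xa xb J) (fun k => (V (n + 1) k + V n k) / 2) j +
        Complex.I * (timeStep T N : ℂ) *
          ((mollifier δ (Φ n j) : ℂ) * cMollifier δ ((V (n + 1) j + V n j) / 2)) +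
        (timeStep T N : ℂ) *
          interp₀ xa xb J
            (fun x => (f (((n : ℝ) + 1) * timeStep T N) x + f ((n : ℝ) * timeStep T N) x) / 2) j

/-- The error `g(|u^{m+1/2}|²) - Φ^{m+1/2}` of the relaxation variable, with
`u^{m+1/2} = I_h[u((m + 1/2) τ, ·)]`. -/
def relaxError (T xa xb : ℝ) (N J : ℕ) (g : ℝ → ℝ) (u : ℝ → ℝ → ℂ) (Φ : ℕ → RGrid J)
    (m : ℕ) : CGrid J :=
  fun j => ((g (‖interp xa xb J (u (((m : ℝ) + 1 / 2) * timeStep T N)) j‖ ^ 2) - Φ m j : ℝ) : ℂ)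

/-- The nodal error `u^m - V^m`, with `u^m = I_h[u(m τ, ·)]`. -/
def nodalError (T xa xb : ℝ) (N J : ℕ) (u : ℝ → ℝ → ℂ) (V : ℕ → CGrid J) (m : ℕ) : CGrid J :=
  fun j => interp xa xb J (u ((m : ℝ) * timeStep T N)) j - V m j

end

end RelaxNLS

/-! Let e^n = u^n - V^n and let η^n = g(|u^{n+1/2}|²) - Φ^{n+1/2}. Since δ dominates |u| and
|g(|u|²)|, the mollifiers are the identity on the exact solution, which therefore satisfies the
scheme up to consistency errors. Elsewhere they make both nonlinearities, `nonlin` and `density`,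
globally C³ with bounded derivatives. Errors are measured in the discrete H¹ seminorm `sem`: it
controls the maximum norm of mesh functions that vanish at the first node, and the linear
Crank–Nicolson step does not increase it (`sem_le_of_crankNicolson`).

Split e = ε + θ with ε the error of the elliptic projection. Then ε and its time differences carry a
factor h², and since Δ_h of the projection equals u_xx exactly at the interior nodes, θ satisfies a
Crank–Nicolson equation whose residual consists of increments of ε and a time defect of order τ³
(`error_step`).

The difficulty is the relaxation. It gives η^{n+1} + η^n = 2D^{n+1} + O(τ²), with D the difference
of the densities at u and V. Nothing is damped: an initial error of size τ survives with alternating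
sign, and estimating η one step at a time would add up N terms of size |e|. Subtracting two
consecutive relations removes the alternation and bounds η^{n+2} - η^n by the increment e^{n+2} -
e^{n+1} and terms with a factor τ (`sem_relax_step_le`). It then suffices that the increments d^n =
θ^n - θ^{n-1} are of size τ(τ+h²).

In the equation for d the forcing is iτ(𝒩^n - 𝒩^{n-1}), 𝒩 being the error of the nonlinear term. It
contains η^n - η^{n-1}, which is not small because η alternates. With Q^n = (iτ/2)(𝒩^n - 𝒩^{n-1})
the forcing is 2Q^n. Giving one half to each side turns the equation into a Crank–Nicolson step from
d^n + Q^n to d^{n+1} - Q^n, two quantities whose sum is still d^{n+1} + d^n (`diff_step`). The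
corrected increments d^n - Q^{n-1} are thus driven by Q^n + Q^{n-1}, a difference of 𝒩 over two
steps, which sees only η^n - η^{n-2} (`sem_nonlinDiff_sub_le`). A Gronwall argument closes the
coupled inequalities (`ErrorRecursion.bound`).

In H¹, second differences of a nonlinearity produce a term quadratic in the errors
(`BddC3.sem_secondDiff_le`). On fine meshes it is harmless because the induction keeps the older
error below 1; on coarse meshes an inverse inequality replaces it at the cost of a bounded factor
1/h. Hence τ and h need not be coupled. -/

namespace RelaxNLS

noncomputable section

/-! Functions with bounded derivatives up to order three -/

/-- `F` is three times continuously differentiable, and its derivatives up to order three are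
bounded. -/
structure BddC3 {E G : Type*} [NormedAddCommGroup E] [NormedSpace ℝ E] [NormedAddCommGroup G]
    [NormedSpace ℝ G] (F : E → G) : Prop where
  contDiff : ContDiff ℝ 3 F
  bound : ∃ K, ∀ k ≤ 3, ∀ x, ‖iteratedFDeriv ℝ k F x‖ ≤ K

section BddC3

variable {E G H : Type*} [NormedAddCommGroup E] [NormedSpace ℝ E] [NormedAddCommGroup G]
  [NormedSpace ℝ G] [NormedAddCommGroup H] [NormedSpace ℝ H]

theorem natCast_le_three {k : ℕ} (hk : k ≤ 3) : (k : WithTop ℕ∞) ≤ 3 := by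
  exact_mod_cast (Nat.cast_le (α := WithTop ℕ∞)).2 hk

theorem BddC3.const (c : G) : BddC3 (fun _ : E => c) := by
  refine ⟨contDiff_const, ‖c‖, fun k _ x => ?_⟩
  rcases Nat.eq_zero_or_pos k with rfl | hk
  · simp
  · rw [iteratedFDeriv_const_of_ne hk.ne']
    simp

theorem BddC3.add {F₁ F₂ : E → G} (h₁ : BddC3 F₁) (h₂ : BddC3 F₂) :
    BddC3 (fun x => F₁ x + F₂ x) := by
  obtain ⟨K₁, hK₁⟩ := h₁.bound
  obtain ⟨K₂, hK₂⟩ := h₂.bound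
  refine ⟨h₁.contDiff.add h₂.contDiff, K₁ + K₂, fun k hk x => ?_⟩
  have hk' := natCast_le_three hk
  have := iteratedFDeriv_add_apply (x := x) (h₁.contDiff.of_le hk').contDiffAt
    (h₂.contDiff.of_le hk').contDiffAt
  change ‖iteratedFDeriv ℝ k (F₁ + F₂) x‖ ≤ _
  rw [this]
  exact (norm_add_le _ _).trans (add_le_add (hK₁ k hk x) (hK₂ k hk x))

theorem BddC3.mul {A : Type*} [NormedRing A] [NormedAlgebra ℝ A] {F₁ F₂ : E → A} (h₁ : BddC3 F₁)
    (h₂ : BddC3 F₂) : BddC3 (fun x => F₁ x * F₂ x) := by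
  obtain ⟨K₁, hK₁⟩ := h₁.bound
  obtain ⟨K₂, hK₂⟩ := h₂.bound
  have hK₁0 : 0 ≤ K₁ := (norm_nonneg _).trans (hK₁ 0 (by norm_num) 0)
  refine ⟨h₁.contDiff.mul h₂.contDiff, 8 * (K₁ * K₂), fun k hk x => ?_⟩
  refine (norm_iteratedFDeriv_mul_le h₁.contDiff h₂.contDiff x (natCast_le_three hk)).trans ?_
  calc ∑ i ∈ Finset.range (k + 1),
        (k.choose i : ℝ) * ‖iteratedFDeriv ℝ i F₁ x‖ * ‖iteratedFDeriv ℝ (k - i) F₂ x‖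
      ≤ ∑ i ∈ Finset.range (k + 1), (k.choose i : ℝ) * (K₁ * K₂) := by
        refine Finset.sum_le_sum fun i hi => ?_
        rw [Finset.mem_range] at hi
        rw [mul_assoc]
        exact mul_le_mul_of_nonneg_left (mul_le_mul (hK₁ i (by omega) x) (hK₂ _ (by omega) x)
          (norm_nonneg _) hK₁0) (Nat.cast_nonneg _)
    _ = 2 ^ k * (K₁ * K₂) := by
        rw [← Finset.sum_mul]
        congr 1
        exact_mod_cast Nat.sum_range_choose k
    _ ≤ 8 * (K₁ * K₂) := by
        refine mul_le_mul_of_nonneg_right ?_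
          (mul_nonneg hK₁0 ((norm_nonneg _).trans (hK₂ 0 (by norm_num) 0)))
        calc (2 : ℝ) ^ k ≤ 2 ^ 3 := pow_le_pow_right₀ (by norm_num) hk
          _ = 8 := by norm_num

theorem BddC3.comp_clm {F : G → H} (h : BddC3 F) (L : E →L[ℝ] G) : BddC3 (fun x => F (L x)) := by
  obtain ⟨K, hK⟩ := h.bound
  refine ⟨h.contDiff.comp L.contDiff, K * max 1 ‖L‖ ^ 3, fun k hk x => ?_⟩
  have hK0 : 0 ≤ K := (norm_nonneg _).trans (hK 0 (by norm_num) 0)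
  have := L.iteratedFDeriv_comp_right h.contDiff x (natCast_le_three hk)
  change ‖iteratedFDeriv ℝ k (F ∘ L) x‖ ≤ _
  rw [this]
  refine (ContinuousMultilinearMap.norm_compContinuousLinearMap_le _ _).trans ?_
  refine mul_le_mul (hK k hk _) ?_ (Finset.prod_nonneg fun _ _ => norm_nonneg _) hK0
  rw [Finset.prod_const, Finset.card_univ, Fintype.card_fin]
  calc ‖L‖ ^ k ≤ max 1 ‖L‖ ^ k := pow_le_pow_left₀ (norm_nonneg _) (le_max_right _ _) _
    _ ≤ max 1 ‖L‖ ^ 3 := pow_le_pow_right₀ (le_max_left _ _) hk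

theorem BddC3.ofReal {F : E → ℝ} (h : BddC3 F) : BddC3 (fun x => (F x : ℂ)) := by
  obtain ⟨K, hK⟩ := h.bound
  refine ⟨Complex.ofRealCLM.contDiff.comp h.contDiff, K, fun k hk x => ?_⟩
  have := Complex.ofRealLI.norm_iteratedFDeriv_comp_left (h.contDiff.contDiffAt (x := x))
    (natCast_le_three hk)
  exact this.le.trans (hK k hk x)

/-- Composition with a function that is smooth on a half-line containing the range. -/
theorem BddC3.comp_Ici {g : ℝ → ℝ} {F : E → ℝ} (hg : ContDiffOn ℝ 3 g (Set.Ici 0)) (hF : BddC3 F)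
    (hF0 : ∀ x, 0 ≤ F x) : BddC3 (fun x => g (F x)) := by
  obtain ⟨K, hK⟩ := hF.bound
  have hu : UniqueDiffOn ℝ (Set.Ici (0 : ℝ)) := uniqueDiffOn_Ici 0
  have hbd : ∀ i : ℕ, i ≤ 3 → ∃ C, ∀ y ∈ Set.Icc 0 K,
      ‖iteratedFDerivWithin ℝ i g (Set.Ici 0) y‖ ≤ C := fun i hi =>
    isCompact_Icc.exists_bound_of_continuousOn
      ((hg.continuousOn_iteratedFDerivWithin (natCast_le_three hi) hu).mono Set.Icc_subset_Ici_self)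
  choose! C hC using hbd
  have hr : Set.range F ⊆ Set.Ici 0 := by
    rintro _ ⟨x, rfl⟩
    exact hF0 x
  have hFK : ∀ x, F x ∈ Set.Icc 0 K := fun x => ⟨hF0 x, by
    have := hK 0 (by norm_num) x
    rw [norm_iteratedFDeriv_zero] at this
    exact (le_abs_self _).trans this⟩
  set C' : ℝ := ∑ i ∈ Finset.range 4, |C i| with hC'
  have hCC : ∀ i ≤ 3, C i ≤ C' := fun i hi =>
    (le_abs_self _).trans (Finset.single_le_sum (f := fun i => |C i|) (fun _ _ => abs_nonneg _)
      (Finset.mem_range.2 (by omega)))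
  -- The bound for derivatives of a composition asks for the i-th derivative of `F` to be at most
  -- D^i, 1 ≤ i ≤ k; the maximum with 1 gives K ≤ D ≤ D^i.
  set D : ℝ := max 1 K with hD
  have hC0 : 0 ≤ C' := Finset.sum_nonneg fun _ _ => abs_nonneg _
  refine ⟨?_, 6 * C' * D ^ 3, fun k hk x => ?_⟩
  · rw [← contDiffOn_univ]
    exact hg.comp hF.contDiff.contDiffOn fun x _ => hF0 x
  · have := norm_iteratedFDeriv_comp_le' hr hu hg hF.contDiff (natCast_le_three hk) x (C := C')
      (D := D) (fun i hi => (hC i (hi.trans hk) _ (hFK x)).trans (hCC i (hi.trans hk)))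
      (fun i hi hi' => ((hK i (hi'.trans hk) x).trans (le_max_right 1 K)).trans
        (le_self_pow₀ (le_max_left 1 K) (by omega)))
    refine this.trans ?_
    have h6 : (k.factorial : ℝ) ≤ 6 := by
      exact_mod_cast (Nat.factorial_le hk).trans (by decide)
    have hDk : D ^ k ≤ D ^ 3 := pow_le_pow_right₀ (le_max_left _ _) hk
    have hD0 : 0 ≤ D := zero_le_one.trans (le_max_left _ _)
    gcongr

end BddC3

/-! Smoothness of the mollifier -/

theorem hasDerivAt_posPart_pow (n : ℕ) (x : ℝ) :
    HasDerivAt (fun x : ℝ => max x 0 ^ (n + 2)) ((n + 2) * max x 0 ^ (n + 1)) x := by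
  rcases lt_trichotomy x 0 with hx | rfl | hx
  · rw [max_eq_right hx.le, zero_pow (by omega), mul_zero]
    refine (hasDerivAt_const x (0 : ℝ)).congr_of_eventuallyEq ?_
    filter_upwards [Iio_mem_nhds hx] with y hy
    rw [max_eq_right (le_of_lt hy), zero_pow (by omega)]
  · rw [max_self, zero_pow (by omega), mul_zero, hasDerivAt_iff_isLittleO]
    simp only [max_self, sub_zero, smul_zero]
    rw [zero_pow (by omega)]
    simp only [sub_zero]
    have h1 : (fun y : ℝ => max y 0 ^ (n + 2)) =O[nhds 0] (fun y : ℝ => y ^ (n + 2)) := by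
      refine Asymptotics.IsBigO.of_bound 1 (Filter.Eventually.of_forall fun y => ?_)
      rw [one_mul, norm_pow, norm_pow]
      refine pow_le_pow_left₀ (norm_nonneg _) ?_ _
      rw [Real.norm_eq_abs, Real.norm_eq_abs, abs_of_nonneg (le_max_right _ _)]
      exact max_le (le_abs_self _) (abs_nonneg _)
    exact h1.trans_isLittleO (Asymptotics.isLittleO_pow_id (by omega))
  · rw [max_eq_left hx.le]
    have h1 := hasDerivAt_pow (n + 2) x
    have e : n + 2 - 1 = n + 1 := by omega
    rw [e] at h1
    push_cast at h1
    refine h1.congr_of_eventuallyEq ?_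
    filter_upwards [Ioi_mem_nhds hx] with y hy
    rw [max_eq_left (le_of_lt hy)]

/-- Each derivative of a power of the positive part is again such a power, of exponent one lower.
Writing the mollifier with positive parts of exponent at least four therefore gives C³ regularity at
the junctions without matching derivatives there. -/
theorem contDiff_posPart_pow (n k : ℕ) (hk : n + 1 ≤ k) :
    ContDiff ℝ n (fun x : ℝ => max x 0 ^ k) := by
  induction n generalizing k with
  | zero =>
    rw [Nat.cast_zero, contDiff_zero]
    fun_prop
  | succ n ih =>
    obtain ⟨l, rfl⟩ : ∃ l, k = l + 2 := ⟨k - 2, by omega⟩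
    rw [Nat.cast_add, Nat.cast_one, contDiff_succ_iff_deriv]
    refine ⟨fun x => (hasDerivAt_posPart_pow l x).differentiableAt, by simp, ?_⟩
    have : deriv (fun x : ℝ => max x 0 ^ (l + 2)) = fun x => ((l : ℝ) + 2) * max x 0 ^ (l + 1) :=
      funext fun x => (hasDerivAt_posPart_pow l x).deriv
    rw [this]
    exact contDiff_const.mul (ih (l + 1) (by omega))

/-- The correction of the identity on `[δ, ∞)`, in the variable `s`, cut off at `s = 1`. -/
def hermiteRamp (s : ℝ) : ℝ :=
  15 * max s 0 ^ 4 - 39 * max s 0 ^ 5 + 34 * max s 0 ^ 6 - 10 * max s 0 ^ 7 +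
    (20 * max (s - 1) 0 ^ 4 + 45 * max (s - 1) 0 ^ 5 + 36 * max (s - 1) 0 ^ 6 +
      10 * max (s - 1) 0 ^ 7)

theorem contDiff_hermiteRamp : ContDiff ℝ 3 hermiteRamp := by
  have h : ∀ k, 4 ≤ k → ContDiff ℝ 3 (fun x : ℝ => max x 0 ^ k) := fun k hk =>
    contDiff_posPart_pow 3 k (by omega)
  have h' : ∀ k, 4 ≤ k → ContDiff ℝ 3 (fun x : ℝ => max (x - 1) 0 ^ k) := fun k hk =>
    (h k hk).comp (contDiff_id.sub contDiff_const)
  unfold hermiteRamp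
  refine ContDiff.add (ContDiff.sub (ContDiff.add (ContDiff.sub ?_ ?_) ?_) ?_)
    (ContDiff.add (ContDiff.add (ContDiff.add ?_ ?_) ?_) ?_) <;>
    exact contDiff_const.mul (by first | exact h _ (by norm_num) | exact h' _ (by norm_num))

/-- With x = δ(1 + s) the saturated value 2δ means that the ramp must equal 1 - s for s ≥ 1. The
polynomial differs from 1 - s there by a Taylor expansion at s = 1 that starts at order four,
because p_δ meets the constant 2δ to third order; the second bracket of `hermiteRamp` is minus this
expansion. -/
theorem mollifierNonneg_eq {δ x : ℝ} (hδ : 0 < δ) :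
    mollifierNonneg δ x = x + δ * hermiteRamp (δ⁻¹ * (x - δ)) := by
  have hx : x = δ * (1 + δ⁻¹ * (x - δ)) := by field_simp; ring
  unfold mollifierNonneg hermiteRamp
  set s := δ⁻¹ * (x - δ) with hs
  split_ifs with h1 h2
  · have : s ≤ 0 := mul_nonpos_of_nonneg_of_nonpos (inv_nonneg.2 hδ.le) (by linarith)
    rw [max_eq_right this, max_eq_right (by linarith)]
    ring
  · have h3 : 0 ≤ s := mul_nonneg (inv_nonneg.2 hδ.le) (by linarith)
    have h4 : s ≤ 1 := by
      rw [hs, inv_mul_le_iff₀ hδ]; linarith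
    rw [max_eq_left h3, max_eq_right (by linarith)]
    have : (hermitePoly δ).eval x =
        δ * (1 + s + 15 * s ^ 4 - 39 * s ^ 5 + 34 * s ^ 6 - 10 * s ^ 7) := by
      simp [hermitePoly, hs]
    rw [this]
    linear_combination -hx
  · have h4 : 1 ≤ s := by
      rw [hs, le_inv_mul_iff₀ hδ]; linarith
    rw [max_eq_left (by linarith), max_eq_left (by linarith)]
    linear_combination -hx

theorem hermiteRamp_of_nonpos {s : ℝ} (hs : s ≤ 0) : hermiteRamp s = 0 := by
  unfold hermiteRamp
  rw [max_eq_right hs, max_eq_right (by linarith)]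
  norm_num

theorem mollifier_eq {δ : ℝ} (hδ : 0 < δ) (x : ℝ) :
    mollifier δ x =
      x + δ * hermiteRamp (δ⁻¹ * (x - δ)) - δ * hermiteRamp (δ⁻¹ * (-x - δ)) := by
  have h0 : ∀ y : ℝ, y ≤ 0 → hermiteRamp (δ⁻¹ * (y - δ)) = 0 := fun y hy =>
    hermiteRamp_of_nonpos (mul_nonpos_of_nonneg_of_nonpos (inv_nonneg.2 hδ.le) (by linarith))
  unfold mollifier
  split_ifs with h
  · rw [mollifierNonneg_eq hδ, h0 (-x) (by linarith)]
    ring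
  · rw [mollifierNonneg_eq hδ, h0 x (by linarith)]
    ring

theorem mollifier_of_abs_le {δ x : ℝ} (hx : |x| ≤ δ) : mollifier δ x = x := by
  rw [abs_le] at hx
  unfold mollifier mollifierNonneg
  split_ifs <;> first | rfl | linarith

theorem mollifier_of_two_mul_lt {δ x : ℝ} (hδ : 0 < δ) (hx : 2 * δ < x) :
    mollifier δ x = 2 * δ := by
  unfold mollifier mollifierNonneg
  split_ifs <;> first | rfl | linarith

theorem mollifier_of_lt_neg {δ x : ℝ} (hδ : 0 < δ) (hx : x < -(2 * δ)) :
    mollifier δ x = -(2 * δ) := by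
  unfold mollifier mollifierNonneg
  split_ifs <;> first | rfl | linarith

theorem contDiff_mollifier {δ : ℝ} (hδ : 0 < δ) : ContDiff ℝ 3 (mollifier δ) := by
  rw [funext (mollifier_eq hδ)]
  refine (contDiff_id.add (contDiff_const.mul (contDiff_hermiteRamp.comp ?_))).sub
    (contDiff_const.mul (contDiff_hermiteRamp.comp ?_))
  · exact contDiff_const.mul (contDiff_id.sub contDiff_const)
  · exact contDiff_const.mul (contDiff_id.neg.sub contDiff_const)

/-- The derivatives are continuous, hence bounded on the compact interval [-2δ, 2δ], and outside it
the function is locally constant. -/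
theorem bddC3_mollifier {δ : ℝ} (hδ : 0 < δ) : BddC3 (mollifier δ) := by
  have hc := contDiff_mollifier hδ
  have hbd : ∀ i : ℕ, i ≤ 3 → ∃ C, ∀ y ∈ Set.Icc (-(2 * δ)) (2 * δ),
      ‖iteratedFDeriv ℝ i (mollifier δ) y‖ ≤ C := fun i hi =>
    isCompact_Icc.exists_bound_of_continuousOn
      (hc.continuous_iteratedFDeriv (natCast_le_three hi)).continuousOn
  choose! C hC using hbd
  obtain ⟨K₁, hK₁⟩ := (BddC3.const (E := ℝ) (2 * δ)).bound
  obtain ⟨K₂, hK₂⟩ := (BddC3.const (E := ℝ) (-(2 * δ))).bound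
  set C' : ℝ := ∑ i ∈ Finset.range 4, |C i| with hC'
  have hCC : ∀ i ≤ 3, C i ≤ C' := fun i hi =>
    (le_abs_self _).trans (Finset.single_le_sum (f := fun i => |C i|) (fun _ _ => abs_nonneg _)
      (Finset.mem_range.2 (by omega)))
  refine ⟨hc, max C' (max K₁ K₂), fun k hk x => ?_⟩
  rcases lt_or_ge (2 * δ) x with h1 | h1
  · have : mollifier δ =ᶠ[nhds x] fun _ => 2 * δ := by
      filter_upwards [Ioi_mem_nhds h1] with y hy
      exact mollifier_of_two_mul_lt hδ hy
    rw [(this.iteratedFDeriv ℝ k).eq_of_nhds]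
    exact (hK₁ k hk x).trans ((le_max_left _ _).trans (le_max_right _ _))
  rcases lt_or_ge x (-(2 * δ)) with h2 | h2
  · have : mollifier δ =ᶠ[nhds x] fun _ => -(2 * δ) := by
      filter_upwards [Iio_mem_nhds h2] with y hy
      exact mollifier_of_lt_neg hδ hy
    rw [(this.iteratedFDeriv ℝ k).eq_of_nhds]
    exact (hK₂ k hk x).trans ((le_max_right _ _).trans (le_max_right _ _))
  · exact ((hC k hk x ⟨h2, h1⟩).trans (hCC k hk)).trans (le_max_left _ _)

theorem bddC3_cMollifier {δ : ℝ} (hδ : 0 < δ) : BddC3 (cMollifier δ) :=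
  ((bddC3_mollifier hδ).comp_clm Complex.reCLM).ofReal.add
    ((BddC3.const Complex.I).mul ((bddC3_mollifier hδ).comp_clm Complex.imCLM).ofReal)

theorem cMollifier_of_norm_le {δ : ℝ} {z : ℂ} (hz : ‖z‖ ≤ δ) : cMollifier δ z = z := by
  unfold cMollifier
  rw [mollifier_of_abs_le ((Complex.abs_re_le_norm z).trans hz),
    mollifier_of_abs_le ((Complex.abs_im_le_norm z).trans hz), mul_comm, Complex.re_add_im]

theorem norm_cMollifier_sq (δ : ℝ) (z : ℂ) :
    ‖cMollifier δ z‖ ^ 2 = mollifier δ z.re * mollifier δ z.re + mollifier δ z.im * mollifier δ z.im := by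
  rw [← Complex.normSq_eq_norm_sq, Complex.normSq_apply]
  simp [cMollifier]

/-- The nonlinearity of the scheme, as a function of the relaxation variable and the solution. -/
def nonlin (δ : ℝ) (p : ℝ × ℂ) : ℂ := (mollifier δ p.1 : ℂ) * cMollifier δ p.2

theorem bddC3_nonlin {δ : ℝ} (hδ : 0 < δ) : BddC3 (nonlin δ) :=
  ((bddC3_mollifier hδ).comp_clm (ContinuousLinearMap.fst ℝ ℝ ℂ)).ofReal.mul
    ((bddC3_cMollifier hδ).comp_clm (ContinuousLinearMap.snd ℝ ℝ ℂ))

/-- No growth condition on `g` is needed, since the mollified modulus stays in a bounded interval.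
Its square is a sum of squares of mollified coordinates, so the lack of smoothness of the norm at 0
does not matter. -/
theorem bddC3_density {δ : ℝ} (hδ : 0 < δ) {g : ℝ → ℝ} (hg : ContDiffOn ℝ 3 g (Set.Ici 0)) :
    BddC3 (fun z : ℂ => g (‖cMollifier δ z‖ ^ 2)) := by
  refine BddC3.comp_Ici hg ?_ fun _ => sq_nonneg _
  have h1 := (bddC3_mollifier hδ).comp_clm Complex.reCLM
  have h2 := (bddC3_mollifier hδ).comp_clm Complex.imCLM
  simp only [norm_cMollifier_sq]
  exact (h1.mul h1).add (h2.mul h2)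

end

end RelaxNLS

namespace RelaxNLS

noncomputable section

/-! Second differences of functions with bounded derivatives -/

section SecondDiff

variable {E G : Type*} [NormedAddCommGroup E] [NormedSpace ℝ E] [NormedAddCommGroup G]
  [NormedSpace ℝ G]

theorem norm_image_sub_le_of_fderiv_bound {P : E → G} {K : ℝ} (hP : Differentiable ℝ P)
    (hb : ∀ x, ‖fderiv ℝ P x‖ ≤ K) (x y : E) : ‖P x - P y‖ ≤ K * ‖x - y‖ :=
  convex_univ.norm_image_sub_le_of_norm_fderiv_le (fun z _ => hP z) (fun z _ => hb z)
    (Set.mem_univ _) (Set.mem_univ _)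

theorem norm_fderiv_eq_iteratedFDeriv (P : E → G) (x : E) :
    ‖fderiv ℝ P x‖ = ‖iteratedFDeriv ℝ 1 P x‖ := by
  rw [← norm_iteratedFDeriv_zero (𝕜 := ℝ) (f := fderiv ℝ P), norm_iteratedFDeriv_fderiv]

theorem norm_image_sub_le_of_iteratedFDeriv_bound {P : E → G} {K : ℝ} (hP : Differentiable ℝ P)
    (hb : ∀ x, ‖iteratedFDeriv ℝ 1 P x‖ ≤ K) (x y : E) : ‖P x - P y‖ ≤ K * ‖x - y‖ :=
  norm_image_sub_le_of_fderiv_bound hP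
    (fun x => (norm_fderiv_eq_iteratedFDeriv P x).le.trans (hb x)) x y

/-- The map z ↦ P z - P (z - x) has derivative of norm at most K‖x‖, so moving the base point from b
to a costs K‖x‖‖a - b‖. Replacing x by y at the base point b costs K‖x - y‖. -/
theorem norm_secondDiff_le {P : E → G} {K : ℝ} (hP : Differentiable ℝ P)
    (hb : ∀ x, ‖fderiv ℝ P x‖ ≤ K)
    (hlip : ∀ x y, ‖fderiv ℝ P x - fderiv ℝ P y‖ ≤ K * ‖x - y‖) (a b x y : E) :
    ‖P a - P (a - x) - (P b - P (b - y))‖ ≤ K * (‖x - y‖ + ‖a - b‖ * ‖x‖) := by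
  have hd : ∀ z, HasFDerivAt (fun p => P p - P (p - x)) (fderiv ℝ P z - fderiv ℝ P (z - x)) z :=
    fun z => (hP z).hasFDerivAt.sub
      ((hP (z - x)).hasFDerivAt.comp z ((hasFDerivAt_id z).sub_const x))
  have h1 : ‖(P a - P (a - x)) - (P b - P (b - x))‖ ≤ (K * ‖x‖) * ‖a - b‖ :=
    convex_univ.norm_image_sub_le_of_norm_hasFDerivWithin_le
      (fun z _ => (hd z).hasFDerivWithinAt)
      (fun z _ => by simpa using hlip z (z - x)) (Set.mem_univ b) (Set.mem_univ a)
  have h2 := norm_image_sub_le_of_fderiv_bound hP hb (b - y) (b - x)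
  rw [sub_sub_sub_cancel_left] at h2
  have e : P a - P (a - x) - (P b - P (b - y)) =
      (P a - P (a - x) - (P b - P (b - x))) + (P (b - y) - P (b - x)) := by abel
  rw [e]
  refine (norm_add_le _ _).trans ?_
  linarith

/-- The last clause is `norm_secondDiff_le` applied to the derivative of `F`; it is where the bound
on third derivatives enters. -/
theorem BddC3.exists_lipschitz {F : E → G} (hF : BddC3 F) :
    ∃ K, 0 < K ∧ Differentiable ℝ F ∧ (∀ x, ‖fderiv ℝ F x‖ ≤ K) ∧
      (∀ x y, ‖fderiv ℝ F x - fderiv ℝ F y‖ ≤ K * ‖x - y‖) ∧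
      (∀ a b x y, ‖F a - F (a - x) - (F b - F (b - y))‖ ≤ K * (‖x - y‖ + ‖a - b‖ * ‖x‖)) ∧
      (∀ a b x y, ‖fderiv ℝ F a - fderiv ℝ F (a - x) - (fderiv ℝ F b - fderiv ℝ F (b - y))‖ ≤
        K * (‖x - y‖ + ‖a - b‖ * ‖x‖)) := by
  obtain ⟨K₀, hK₀⟩ := hF.bound
  set K := max 1 K₀ with hK
  have hb : ∀ k ≤ 3, ∀ x, ‖iteratedFDeriv ℝ k F x‖ ≤ K := fun k hk x =>
    (hK₀ k hk x).trans (le_max_right _ _)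
  have hd1 : Differentiable ℝ F := hF.contDiff.differentiable (by norm_num)
  have hc1 : ContDiff ℝ 2 (fderiv ℝ F) := hF.contDiff.fderiv_right (by norm_num)
  have hd2 : Differentiable ℝ (fderiv ℝ F) := hc1.differentiable (by norm_num)
  have hc2 : ContDiff ℝ 1 (fderiv ℝ (fderiv ℝ F)) := hc1.fderiv_right (by norm_num)
  have hd3 : Differentiable ℝ (fderiv ℝ (fderiv ℝ F)) := hc2.differentiable (by norm_num)
  have b1 : ∀ x, ‖fderiv ℝ F x‖ ≤ K := fun x => by
    rw [norm_fderiv_eq_iteratedFDeriv]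
    exact hb 1 (by norm_num) x
  have b2 : ∀ x, ‖fderiv ℝ (fderiv ℝ F) x‖ ≤ K := fun x => by
    rw [norm_fderiv_eq_iteratedFDeriv, norm_iteratedFDeriv_fderiv]
    exact hb 2 (by norm_num) x
  have l1 := norm_image_sub_le_of_fderiv_bound hd2 b2
  have l2 := norm_image_sub_le_of_iteratedFDeriv_bound (P := fderiv ℝ (fderiv ℝ F)) hd3
    (K := K) fun x => by
    rw [norm_iteratedFDeriv_fderiv, norm_iteratedFDeriv_fderiv]
    exact hb 3 le_rfl x
  exact ⟨K, lt_of_lt_of_le one_pos (le_max_left _ _), hd1, b1, l1, norm_secondDiff_le hd1 b1 l1,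
    norm_secondDiff_le hd2 b2 l2⟩

/-- The increment of a second difference between two quadruples of points. -/
theorem norm_secondDiff_sub_le {F : E → G} {K : ℝ} (hd : Differentiable ℝ F)
    (hb : ∀ x, ‖fderiv ℝ F x‖ ≤ K)
    (hl : ∀ x y, ‖fderiv ℝ F x - fderiv ℝ F y‖ ≤ K * ‖x - y‖)
    (hs : ∀ a b x y,
      ‖fderiv ℝ F a - fderiv ℝ F (a - x) - (fderiv ℝ F b - fderiv ℝ F (b - y))‖ ≤
        K * (‖x - y‖ + ‖a - b‖ * ‖x‖))
    {a b x y a' b' x' y' : E} {A X Y : ℝ} (hK : 0 ≤ K)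
    (hA : ‖a - b‖ ≤ A) (hA' : ‖a' - b'‖ ≤ A) (hX : ‖x‖ ≤ X) (hX' : ‖x'‖ ≤ X)
    (hY : ‖x - y‖ ≤ Y) (hY' : ‖x' - y'‖ ≤ Y) :
    ‖F a' - F (a' - x') - (F b' - F (b' - y')) - (F a - F (a - x) - (F b - F (b - y)))‖ ≤
      K * X * ‖(a' - b') - (a - b)‖ + K * (Y + A * X) * ‖b' - b‖ +
        K * ‖(x' - y') - (x - y)‖ + K * (A + Y) * ‖y' - y‖ := by
  have hX0 := (norm_nonneg _).trans hX
  have hY0 := (norm_nonneg _).trans hY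
  have hA0 := (norm_nonneg _).trans hA
  have hpath : ∀ (p q : E) (s : ℝ),
      HasDerivAt (fun s : ℝ => F (p + s • q)) (fderiv ℝ F (p + s • q) q) s := fun p q s => by
    have h1 : HasDerivAt (fun s : ℝ => p + s • q) q s := by
      simpa using ((hasDerivAt_id s).smul_const q).const_add p
    exact (hd (p + s • q)).hasFDerivAt.comp_hasDerivAt s h1
  -- The two quadruples are joined by segments. The bounds A, X, Y on a - b, x and x - y are convex
  -- conditions, so they persist along the path, and the mean value inequality applies on [0, 1].
  let Ψ : ℝ → G := fun s => F (a + s • (a' - a)) - F ((a - x) + s • ((a' - x') - (a - x))) -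
    (F (b + s • (b' - b)) - F ((b - y) + s • ((b' - y') - (b - y))))
  have hΨ : ∀ s : ℝ, HasDerivAt Ψ (fderiv ℝ F (a + s • (a' - a)) (a' - a) -
      fderiv ℝ F ((a - x) + s • ((a' - x') - (a - x))) ((a' - x') - (a - x)) -
      (fderiv ℝ F (b + s • (b' - b)) (b' - b) -
      fderiv ℝ F ((b - y) + s • ((b' - y') - (b - y))) ((b' - y') - (b - y)))) s := fun s =>
    ((hpath _ _ s).sub (hpath _ _ s)).sub ((hpath _ _ s).sub (hpath _ _ s))
  have hconv : ∀ (p p' : E) (c s : ℝ), 0 ≤ s → s ≤ 1 → ‖p‖ ≤ c → ‖p'‖ ≤ c →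
      ‖p + s • (p' - p)‖ ≤ c := by
    intro p p' c s h0 h1 hp hp'
    have e : p + s • (p' - p) = (1 - s) • p + s • p' := by module
    rw [e]
    refine (norm_add_le _ _).trans ?_
    rw [norm_smul, norm_smul, Real.norm_of_nonneg h0, Real.norm_of_nonneg (by linarith)]
    nlinarith
  have key := norm_image_sub_le_of_norm_deriv_le_segment_01' (f := Ψ)
    (C := K * X * ‖(a' - b') - (a - b)‖ + K * (Y + A * X) * ‖b' - b‖ +
        K * ‖(x' - y') - (x - y)‖ + K * (A + Y) * ‖y' - y‖)
    (fun s _ => (hΨ s).hasDerivWithinAt) (fun s hs01 => ?_)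
  · simpa [Ψ] using key
  · obtain ⟨h0, h1⟩ := hs01
    set p := a + s • (a' - a) with hp
    set q := b + s • (b' - b) with hq
    set ξ := x + s • (x' - x) with hξ
    set ζ := y + s • (y' - y) with hζ
    have e1 : (a - x) + s • ((a' - x') - (a - x)) = p - ξ := by rw [hp, hξ]; module
    have e2 : (b - y) + s • ((b' - y') - (b - y)) = q - ζ := by rw [hq, hζ]; module
    rw [e1, e2]
    have n1 : ‖ξ‖ ≤ X := hconv _ _ _ _ h0 h1.le hX hX'
    have n2 : ‖ξ - ζ‖ ≤ Y := by
      have : ξ - ζ = (x - y) + s • ((x' - y') - (x - y)) := by rw [hξ, hζ]; module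
      rw [this]
      exact hconv _ _ _ _ h0 h1.le hY hY'
    have n3 : ‖p - q‖ ≤ A := by
      have : p - q = (a - b) + s • ((a' - b') - (a - b)) := by rw [hp, hq]; module
      rw [this]
      exact hconv _ _ _ _ h0 h1.le hA hA'
    -- The velocities are regrouped so that each term is small for its own reason: a first
    -- difference of the derivative meets the change of a - b, a second difference meets the change
    -- of b, a bounded derivative meets the change of x - y, and a Lipschitz difference meets the
    -- change of y.
    have e3 : fderiv ℝ F p (a' - a) - fderiv ℝ F (p - ξ) ((a' - x') - (a - x)) -
        (fderiv ℝ F q (b' - b) - fderiv ℝ F (q - ζ) ((b' - y') - (b - y))) =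
        (fderiv ℝ F p - fderiv ℝ F (p - ξ)) ((a' - b') - (a - b)) +
        (fderiv ℝ F p - fderiv ℝ F (p - ξ) - (fderiv ℝ F q - fderiv ℝ F (q - ζ))) (b' - b) +
        fderiv ℝ F (p - ξ) ((x' - y') - (x - y)) +
        (fderiv ℝ F (p - ξ) - fderiv ℝ F (q - ζ)) (y' - y) := by
      simp only [map_sub, sub_apply]
      abel
    rw [e3]
    refine (norm_add_le _ _).trans (add_le_add ((norm_add_le _ _).trans (add_le_add
      ((norm_add_le _ _).trans (add_le_add ?_ ?_)) ?_)) ?_)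
    · refine (ContinuousLinearMap.le_opNorm _ _).trans (mul_le_mul_of_nonneg_right ?_ (norm_nonneg _))
      refine (hl _ _).trans ?_
      rw [sub_sub_cancel]
      exact mul_le_mul_of_nonneg_left n1 hK
    · refine (ContinuousLinearMap.le_opNorm _ _).trans (mul_le_mul_of_nonneg_right ?_ (norm_nonneg _))
      refine (hs _ _ _ _).trans (mul_le_mul_of_nonneg_left ?_ hK)
      exact add_le_add n2 (mul_le_mul n3 n1 (norm_nonneg _) hA0)
    · exact (ContinuousLinearMap.le_opNorm _ _).trans
        (mul_le_mul_of_nonneg_right (hb _) (norm_nonneg _))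
    · refine (ContinuousLinearMap.le_opNorm _ _).trans (mul_le_mul_of_nonneg_right ?_ (norm_nonneg _))
      refine (hl _ _).trans (mul_le_mul_of_nonneg_left ?_ hK)
      have : p - ξ - (q - ζ) = (p - q) - (ξ - ζ) := by abel
      rw [this]
      exact (norm_sub_le _ _).trans (add_le_add n3 n2)

end SecondDiff

/-! The discrete `H¹` seminorm of mesh functions with values in a normed space -/

section Sem

variable {E : Type*} [NormedAddCommGroup E] {J : ℕ}

/-- The increments of a mesh function. -/
def incr (x : Fin (J + 2) → E) : Fin (J + 1) → E := fun j => x j.succ - x j.castSucc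

/-- The discrete `H¹` seminorm. -/
def sem (h : ℝ) (x : Fin (J + 2) → E) : ℝ := ‖WithLp.toLp 2 (incr x)‖ / √h

theorem incr_add (x y : Fin (J + 2) → E) : incr (x + y) = incr x + incr y := by
  funext j; simp only [incr, Pi.add_apply]; abel

theorem incr_neg (x : Fin (J + 2) → E) : incr (-x) = -incr x := by
  funext j; simp only [incr, Pi.neg_apply]; abel

theorem norm_toLp_sq {n : ℕ} (b : Fin n → E) : ‖WithLp.toLp 2 b‖ ^ 2 = ∑ j, ‖b j‖ ^ 2 := by
  rw [PiLp.norm_sq_eq_of_L2]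

theorem norm_toLp_mono {n : ℕ} {E' : Type*} [NormedAddCommGroup E'] {b : Fin n → E}
    {c : Fin n → E'} (hbc : ∀ j, ‖b j‖ ≤ ‖c j‖) : ‖WithLp.toLp 2 b‖ ≤ ‖WithLp.toLp 2 c‖ := by
  refine le_of_sq_le_sq ?_ (norm_nonneg _)
  rw [norm_toLp_sq, norm_toLp_sq]
  exact Finset.sum_le_sum fun j _ => pow_le_pow_left₀ (norm_nonneg _) (hbc j) 2

theorem sem_nonneg (h : ℝ) (x : Fin (J + 2) → E) : 0 ≤ sem h x :=
  div_nonneg (norm_nonneg _) (Real.sqrt_nonneg _)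

theorem sem_add_le (h : ℝ) (x y : Fin (J + 2) → E) : sem h (x + y) ≤ sem h x + sem h y := by
  unfold sem
  rw [incr_add, WithLp.toLp_add, ← add_div]
  exact div_le_div_of_nonneg_right (norm_add_le _ _) (Real.sqrt_nonneg _)

theorem sem_neg (h : ℝ) (x : Fin (J + 2) → E) : sem h (-x) = sem h x := by
  unfold sem
  rw [incr_neg, WithLp.toLp_neg, norm_neg]

theorem sem_sub_le (h : ℝ) (x y : Fin (J + 2) → E) : sem h (x - y) ≤ sem h x + sem h y := by
  rw [sub_eq_add_neg, ← sem_neg h y]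
  exact sem_add_le h x (-y)

theorem sem_zero (h : ℝ) : sem h (0 : Fin (J + 2) → E) = 0 := by
  have : incr (0 : Fin (J + 2) → E) = 0 := by funext j; simp [incr]
  unfold sem
  rw [this, WithLp.toLp_zero, norm_zero, zero_div]

theorem sem_smul {𝕜 : Type*} [NormedField 𝕜] [NormedSpace 𝕜 E] (h : ℝ) (c : 𝕜)
    (x : Fin (J + 2) → E) : sem h (c • x) = ‖c‖ * sem h x := by
  have : incr (c • x) = c • incr x := by
    funext j; simp only [incr, Pi.smul_apply, smul_sub]
  unfold sem
  rw [this, WithLp.toLp_smul, norm_smul, mul_div_assoc]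

/-- Minkowski's inequality in ℓ². A constant bound c on difference quotients contributes c times the
square root of the interval length (J + 1)h. -/
theorem sem_le_of_incr_le {E₁ E₂ : Type*} [NormedAddCommGroup E₁] [NormedAddCommGroup E₂]
    {h c k d : ℝ} (hh : 0 < h) (hc : 0 ≤ c) (hk : 0 ≤ k) (hd : 0 ≤ d) {x : Fin (J + 2) → E}
    {y : Fin (J + 2) → E₁} {z : Fin (J + 2) → E₂}
    (hx : ∀ j, ‖incr x j‖ ≤ c * h + k * ‖incr y j‖ + d * ‖incr z j‖) :
    sem h x ≤ c * √((J + 1) * h) + k * sem h y + d * sem h z := by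
  let b₀ : Fin (J + 1) → ℝ := fun _ => h
  let b₁ : Fin (J + 1) → ℝ := fun j => ‖incr y j‖
  let b₂ : Fin (J + 1) → ℝ := fun j => ‖incr z j‖
  have h0 : ‖WithLp.toLp 2 b₀‖ = √((J + 1) * h) * √h := by
    rw [← Real.sqrt_mul (by positivity), EuclideanSpace.norm_eq]
    congr 1
    simp [b₀]
    ring
  have h1 : ‖WithLp.toLp 2 b₁‖ = ‖WithLp.toLp 2 (incr y)‖ :=
    le_antisymm (norm_toLp_mono fun j => by simp [b₁]) (norm_toLp_mono fun j => by simp [b₁])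
  have h2 : ‖WithLp.toLp 2 b₂‖ = ‖WithLp.toLp 2 (incr z)‖ :=
    le_antisymm (norm_toLp_mono fun j => by simp [b₂]) (norm_toLp_mono fun j => by simp [b₂])
  have h3 : ‖WithLp.toLp 2 (incr x)‖ ≤ ‖WithLp.toLp 2 (c • b₀ + k • b₁ + d • b₂)‖ := by
    refine norm_toLp_mono fun j => (hx j).trans ?_
    simp only [Pi.add_apply, Pi.smul_apply, smul_eq_mul, b₀, b₁, b₂]
    exact le_abs_self _
  have h4 : ‖WithLp.toLp 2 (incr x)‖ ≤
      c * (√((J + 1) * h) * √h) + k * ‖WithLp.toLp 2 (incr y)‖ +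
        d * ‖WithLp.toLp 2 (incr z)‖ := by
    refine h3.trans ?_
    rw [WithLp.toLp_add, WithLp.toLp_add, WithLp.toLp_smul, WithLp.toLp_smul, WithLp.toLp_smul]
    refine (norm_add₃_le).trans ?_
    rw [norm_smul, norm_smul, norm_smul, h0, h1, h2, Real.norm_of_nonneg hc,
      Real.norm_of_nonneg hk, Real.norm_of_nonneg hd]
  have hs : 0 < √h := Real.sqrt_pos.2 hh
  unfold sem
  rw [div_le_iff₀ hs]
  refine h4.trans (le_of_eq ?_)
  field_simp

theorem sem_le_of_incr_le_const {h c : ℝ} (hh : 0 < h) (hc : 0 ≤ c) {x : Fin (J + 2) → E}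
    (hx : ∀ j, ‖incr x j‖ ≤ c * h) : sem h x ≤ c * √((J + 1) * h) := by
  have := sem_le_of_incr_le (k := 0) (d := 0) (y := x) (z := x) hh hc le_rfl le_rfl (x := x)
    (fun j => by simpa using hx j)
  simpa using this

/-- An inverse inequality; the loss of 1/h is acceptable because it is used only on coarse meshes.
-/
theorem sem_le_of_norm_le {h c : ℝ} (hh : 0 < h) {x : Fin (J + 2) → E} (hx : ∀ j, ‖x j‖ ≤ c) :
    sem h x ≤ 2 * c / h * √((J + 1) * h) := by
  have hc : 0 ≤ c := (norm_nonneg _).trans (hx 0)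
  refine sem_le_of_incr_le_const hh (by positivity) fun j => ?_
  rw [div_mul_cancel₀ _ hh.ne', two_mul]
  exact (norm_sub_le _ _).trans (add_le_add (hx _) (hx _))

/-- The discrete Sobolev inequality for mesh functions that vanish at the first node. -/
theorem norm_le_sem {h : ℝ} (hh : 0 < h) {x : Fin (J + 2) → E} (hx : x 0 = 0)
    (j : Fin (J + 2)) : ‖x j‖ ≤ √((J + 1) * h) * sem h x := by
  have h1 : ‖x j‖ ≤ ∑ i, ‖incr x i‖ := by
    have : ∀ k (hk : k < J + 2), ‖x ⟨k, hk⟩‖ ≤ ∑ i : Fin (J + 1),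
        if (i : ℕ) < k then ‖incr x i‖ else 0 := by
      intro k
      induction k with
      | zero =>
        intro hk
        simp [hx]
      | succ k ih =>
        intro hk
        have h2 := ih (by omega)
        have h3 : ‖x ⟨k + 1, hk⟩‖ ≤ ‖x ⟨k, by omega⟩‖ + ‖incr x ⟨k, by omega⟩‖ := by
          have : x ⟨k + 1, hk⟩ = x ⟨k, by omega⟩ + incr x ⟨k, by omega⟩ := by
            simp [incr]
          rw [this]
          exact norm_add_le _ _
        refine h3.trans ((add_le_add_left h2 _).trans ?_)
        have h4 : ‖incr x ⟨k, by omega⟩‖ =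
            ∑ i : Fin (J + 1), if i = ⟨k, by omega⟩ then ‖incr x i‖ else 0 := by
          simp
        rw [h4, ← Finset.sum_add_distrib]
        refine Finset.sum_le_sum fun i _ => ?_
        by_cases hik : (i : ℕ) < k
        · have : i ≠ ⟨k, by omega⟩ := fun e => by simp [e] at hik
          simp [hik, this, Nat.lt_succ_of_lt hik]
        · by_cases hik' : i = ⟨k, by omega⟩
          · simp [hik']
          · have : ¬ (i : ℕ) < k + 1 := fun hlt => hik' (Fin.ext (by simp; omega))
            simp [hik, hik', this]
    refine (this j j.2).trans (Finset.sum_le_sum fun i _ => ?_)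
    split_ifs
    · exact le_rfl
    · exact norm_nonneg _
  refine h1.trans ?_
  have h2 : (∑ i, ‖incr x i‖) ^ 2 ≤ ((J : ℝ) + 1) * ∑ i, ‖incr x i‖ ^ 2 := by
    have := sq_sum_le_card_mul_sum_sq (s := Finset.univ) (f := fun i => ‖incr x i‖)
    simpa using this
  have hs : 0 < √h := Real.sqrt_pos.2 hh
  refine le_of_sq_le_sq (h2.trans (le_of_eq ?_)) (mul_nonneg (Real.sqrt_nonneg _) (sem_nonneg _ _))
  unfold sem
  rw [mul_pow, div_pow, norm_toLp_sq, Real.sq_sqrt (by positivity), Real.sq_sqrt hh.le]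
  field_simp

end Sem

/-! ### Seminorm estimates for second differences of a nonlinearity -/

section NonlinearEstimate

variable {E G : Type*} [NormedAddCommGroup E] [NormedSpace ℝ E] [NormedAddCommGroup G]
  [NormedSpace ℝ G]

/-- Here a and b are exact values at two times and x and y the corresponding errors. The first bound
is `norm_secondDiff_sub_le` between neighbouring nodes, with maximum norms replaced by seminorms
through the Sobolev inequality. Its quadratic term contains only y, which in the applications is the
older error and so is already controlled. The second bound has no quadratic term but costs 1/h. -/
theorem BddC3.sem_secondDiff_le {F : E → G} (hF : BddC3 F) (L : ℝ) {M : ℝ} (hM : 0 ≤ M) :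
    ∃ K, 0 < K ∧ ∀ (J : ℕ) (h τ : ℝ), 0 < h → ((J : ℝ) + 1) * h = L → 0 ≤ τ →
      ∀ a b x y : Fin (J + 2) → E, x 0 = 0 → y 0 = 0 → (∀ j, ‖incr b j‖ ≤ M * h) →
        (∀ j, ‖(a - b) j‖ ≤ M * τ) → (∀ j, ‖incr (a - b) j‖ ≤ M * τ * h) →
        sem h (fun j => F (a j) - F (a j - x j) - (F (b j) - F (b j - y j))) ≤
          K * (τ * sem h x + τ * sem h y + sem h (x - y) * (1 + sem h y)) ∧
        sem h (fun j => F (a j) - F (a j - x j) - (F (b j) - F (b j - y j))) ≤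
          K / h * (τ * sem h x + sem h (x - y)) := by
  obtain ⟨K, hK, hd, hb, hl, hs, hs'⟩ := hF.exists_lipschitz
  set ℓ := √L with hℓ
  have hℓ0 : 0 ≤ ℓ := Real.sqrt_nonneg _
  refine ⟨K * (1 + ℓ) ^ 2 * (2 + M) ^ 2, by positivity, ?_⟩
  intro J h τ hh hL hτ a b x y hx0 hy0 hb1 hab hab1
  have hxy0 : (x - y) 0 = 0 := by simp [hx0, hy0]
  have sx := norm_le_sem hh hx0
  have sy := norm_le_sem hh hy0
  have sxy := norm_le_sem hh hxy0
  rw [hL, ← hℓ] at sx sy sxy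
  set X := sem h x with hX
  set Y := sem h y with hY
  set D := sem h (x - y) with hD
  have hX0 : 0 ≤ X := sem_nonneg _ _
  have hY0 : 0 ≤ Y := sem_nonneg _ _
  have hD0 : 0 ≤ D := sem_nonneg _ _
  have hMτ : 0 ≤ M * τ := mul_nonneg hM hτ
  constructor
  -- The first two terms of the increment estimate are multiples of h because a - b and b are smooth
  -- samples, and together give c; the other two keep the increments of x - y and of y. The factor
  -- K(Mτ + ℓD) of the last one produces the quadratic term.
  · have := sem_le_of_incr_le (x := fun j => F (a j) - F (a j - x j) - (F (b j) - F (b j - y j)))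
      (y := x - y) (z := y) (c := K * (ℓ * X) * (M * τ) + K * (ℓ * D + M * τ * (ℓ * X)) * M)
      (k := K) (d := K * (M * τ + ℓ * D)) hh (by positivity) hK.le (by positivity) fun j => by
        have := norm_secondDiff_sub_le hd hb hl hs' hK.le (hab j.castSucc) (hab j.succ)
          (sx j.castSucc) (sx j.succ) (sxy j.castSucc) (sxy j.succ)
        refine this.trans ?_
        have h1 := hab1 j
        have h2 := hb1 j
        have t1 : K * (ℓ * X) * ‖a j.succ - b j.succ - (a j.castSucc - b j.castSucc)‖ ≤
            K * (ℓ * X) * (M * τ * h) := mul_le_mul_of_nonneg_left h1 (by positivity)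
        have t2 : K * (ℓ * D + M * τ * (ℓ * X)) * ‖b j.succ - b j.castSucc‖ ≤
            K * (ℓ * D + M * τ * (ℓ * X)) * (M * h) :=
          mul_le_mul_of_nonneg_left h2 (by positivity)
        refine (add_le_add (add_le_add (add_le_add t1 t2) le_rfl) le_rfl).trans (le_of_eq ?_)
        simp only [incr, Pi.sub_apply]
        ring
    rw [hL] at this
    refine this.trans ?_
    have p1 : 0 ≤ K * (τ * X) := by positivity
    have p2 : 0 ≤ K * (τ * Y) := by positivity
    have p3 : 0 ≤ K * D := by positivity
    have p4 : 0 ≤ K * (D * Y) := by positivity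
    have c1 : ℓ ^ 2 * (M + M * M) ≤ (1 + ℓ) ^ 2 * (2 + M) ^ 2 :=
      mul_le_mul (by nlinarith) (by nlinarith) (by positivity) (by positivity)
    have c2 : M ≤ (1 + ℓ) ^ 2 * (2 + M) ^ 2 := by
      have : (1:ℝ) * M ≤ (1 + ℓ) ^ 2 * (2 + M) ^ 2 :=
        mul_le_mul (by nlinarith) (by nlinarith) hM (by positivity)
      linarith
    have c3 : 1 + ℓ ^ 2 * M ≤ (1 + ℓ) ^ 2 * (2 + M) ^ 2 := by
      have : (1 + ℓ ^ 2) * (1 + M) ≤ (1 + ℓ) ^ 2 * (2 + M) ^ 2 :=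
        mul_le_mul (by nlinarith) (by nlinarith) (by positivity) (by positivity)
      nlinarith [sq_nonneg ℓ]
    have c4 : ℓ ≤ (1 + ℓ) ^ 2 * (2 + M) ^ 2 := by
      have : ℓ * 1 ≤ (1 + ℓ) ^ 2 * (2 + M) ^ 2 :=
        mul_le_mul (by nlinarith) (by nlinarith) (by positivity) (by positivity)
      linarith
    have q1 := mul_le_mul_of_nonneg_right c1 p1
    have q2 := mul_le_mul_of_nonneg_right c2 p2
    have q3 := mul_le_mul_of_nonneg_right c3 p3
    have q4 := mul_le_mul_of_nonneg_right c4 p4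
    rw [← hℓ]
    linarith
  · have := sem_le_of_norm_le (x := fun j => F (a j) - F (a j - x j) - (F (b j) - F (b j - y j)))
      (c := K * (ℓ * D + M * τ * (ℓ * X))) hh fun j => by
        refine (hs (a j) (b j) (x j) (y j)).trans (mul_le_mul_of_nonneg_left ?_ hK.le)
        exact add_le_add (sxy j) (mul_le_mul (hab j) (sx j) (norm_nonneg _) hMτ)
    rw [hL] at this
    refine this.trans ?_
    rw [← hℓ, div_mul_eq_mul_div, div_mul_eq_mul_div]
    refine div_le_div_of_nonneg_right ?_ hh.le
    have p1 : 0 ≤ K * (τ * X) := by positivity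
    have p3 : 0 ≤ K * D := by positivity
    have c1 : ℓ ^ 2 * (2 * M) ≤ (1 + ℓ) ^ 2 * (2 + M) ^ 2 :=
      mul_le_mul (by nlinarith) (by nlinarith) (by positivity) (by positivity)
    have c3 : ℓ ^ 2 * 2 ≤ (1 + ℓ) ^ 2 * (2 + M) ^ 2 :=
      mul_le_mul (by nlinarith) (by nlinarith) (by positivity) (by positivity)
    have q1 := mul_le_mul_of_nonneg_right c1 p1
    have q3 := mul_le_mul_of_nonneg_right c3 p3
    linarith

end NonlinearEstimate

end

end RelaxNLS

namespace RelaxNLS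

noncomputable section

/-! Summation by parts and its consequences -/

section Energy

variable {J : ℕ} {h : ℝ}

theorem discLaplacian_add (v w : CGrid J) :
    discLaplacian h (v + w) = discLaplacian h v + discLaplacian h w := by
  funext j
  simp only [discLaplacian, Pi.add_apply]
  split_ifs
  · ring
  · ring

theorem discLaplacian_smul (c : ℂ) (v : CGrid J) :
    discLaplacian h (c • v) = c • discLaplacian h v := by
  funext j
  simp only [discLaplacian, Pi.smul_apply, smul_eq_mul]
  split_ifs
  · ring
  · ring

theorem discLaplacian_sub (v w : CGrid J) :
    discLaplacian h (v - w) = discLaplacian h v - discLaplacian h w := by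
  have : v - w = v + (-1 : ℂ) • w := by module
  rw [this, discLaplacian_add, discLaplacian_smul]
  module

theorem discLaplacian_zero (v : CGrid J) : discLaplacian h v 0 = 0 := by
  simp [discLaplacian]

theorem discLaplacian_last (v : CGrid J) : discLaplacian h v (Fin.last (J + 1)) = 0 := by
  simp [discLaplacian]

/-- Summation by parts. -/
theorem sum_incr_mul {W : CGrid J} (h0 : W 0 = 0) (h1 : W (Fin.last (J + 1)) = 0)
    (c : Fin (J + 1) → ℂ) :
    ∑ j, incr W j * c j =
      ∑ i : Fin J, W i.castSucc.succ * (c i.castSucc - c i.succ) := by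
  have e1 : ∑ j : Fin (J + 1), W j.succ * c j = ∑ i : Fin J, W i.castSucc.succ * c i.castSucc := by
    rw [Fin.sum_univ_castSucc, Fin.succ_last, h1, zero_mul, add_zero]
  have e2 : ∑ j : Fin (J + 1), W j.castSucc * c j = ∑ i : Fin J, W i.castSucc.succ * c i.succ := by
    rw [Fin.sum_univ_succ, Fin.castSucc_zero, h0, zero_mul, zero_add]
    rfl
  simp only [incr, sub_mul, mul_sub, Finset.sum_sub_distrib]
  rw [e1, e2]

theorem incr_sub_incr (hh : h ≠ 0) (Z : CGrid J) (i : Fin J) :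
    incr Z i.castSucc - incr Z i.succ = -((h : ℂ) ^ 2 * discLaplacian h Z i.castSucc.succ) := by
  have hh' : (h : ℂ) ^ 2 ≠ 0 := pow_ne_zero _ (Complex.ofReal_ne_zero.2 hh)
  have e : discLaplacian h Z i.castSucc.succ =
      (Z i.castSucc.castSucc - 2 * Z i.castSucc.succ + Z i.succ.succ) / (h : ℂ) ^ 2 := by
    unfold discLaplacian
    rw [dif_pos (by simp)]
    rfl
  rw [e, mul_div_cancel₀ _ hh']
  have e' : i.succ.castSucc = i.castSucc.succ := rfl
  simp only [incr, e']
  ring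

/-- The discrete Green formula. -/
theorem sum_incr_mul_conj {W Z : CGrid J} (hh : h ≠ 0) (h0 : W 0 = 0)
    (h1 : W (Fin.last (J + 1)) = 0) :
    ∑ j, incr W j * (starRingEnd ℂ) (incr Z j) =
      -((h : ℂ) ^ 2 * ∑ i : Fin J, W i.castSucc.succ *
        (starRingEnd ℂ) (discLaplacian h Z i.castSucc.succ)) := by
  rw [sum_incr_mul h0 h1, Finset.mul_sum, ← Finset.sum_neg_distrib]
  refine Finset.sum_congr rfl fun i _ => ?_
  rw [← map_sub, incr_sub_incr hh]
  simp only [map_neg, map_mul, map_pow, Complex.conj_ofReal]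
  ring

theorem re_sum_mul_conj_le {n : ℕ} (a b : Fin n → ℂ) :
    (∑ j, a j * (starRingEnd ℂ) (b j)).re ≤ ‖WithLp.toLp 2 a‖ * ‖WithLp.toLp 2 b‖ := by
  have h1 : ∑ j, a j * (starRingEnd ℂ) (b j) = inner ℂ (WithLp.toLp 2 b) (WithLp.toLp 2 a) := by
    simp [PiLp.inner_apply]
  rw [h1, mul_comm]
  exact (Complex.re_le_norm _).trans (norm_inner_le_norm _ _)

/-- Stability of the Crank–Nicolson step in the discrete `H¹` seminorm. -/
theorem sem_le_of_crankNicolson (hh : 0 < h) {X Y R : CGrid J} {τ : ℝ}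
    (hXY : X - Y = (Complex.I * (τ : ℂ)) • discLaplacian h ((2⁻¹ : ℂ) • (X + Y)) + R) :
    sem h X ≤ sem h Y + sem h R := by
  set Z : CGrid J := (2⁻¹ : ℂ) • (X + Y) with hZ
  set W := discLaplacian h Z with hW
  -- The Green formula needs boundary values only of its first argument, and the discrete Laplacian
  -- is zero at the end nodes by definition. The pairing of Δ_h Z with Z is then real, so the factor
  -- i removes it from the energy balance.
  have hg := sum_incr_mul_conj (W := W) (Z := Z) hh.ne' (discLaplacian_zero Z)
    (discLaplacian_last Z)
  have h1 : (Complex.I * ∑ j, incr W j * (starRingEnd ℂ) (incr Z j)).re = 0 := by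
    rw [hg]
    have : ∑ i : Fin J, W i.castSucc.succ * (starRingEnd ℂ) (discLaplacian h Z i.castSucc.succ) =
        ((∑ i : Fin J, Complex.normSq (W i.castSucc.succ) : ℝ) : ℂ) := by
      push_cast
      exact Finset.sum_congr rfl fun i _ => Complex.mul_conj _
    rw [this, ← Complex.ofReal_pow, ← Complex.ofReal_mul, ← Complex.ofReal_neg,
      Complex.I_mul_re, Complex.ofReal_im, neg_zero]
  have h2 : ∀ j, incr X j - incr Y j = Complex.I * τ * incr W j + incr R j := fun j => by
    have e : incr (X - Y) j = incr X j - incr Y j := by simp only [incr, Pi.sub_apply]; ring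
    rw [← e, hXY]
    simp only [incr, Pi.add_apply, Pi.smul_apply, smul_eq_mul]
    ring
  have h3 : ∀ j, ‖incr X j‖ ^ 2 - ‖incr Y j‖ ^ 2 =
      2 * ((incr X j - incr Y j) * (starRingEnd ℂ) (incr Z j)).re := fun j => by
    have e : incr Z j = 2⁻¹ * (incr X j + incr Y j) := by
      rw [hZ]; simp only [incr, Pi.add_apply, Pi.smul_apply, smul_eq_mul]; ring
    rw [e, ← Complex.normSq_eq_norm_sq, ← Complex.normSq_eq_norm_sq, Complex.normSq_apply,
      Complex.normSq_apply]
    have e2 : ((2 : ℂ)⁻¹).re = 2⁻¹ := by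
      rw [show (2 : ℂ)⁻¹ = ((2⁻¹ : ℝ) : ℂ) by push_cast; rfl, Complex.ofReal_re]
    have e3 : ((2 : ℂ)⁻¹).im = 0 := by
      rw [show (2 : ℂ)⁻¹ = ((2⁻¹ : ℝ) : ℂ) by push_cast; rfl, Complex.ofReal_im]
    simp only [Complex.mul_re, Complex.sub_re, Complex.sub_im, Complex.conj_re, Complex.conj_im,
      Complex.mul_im, Complex.add_re, Complex.add_im, e2, e3]
    ring
  set nX := ‖WithLp.toLp 2 (incr X)‖ with hnX
  set nY := ‖WithLp.toLp 2 (incr Y)‖ with hnY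
  set nR := ‖WithLp.toLp 2 (incr R)‖ with hnR
  have h4 : nX ^ 2 - nY ^ 2 = 2 * (∑ j, incr R j * (starRingEnd ℂ) (incr Z j)).re := by
    rw [hnX, hnY, norm_toLp_sq, norm_toLp_sq, ← Finset.sum_sub_distrib]
    simp only [h3, h2, ← Finset.mul_sum]
    congr 1
    rw [← Complex.re_sum]
    simp only [add_mul, Finset.sum_add_distrib, Complex.add_re]
    have : (∑ j, Complex.I * τ * incr W j * (starRingEnd ℂ) (incr Z j)).re = 0 := by
      have e : ∑ j, Complex.I * τ * incr W j * (starRingEnd ℂ) (incr Z j) =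
          (τ : ℂ) * (Complex.I * ∑ j, incr W j * (starRingEnd ℂ) (incr Z j)) := by
        rw [Finset.mul_sum, Finset.mul_sum]
        exact Finset.sum_congr rfl fun j _ => by ring
      rw [e, Complex.re_ofReal_mul, h1, mul_zero]
    rw [this, zero_add]
  have h5 : nX ^ 2 - nY ^ 2 ≤ nR * (nX + nY) := by
    rw [h4]
    have h6 := re_sum_mul_conj_le (incr R) (incr Z)
    have h7 : ‖WithLp.toLp 2 (incr Z)‖ ≤ 2⁻¹ * (nX + nY) := by
      have e : incr Z = (2⁻¹ : ℂ) • (incr X + incr Y) := by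
        funext j
        rw [hZ]; simp only [incr, Pi.add_apply, Pi.smul_apply, smul_eq_mul]; ring
      rw [e, WithLp.toLp_smul, WithLp.toLp_add, norm_smul]
      have : ‖(2⁻¹ : ℂ)‖ = 2⁻¹ := by simp
      rw [this]
      exact mul_le_mul_of_nonneg_left (norm_add_le _ _) (by norm_num)
    have h8 : nR * ‖WithLp.toLp 2 (incr Z)‖ ≤ nR * (2⁻¹ * (nX + nY)) :=
      mul_le_mul_of_nonneg_left h7 (norm_nonneg _)
    linarith
  have hX0 : 0 ≤ nX := norm_nonneg _
  have hY0 : 0 ≤ nY := norm_nonneg _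
  have hR0 : 0 ≤ nR := norm_nonneg _
  have h9 : nX ≤ nY + nR := by
    by_contra! hlt
    nlinarith
  unfold sem
  rw [← add_div]
  exact div_le_div_of_nonneg_right h9 (Real.sqrt_nonneg _)

/-- The discrete elliptic estimate. -/
theorem sem_le_of_discLaplacian_le (hh : 0 < h) {ε : CGrid J} (hε : VanishesAtEnds ε) {c : ℝ}
    (hc : ∀ i : Fin J, ‖discLaplacian h ε i.castSucc.succ‖ ≤ c) (hc0 : 0 ≤ c) :
    sem h ε ≤ (J + 1) * h * √((J + 1) * h) * c := by
  have hg := sum_incr_mul_conj (W := ε) (Z := ε) hh.ne' hε.1 hε.2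
  have h1 : ∑ j, incr ε j * (starRingEnd ℂ) (incr ε j) = ((‖WithLp.toLp 2 (incr ε)‖ ^ 2 : ℝ) : ℂ) := by
    rw [norm_toLp_sq]
    push_cast
    exact Finset.sum_congr rfl fun i _ => Complex.mul_conj' _
  rw [h1] at hg
  -- Pairing ε with its Laplacian bounds the squared seminorm by c times the maximum of |ε|, which
  -- is at most a multiple of the seminorm; one factor then cancels.
  have h2 : ‖WithLp.toLp 2 (incr ε)‖ ^ 2 ≤ h ^ 2 * ∑ i : Fin J, √((J + 1) * h) * sem h ε * c := by
    have e := congrArg norm hg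
    rw [norm_neg, norm_mul, Complex.norm_real, Real.norm_of_nonneg (sq_nonneg _), norm_pow,
      Complex.norm_real, Real.norm_of_nonneg hh.le] at e
    rw [e]
    refine mul_le_mul_of_nonneg_left ((norm_sum_le _ _).trans (Finset.sum_le_sum fun i _ => ?_))
      (sq_nonneg _)
    rw [norm_mul, RCLike.norm_conj]
    exact mul_le_mul (norm_le_sem hh hε.1 _) (hc i) (norm_nonneg _)
      (mul_nonneg (Real.sqrt_nonneg _) (sem_nonneg _ _))
  rw [Finset.sum_const, Finset.card_univ, Fintype.card_fin, nsmul_eq_mul] at h2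
  have h3 : sem h ε ^ 2 * h = ‖WithLp.toLp 2 (incr ε)‖ ^ 2 := by
    unfold sem
    rw [div_pow, Real.sq_sqrt hh.le, div_mul_cancel₀ _ hh.ne']
  set S := sem h ε with hS
  have hS0 : 0 ≤ S := sem_nonneg _ _
  set ℓ := √(((J : ℝ) + 1) * h) with hℓ
  have hℓ0 : 0 ≤ ℓ := Real.sqrt_nonneg _
  have h4 : S ^ 2 * h ≤ h * (S * (((J : ℝ) + 1) * h * ℓ * c)) := by
    rw [h3]
    refine h2.trans ?_
    have : 0 ≤ h ^ 2 * (ℓ * S * c) := by positivity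
    nlinarith
  have h5 : S * S ≤ S * (((J : ℝ) + 1) * h * ℓ * c) := by
    rw [← sq]
    exact le_of_mul_le_mul_left (by linarith) hh
  rcases hS0.eq_or_lt with h6 | h6
  · rw [← h6]; positivity
  · exact le_of_mul_le_mul_left h5 h6

/-- The discrete `H¹` norm is controlled by the seminorm. -/
theorem normH1_le_sem (hh : 0 < h) {v : CGrid J} (hv : v 0 = 0) :
    normH1 h v ≤ (1 + 2 * ((J + 1) * h)) * sem h v := by
  set L := ((J : ℝ) + 1) * h with hL
  have hL0 : 0 ≤ L := by positivity
  have h1 : normL2 h v ^ 2 ≤ 2 * L ^ 2 * sem h v ^ 2 := by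
    unfold normL2
    rw [Real.sq_sqrt (by positivity)]
    have h2 : ∑ j, ‖v j‖ ^ 2 ≤ ∑ _j : Fin (J + 2), L * sem h v ^ 2 := by
      refine Finset.sum_le_sum fun j _ => ?_
      have := pow_le_pow_left₀ (norm_nonneg _) (norm_le_sem hh hv j) 2
      rwa [mul_pow, Real.sq_sqrt hL0] at this
    rw [Finset.sum_const, Finset.card_univ, Fintype.card_fin, nsmul_eq_mul] at h2
    have h3 := mul_le_mul_of_nonneg_left h2 hh.le
    refine h3.trans ?_
    -- The norm sums over J + 2 nodes while the interval has J + 1 cells, whence the factor 2.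
    have h4 : h * ((J + 2 : ℕ) : ℝ) ≤ 2 * L := by
      rw [hL]; push_cast; nlinarith [Nat.cast_nonneg (α := ℝ) J]
    have h5 : 0 ≤ L * sem h v ^ 2 := by positivity
    nlinarith
  have h2 : seminormH1 h v ^ 2 = sem h v ^ 2 := by
    unfold seminormH1 sem
    rw [Real.sq_sqrt (by positivity), div_pow, Real.sq_sqrt hh.le, norm_toLp_sq, Finset.mul_sum,
      Finset.sum_div]
    refine Finset.sum_congr rfl fun j _ => ?_
    have : ‖discDeriv h v j‖ = ‖incr v j‖ / h := by
      unfold discDeriv incr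
      rw [norm_div, Complex.norm_real, Real.norm_of_nonneg hh.le]
    rw [this]
    field_simp
  unfold normH1
  have hs := sem_nonneg h v
  refine Real.sqrt_le_iff.2 ⟨by positivity, ?_⟩
  rw [h2]
  have : 0 ≤ L * sem h v ^ 2 := by positivity
  nlinarith [mul_nonneg hL0 this]

end Energy

end

end RelaxNLS

namespace RelaxNLS

noncomputable section

/-! Taylor-type estimates on an interval, with one-sided derivatives at the ends -/

section Interval

variable {E : Type*} [NormedAddCommGroup E] [NormedSpace ℝ E] {a b : ℝ}

theorem norm_sub_le_of_hasDerivWithinAt {φ φ' : ℝ → E} {M : ℝ}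
    (h₁ : ∀ t ∈ Set.Icc a b, HasDerivWithinAt φ (φ' t) (Set.Icc a b) t)
    (hM : ∀ t ∈ Set.Icc a b, ‖φ' t‖ ≤ M) {s t : ℝ} (hs : s ∈ Set.Icc a b)
    (ht : t ∈ Set.Icc a b) : ‖φ t - φ s‖ ≤ M * |t - s| :=
  (convex_Icc a b).norm_image_sub_le_of_norm_hasDerivWithin_le h₁ hM hs ht

theorem hasDerivWithinAt_comp_add {φ φ' : ℝ → E}
    (h₁ : ∀ t ∈ Set.Icc a b, HasDerivWithinAt φ (φ' t) (Set.Icc a b) t) {t k κ : ℝ}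
    (ht : t ∈ Set.Icc a b) (htk : t + k ∈ Set.Icc a b) (hκ : κ ∈ Set.Icc 0 k) :
    HasDerivWithinAt (fun κ => φ (t + κ)) (φ' (t + κ)) (Set.Icc 0 k) κ := by
  have hm : Set.MapsTo (fun κ => t + κ) (Set.Icc 0 k) (Set.Icc a b) := fun y hy =>
    ⟨by linarith [ht.1, hy.1], by linarith [htk.2, hy.2]⟩
  have h2 : HasDerivWithinAt (fun κ : ℝ => t + κ) 1 (Set.Icc 0 k) κ :=
    ((hasDerivAt_id κ).const_add t).hasDerivWithinAt
  exact ((h₁ (t + κ) (hm hκ)).scomp κ h2 hm).congr_deriv (by simp)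

theorem hasDerivWithinAt_comp_sub {φ φ' : ℝ → E}
    (h₁ : ∀ t ∈ Set.Icc a b, HasDerivWithinAt φ (φ' t) (Set.Icc a b) t) {t k κ : ℝ}
    (ht : t ∈ Set.Icc a b) (htk : t - k ∈ Set.Icc a b) (hκ : κ ∈ Set.Icc 0 k) :
    HasDerivWithinAt (fun κ => φ (t - κ)) (-φ' (t - κ)) (Set.Icc 0 k) κ := by
  have hm : Set.MapsTo (fun κ => t - κ) (Set.Icc 0 k) (Set.Icc a b) := fun y hy =>
    ⟨by linarith [htk.1, hy.2], by linarith [ht.2, hy.1]⟩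
  have h2 : HasDerivWithinAt (fun κ : ℝ => t - κ) (-1) (Set.Icc 0 k) κ :=
    ((hasDerivAt_id κ).const_sub t).hasDerivWithinAt
  exact ((h₁ (t - κ) (hm hκ)).scomp κ h2 hm).congr_deriv (by simp)

/-- Mean value inequality in the half-width κ: the derivative φ'(t+κ) - φ'(t-κ) is at most 2Mκ. The
derivatives are arbitrary given functions, so the estimate also applies to differences of two slices
of a function of two variables. -/
theorem norm_centralDiff_le {φ φ' φ'' : ℝ → E} {M : ℝ}
    (h₁ : ∀ t ∈ Set.Icc a b, HasDerivWithinAt φ (φ' t) (Set.Icc a b) t)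
    (h₂ : ∀ t ∈ Set.Icc a b, HasDerivWithinAt φ' (φ'' t) (Set.Icc a b) t)
    (hM : ∀ t ∈ Set.Icc a b, ‖φ'' t‖ ≤ M) {t k : ℝ} (hk : 0 ≤ k) (ht₁ : t - k ∈ Set.Icc a b)
    (ht₂ : t + k ∈ Set.Icc a b) :
    ‖φ (t + k) + φ (t - k) - (φ t + φ t)‖ ≤ 2 * M * k ^ 2 := by
  have ht : t ∈ Set.Icc a b := ⟨by linarith [ht₁.1], by linarith [ht₂.2]⟩
  have hM0 : 0 ≤ M := (norm_nonneg _).trans (hM t ht)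
  have hd : ∀ κ ∈ Set.Icc 0 k, HasDerivWithinAt (fun κ => φ (t + κ) + φ (t - κ))
      (φ' (t + κ) - φ' (t - κ)) (Set.Icc 0 k) κ := fun κ hκ => by
    rw [sub_eq_add_neg]
    exact (hasDerivWithinAt_comp_add h₁ ht ht₂ hκ).add (hasDerivWithinAt_comp_sub h₁ ht ht₁ hκ)
  have := norm_sub_le_of_hasDerivWithinAt hd (M := 2 * M * k) (fun κ hκ => by
    have := norm_sub_le_of_hasDerivWithinAt h₂ hM (s := t - κ) (t := t + κ)
      ⟨by linarith [ht₁.1, hκ.2], by linarith [ht.2, hκ.1]⟩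
      ⟨by linarith [ht.1, hκ.1], by linarith [ht₂.2, hκ.2]⟩
    refine this.trans ?_
    rw [show t + κ - (t - κ) = 2 * κ by ring, abs_of_nonneg (by linarith [hκ.1])]
    nlinarith [hκ.2]) (s := 0) (t := k) ⟨le_rfl, hk⟩ ⟨hk, le_rfl⟩
  simp only [add_zero, sub_zero, abs_of_nonneg hk] at this
  exact this.trans (le_of_eq (by ring))

/-- The defect vanishes for step κ = 0, and its derivative in κ is half the first-order Taylor
remainder of φ' between t + κ and t, hence of order k². -/
theorem norm_trapezoid_le {φ φ' φ'' φ''' : ℝ → E} {M : ℝ}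
    (h₁ : ∀ t ∈ Set.Icc a b, HasDerivWithinAt φ (φ' t) (Set.Icc a b) t)
    (h₂ : ∀ t ∈ Set.Icc a b, HasDerivWithinAt φ' (φ'' t) (Set.Icc a b) t)
    (h₃ : ∀ t ∈ Set.Icc a b, HasDerivWithinAt φ'' (φ''' t) (Set.Icc a b) t)
    (hM : ∀ t ∈ Set.Icc a b, ‖φ''' t‖ ≤ M) {t k : ℝ} (hk : 0 ≤ k) (ht : t ∈ Set.Icc a b)
    (htk : t + k ∈ Set.Icc a b) :
    ‖φ (t + k) - φ t - (k / 2) • (φ' (t + k) + φ' t)‖ ≤ M * k ^ 3 := by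
  have hM0 : 0 ≤ M := (norm_nonneg _).trans (hM t ht)
  have hd : ∀ κ ∈ Set.Icc 0 k,
      HasDerivWithinAt (fun κ : ℝ => φ (t + κ) - (κ / 2) • (φ' (t + κ) + φ' t))
      ((1 / 2 : ℝ) • (φ' (t + κ) - φ' t - κ • φ'' (t + κ))) (Set.Icc 0 k) κ := fun κ hκ => by
    have e1 := hasDerivWithinAt_comp_add h₁ ht htk hκ
    have e2 := (hasDerivWithinAt_comp_add h₂ ht htk hκ).add_const (φ' t)
    have e3 : HasDerivWithinAt (fun κ : ℝ => κ / 2) (1 / 2) (Set.Icc 0 k) κ :=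
      ((hasDerivAt_id κ).div_const 2).hasDerivWithinAt
    refine (e1.sub (e3.smul e2)).congr_deriv ?_
    module
  have hb : ∀ κ ∈ Set.Icc 0 k, ‖(1 / 2 : ℝ) • (φ' (t + κ) - φ' t - κ • φ'' (t + κ))‖ ≤
      M * k ^ 2 := fun κ hκ => by
    have htκ : t + κ ∈ Set.Icc a b := ⟨by linarith [ht.1, hκ.1], by linarith [htk.2, hκ.2]⟩
    have hsub : Set.Icc t (t + κ) ⊆ Set.Icc a b := Set.Icc_subset_Icc ht.1 htκ.2
    have := norm_sub_le_of_hasDerivWithinAt (a := t) (b := t + κ)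
      (φ := fun s => φ' s - s • φ'' (t + κ)) (φ' := fun s => φ'' s - φ'' (t + κ)) (M := M * k)
      (fun s hs => by
        have e1 := (h₂ s (hsub hs)).mono hsub
        have e2 : HasDerivWithinAt (fun s : ℝ => s • φ'' (t + κ)) ((1 : ℝ) • φ'' (t + κ))
            (Set.Icc t (t + κ)) s := ((hasDerivAt_id s).smul_const _).hasDerivWithinAt
        rw [one_smul] at e2
        exact e1.sub e2)
      (fun s hs => by
        refine (norm_sub_le_of_hasDerivWithinAt h₃ hM htκ (hsub hs)).trans ?_
        refine mul_le_mul_of_nonneg_left ?_ hM0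
        rw [abs_le]
        exact ⟨by linarith [hs.1, hκ.2], by linarith [hs.2, hκ.1, hκ.2]⟩)
      (s := t) (t := t + κ) ⟨le_rfl, by linarith [hκ.1]⟩ ⟨by linarith [hκ.1], le_rfl⟩
    have e : φ' (t + κ) - (t + κ) • φ'' (t + κ) - (φ' t - t • φ'' (t + κ)) =
        φ' (t + κ) - φ' t - κ • φ'' (t + κ) := by module
    rw [e, add_sub_cancel_left, abs_of_nonneg hκ.1] at this
    rw [norm_smul, Real.norm_of_nonneg (by norm_num)]
    have h5 : M * k * κ ≤ M * k * k := mul_le_mul_of_nonneg_left hκ.2 (by positivity)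
    have h6 : 0 ≤ M * k * k := by positivity
    nlinarith
  have := norm_sub_le_of_hasDerivWithinAt hd hb (s := 0) (t := k) ⟨le_rfl, hk⟩ ⟨hk, le_rfl⟩
  simp only [add_zero, sub_zero, zero_div, zero_smul, abs_of_nonneg hk] at this
  rw [sub_right_comm]
  exact this.trans (le_of_eq (by ring))

/-- Differentiating the defect twice in the half-width leaves the central difference of φ₂, which
`norm_centralDiff_le` bounds; two mean value inequalities bring the estimate back. -/
theorem norm_centralDiff_sub_le {φ φ₁ φ₂ φ₃ φ₄ : ℝ → E} {M : ℝ}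
    (h₁ : ∀ t ∈ Set.Icc a b, HasDerivWithinAt φ (φ₁ t) (Set.Icc a b) t)
    (h₂ : ∀ t ∈ Set.Icc a b, HasDerivWithinAt φ₁ (φ₂ t) (Set.Icc a b) t)
    (h₃ : ∀ t ∈ Set.Icc a b, HasDerivWithinAt φ₂ (φ₃ t) (Set.Icc a b) t)
    (h₄ : ∀ t ∈ Set.Icc a b, HasDerivWithinAt φ₃ (φ₄ t) (Set.Icc a b) t)
    (hM : ∀ t ∈ Set.Icc a b, ‖φ₄ t‖ ≤ M) {t k : ℝ} (hk : 0 ≤ k) (ht₁ : t - k ∈ Set.Icc a b)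
    (ht₂ : t + k ∈ Set.Icc a b) :
    ‖φ (t + k) + φ (t - k) - (φ t + φ t) - k ^ 2 • φ₂ t‖ ≤ 2 * M * k ^ 4 := by
  have ht : t ∈ Set.Icc a b := ⟨by linarith [ht₁.1], by linarith [ht₂.2]⟩
  have hM0 : 0 ≤ M := (norm_nonneg _).trans (hM t ht)
  have hω : ∀ κ ∈ Set.Icc 0 k, ‖φ₁ (t + κ) - φ₁ (t - κ) - (2 * κ) • φ₂ t‖ ≤ 2 * M * k ^ 3 := by
    intro κ hκ
    have hd : ∀ κ ∈ Set.Icc 0 k,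
        HasDerivWithinAt (fun κ : ℝ => φ₁ (t + κ) - φ₁ (t - κ) - (2 * κ) • φ₂ t)
          (φ₂ (t + κ) + φ₂ (t - κ) - (φ₂ t + φ₂ t)) (Set.Icc 0 k) κ := fun κ hκ => by
      have e3 : HasDerivWithinAt (fun κ : ℝ => (2 * κ) • φ₂ t) ((2 * 1 : ℝ) • φ₂ t)
          (Set.Icc 0 k) κ :=
        (((hasDerivAt_id κ).const_mul 2).smul_const _).hasDerivWithinAt
      refine (((hasDerivWithinAt_comp_add h₂ ht ht₂ hκ).sub
        (hasDerivWithinAt_comp_sub h₂ ht ht₁ hκ)).sub e3).congr_deriv ?_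
      module
    have := norm_sub_le_of_hasDerivWithinAt hd (M := 2 * M * k ^ 2) (fun κ hκ => by
      refine (norm_centralDiff_le h₃ h₄ hM hκ.1 ⟨by linarith [ht₁.1, hκ.2], by linarith [ht.2, hκ.1]⟩
        ⟨by linarith [ht.1, hκ.1], by linarith [ht₂.2, hκ.2]⟩).trans ?_
      exact mul_le_mul_of_nonneg_left (pow_le_pow_left₀ hκ.1 hκ.2 2) (by positivity))
      (s := 0) (t := κ) ⟨le_rfl, hk⟩ hκ
    simp only [add_zero, sub_zero, mul_zero, zero_smul, sub_self, abs_of_nonneg hκ.1] at this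
    refine this.trans ?_
    have : 2 * M * k ^ 2 * κ ≤ 2 * M * k ^ 2 * k := mul_le_mul_of_nonneg_left hκ.2 (by positivity)
    linarith
  have hd : ∀ κ ∈ Set.Icc 0 k, HasDerivWithinAt (fun κ : ℝ => φ (t + κ) + φ (t - κ) - κ ^ 2 • φ₂ t)
      (φ₁ (t + κ) - φ₁ (t - κ) - (2 * κ) • φ₂ t) (Set.Icc 0 k) κ := fun κ hκ => by
    have e3 : HasDerivWithinAt (fun κ : ℝ => κ ^ 2 • φ₂ t) ((2 * κ) • φ₂ t) (Set.Icc 0 k) κ := by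
      have := ((hasDerivAt_pow 2 κ).smul_const (φ₂ t)).hasDerivWithinAt (s := Set.Icc 0 k)
      simpa using this
    refine (((hasDerivWithinAt_comp_add h₁ ht ht₂ hκ).add
      (hasDerivWithinAt_comp_sub h₁ ht ht₁ hκ)).sub e3).congr_deriv ?_
    module
  have := norm_sub_le_of_hasDerivWithinAt hd hω (s := 0) (t := k) ⟨le_rfl, hk⟩ ⟨hk, le_rfl⟩
  simp only [add_zero, sub_zero, ne_eq, OfNat.ofNat_ne_zero, not_false_eq_true, zero_pow,
    zero_smul, abs_of_nonneg hk] at this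
  rw [sub_right_comm]
  exact this.trans (le_of_eq (by ring))

end Interval

/-! Bounded Lipschitz functions on an interval -/

section BddLip

variable {E : Type*} [NormedAddCommGroup E] {xa xb : ℝ}

/-- `Z` is bounded by `c` and Lipschitz with constant `c` on `[xa, xb]`. -/
structure BddLip (xa xb c : ℝ) (Z : ℝ → E) : Prop where
  bdd : ∀ x ∈ Set.Icc xa xb, ‖Z x‖ ≤ c
  lip : ∀ x ∈ Set.Icc xa xb, ∀ y ∈ Set.Icc xa xb, ‖Z x - Z y‖ ≤ c * |x - y|

theorem BddLip.mono {c d : ℝ} {Z : ℝ → E} (h : BddLip xa xb c Z) (hcd : c ≤ d) :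
    BddLip xa xb d Z :=
  ⟨fun x hx => (h.bdd x hx).trans hcd, fun x hx y hy =>
    (h.lip x hx y hy).trans (mul_le_mul_of_nonneg_right hcd (abs_nonneg _))⟩

theorem BddLip.add {c d : ℝ} {Z Y : ℝ → E} (hZ : BddLip xa xb c Z) (hY : BddLip xa xb d Y) :
    BddLip xa xb (c + d) (fun x => Z x + Y x) :=
  ⟨fun x hx => (norm_add_le _ _).trans (add_le_add (hZ.bdd x hx) (hY.bdd x hx)),
    fun x hx y hy => by
      rw [add_sub_add_comm, add_mul]
      exact (norm_add_le _ _).trans (add_le_add (hZ.lip x hx y hy) (hY.lip x hx y hy))⟩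

theorem BddLip.mul {c d : ℝ} {Z Y : ℝ → ℂ} (hZ : BddLip xa xb c Z) (hY : BddLip xa xb d Y) :
    BddLip xa xb (2 * (c * d)) (fun x => Z x * Y x) := by
  constructor
  · intro x hx
    have hc := (norm_nonneg _).trans (hZ.bdd x hx)
    have hd := (norm_nonneg _).trans (hY.bdd x hx)
    rw [norm_mul]
    have := mul_le_mul (hZ.bdd x hx) (hY.bdd x hx) (norm_nonneg _) hc
    nlinarith [mul_nonneg hc hd]
  · intro x hx y hy
    have hc := (norm_nonneg _).trans (hZ.bdd x hx)
    have e : Z x * Y x - Z y * Y y = Z x * (Y x - Y y) + (Z x - Z y) * Y y := by ring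
    rw [e]
    refine (norm_add_le _ _).trans ?_
    rw [norm_mul, norm_mul]
    have h1 := mul_le_mul (hZ.bdd x hx) (hY.lip x hx y hy) (norm_nonneg _) hc
    have h2 := mul_le_mul (hZ.lip x hx y hy) (hY.bdd y hy) (norm_nonneg _)
      (mul_nonneg hc (abs_nonneg _))
    linarith

theorem BddLip.const_mul {c : ℝ} {Z : ℝ → ℂ} (k : ℂ) (hZ : BddLip xa xb c Z) :
    BddLip xa xb (‖k‖ * c) (fun x => k * Z x) := by
  constructor
  · intro x hx
    rw [norm_mul]
    exact mul_le_mul_of_nonneg_left (hZ.bdd x hx) (norm_nonneg _)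
  · intro x hx y hy
    rw [← mul_sub, norm_mul, mul_assoc]
    exact mul_le_mul_of_nonneg_left (hZ.lip x hx y hy) (norm_nonneg _)

theorem BddLip.ofReal {c : ℝ} {Z : ℝ → ℝ} (hZ : BddLip xa xb c Z) :
    BddLip xa xb c (fun x => (Z x : ℂ)) :=
  ⟨fun x hx => (Complex.norm_real _).le.trans (hZ.bdd x hx), fun x hx y hy => by
    rw [← Complex.ofReal_sub, Complex.norm_real]
    exact hZ.lip x hx y hy⟩

end BddLip

/-! Partial derivatives on the rectangle -/

section Rectangle

variable {E : Type*} [NormedAddCommGroup E] [NormedSpace ℝ E] {T xa xb : ℝ}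

/-- The partial derivative in the direction `e` within `Q`. -/
def partialWithin (Q : Set (ℝ × ℝ)) (e : ℝ × ℝ) (w : ℝ × ℝ → E) (p : ℝ × ℝ) : E :=
  fderivWithin ℝ w Q p e

theorem uniqueDiffOn_rect (hT : 0 < T) (hab : xa < xb) : UniqueDiffOn ℝ (rect T xa xb) :=
  (uniqueDiffOn_Icc hT).prod (uniqueDiffOn_Icc hab)

theorem contDiffOn_partialWithin (hT : 0 < T) (hab : xa < xb) {n m : ℕ} (hnm : n + 1 ≤ m)
    (e : ℝ × ℝ) {w : ℝ × ℝ → E} (hw : ContDiffOn ℝ m w (rect T xa xb)) :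
    ContDiffOn ℝ n (partialWithin (rect T xa xb) e w) (rect T xa xb) :=
  (hw.fderivWithin (uniqueDiffOn_rect hT hab) (by exact_mod_cast hnm)).clm_apply contDiffOn_const

theorem hasDerivWithinAt_time {m : ℕ} (hm : 1 ≤ m) {w : ℝ × ℝ → E}
    (hw : ContDiffOn ℝ m w (rect T xa xb)) {t x : ℝ} (ht : t ∈ Set.Icc 0 T)
    (hx : x ∈ Set.Icc xa xb) :
    HasDerivWithinAt (fun s => w (s, x)) (partialWithin (rect T xa xb) (1, 0) w (t, x))
      (Set.Icc 0 T) t := by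
  have hp : (t, x) ∈ rect T xa xb := ⟨ht, hx⟩
  have h1 := (hw.differentiableOn (by exact_mod_cast (by omega : m ≠ 0)) (t, x) hp).hasFDerivWithinAt
  have h2 : HasDerivWithinAt (fun s : ℝ => (s, x)) ((1 : ℝ), (0 : ℝ)) (Set.Icc 0 T) t :=
    ((hasDerivAt_id t).prodMk (hasDerivAt_const t x)).hasDerivWithinAt
  have hm : Set.MapsTo (fun s : ℝ => (s, x)) (Set.Icc 0 T) (rect T xa xb) := fun s hs => ⟨hs, hx⟩
  exact h1.comp_hasDerivWithinAt t h2 hm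

theorem hasDerivWithinAt_space {m : ℕ} (hm : 1 ≤ m) {w : ℝ × ℝ → E}
    (hw : ContDiffOn ℝ m w (rect T xa xb)) {t x : ℝ} (ht : t ∈ Set.Icc 0 T)
    (hx : x ∈ Set.Icc xa xb) :
    HasDerivWithinAt (fun y => w (t, y)) (partialWithin (rect T xa xb) (0, 1) w (t, x))
      (Set.Icc xa xb) x := by
  have hp : (t, x) ∈ rect T xa xb := ⟨ht, hx⟩
  have h1 := (hw.differentiableOn (by exact_mod_cast (by omega : m ≠ 0)) (t, x) hp).hasFDerivWithinAt
  have h2 : HasDerivWithinAt (fun y : ℝ => (t, y)) ((0 : ℝ), (1 : ℝ)) (Set.Icc xa xb) x :=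
    ((hasDerivAt_const x t).prodMk (hasDerivAt_id x)).hasDerivWithinAt
  have hm : Set.MapsTo (fun y : ℝ => (t, y)) (Set.Icc xa xb) (rect T xa xb) := fun y hy => ⟨ht, hy⟩
  exact h1.comp_hasDerivWithinAt x h2 hm

theorem isCompact_rect : IsCompact (rect T xa xb) := isCompact_Icc.prod isCompact_Icc

theorem exists_bound_rect {n : ℕ} {w : ℝ × ℝ → E} (hw : ContDiffOn ℝ n w (rect T xa xb)) :
    ∃ M, 0 ≤ M ∧ ∀ t ∈ Set.Icc 0 T, ∀ x ∈ Set.Icc xa xb, ‖w (t, x)‖ ≤ M := by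
  obtain ⟨M, hM⟩ := isCompact_rect.exists_bound_of_continuousOn hw.continuousOn
  exact ⟨max 0 M, le_max_left _ _, fun t ht x hx => (hM (t, x) ⟨ht, hx⟩).trans (le_max_right _ _)⟩

theorem exists_bddLip (hT : 0 < T) (hab : xa < xb) {m : ℕ} (hm : 1 ≤ m) {w : ℝ × ℝ → E}
    (hw : ContDiffOn ℝ m w (rect T xa xb)) :
    ∃ M, 0 ≤ M ∧ ∀ t ∈ Set.Icc 0 T, BddLip xa xb M (fun x => w (t, x)) := by
  obtain ⟨M₁, hM₁, h1⟩ := exists_bound_rect hw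
  obtain ⟨M₂, hM₂, h2⟩ := exists_bound_rect
    (contDiffOn_partialWithin hT hab (n := 0) (by omega) (0, 1) hw)
  refine ⟨M₁ + M₂, add_nonneg hM₁ hM₂, fun t ht => ⟨fun x hx => (h1 t ht x hx).trans (by linarith),
    fun x hx y hy => ?_⟩⟩
  exact norm_sub_le_of_hasDerivWithinAt (fun z hz => hasDerivWithinAt_space hm hw ht hz)
    (fun z hz => (h2 t ht z hz).trans (by linarith)) hy hx

/-- The Lipschitz bound in x comes from the mean value inequality in time applied to the difference
of the slices at x and y, whose time derivative is at most M|x - y|. Only space derivatives of time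
derivatives occur, so no symmetry of mixed derivatives is needed. The central difference and the
trapezoidal defect below are handled in the same way. -/
theorem exists_bddLip_sub (hT : 0 < T) (hab : xa < xb) {m : ℕ} (hm : 2 ≤ m) {w : ℝ × ℝ → E}
    (hw : ContDiffOn ℝ m w (rect T xa xb)) :
    ∃ M, 0 ≤ M ∧ ∀ t ∈ Set.Icc 0 T, ∀ s ∈ Set.Icc 0 T,
      BddLip xa xb (M * |t - s|) (fun x => w (t, x) - w (s, x)) := by
  obtain ⟨M, hM, h1⟩ := exists_bddLip hT hab le_rfl
    (contDiffOn_partialWithin hT hab (n := 1) (by omega) (1, 0) hw)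
  refine ⟨M, hM, fun t ht s hs => ⟨fun x hx => ?_, fun x hx y hy => ?_⟩⟩
  · exact norm_sub_le_of_hasDerivWithinAt
      (fun r hr => hasDerivWithinAt_time (by omega) hw hr hx) (fun r hr => (h1 r hr).bdd x hx) hs ht
  · have := norm_sub_le_of_hasDerivWithinAt
      (fun r hr => (hasDerivWithinAt_time (by omega) hw hr hx).sub
        (hasDerivWithinAt_time (by omega) hw hr hy))
      (fun r hr => (h1 r hr).lip x hx y hy) hs ht
    have e : w (t, x) - w (s, x) - (w (t, y) - w (s, y)) =
        w (t, x) - w (t, y) - (w (s, x) - w (s, y)) := by abel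
    rw [e]
    exact this.trans (le_of_eq (by ring))

theorem exists_bound_centralDiff (hT : 0 < T) (hab : xa < xb) {m : ℕ} (hm : 2 ≤ m)
    {w : ℝ × ℝ → E} (hw : ContDiffOn ℝ m w (rect T xa xb)) :
    ∃ M, 0 ≤ M ∧ ∀ t k, 0 ≤ k → t - k ∈ Set.Icc 0 T → t + k ∈ Set.Icc 0 T → ∀ x ∈ Set.Icc xa xb,
      ‖w (t + k, x) + w (t - k, x) - (w (t, x) + w (t, x))‖ ≤ M * k ^ 2 := by
  have hw1 := contDiffOn_partialWithin hT hab (n := m - 1) (by omega) (1, 0) hw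
  obtain ⟨M, hM, h1⟩ := exists_bound_rect
    (contDiffOn_partialWithin hT hab (n := m - 2) (by omega) (1, 0) hw1)
  refine ⟨2 * M, by positivity, fun t k hk ht₁ ht₂ x hx => ?_⟩
  exact norm_centralDiff_le (fun r hr => hasDerivWithinAt_time (by omega) hw hr hx)
    (fun r hr => hasDerivWithinAt_time (by omega) hw1 hr hx) (fun r hr => h1 r hr x hx) hk ht₁ ht₂

theorem exists_bddLip_centralDiff (hT : 0 < T) (hab : xa < xb) {m : ℕ} (hm : 3 ≤ m)
    {w : ℝ × ℝ → E} (hw : ContDiffOn ℝ m w (rect T xa xb)) :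
    ∃ M, 0 ≤ M ∧ ∀ t k, 0 ≤ k → t - k ∈ Set.Icc 0 T → t + k ∈ Set.Icc 0 T →
      BddLip xa xb (M * k ^ 2) (fun x => w (t + k, x) + w (t - k, x) - (w (t, x) + w (t, x))) := by
  have hw1 := contDiffOn_partialWithin hT hab (n := m - 1) (by omega) (1, 0) hw
  obtain ⟨M, hM, h1⟩ := exists_bddLip hT hab (m := m - 2) (by omega)
    (contDiffOn_partialWithin hT hab (n := m - 2) (by omega) (1, 0) hw1)
  have hd : ∀ x ∈ Set.Icc xa xb, ∀ r ∈ Set.Icc 0 T, HasDerivWithinAt (fun s => w (s, x)) _ _ r :=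
    fun x hx r hr => hasDerivWithinAt_time (by omega) hw hr hx
  have hd1 : ∀ x ∈ Set.Icc xa xb, ∀ r ∈ Set.Icc 0 T,
      HasDerivWithinAt (fun s => partialWithin (rect T xa xb) (1, 0) w (s, x)) _ _ r :=
    fun x hx r hr => hasDerivWithinAt_time (by omega) hw1 hr hx
  refine ⟨2 * M, by positivity, fun t k hk ht₁ ht₂ => ⟨fun x hx => ?_, fun x hx y hy => ?_⟩⟩
  · exact norm_centralDiff_le (hd x hx) (hd1 x hx) (fun r hr => (h1 r hr).bdd x hx) hk ht₁ ht₂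
  · have := norm_centralDiff_le (fun r hr => (hd x hx r hr).sub (hd y hy r hr))
      (fun r hr => (hd1 x hx r hr).sub (hd1 y hy r hr))
      (fun r hr => (h1 r hr).lip x hx y hy) hk ht₁ ht₂
    refine (le_of_eq (congrArg norm ?_)).trans (this.trans (le_of_eq (by ring)))
    simp only [Pi.sub_apply]
    abel

theorem exists_bddLip_trapezoid (hT : 0 < T) (hab : xa < xb) {m : ℕ} (hm : 4 ≤ m)
    {w : ℝ × ℝ → E} (hw : ContDiffOn ℝ m w (rect T xa xb)) :
    ∃ M, 0 ≤ M ∧ ∀ t k, 0 ≤ k → t ∈ Set.Icc 0 T → t + k ∈ Set.Icc 0 T →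
      BddLip xa xb (M * k ^ 3) (fun x => w (t + k, x) - w (t, x) -
        (k / 2) • (partialWithin (rect T xa xb) (1, 0) w (t + k, x) +
          partialWithin (rect T xa xb) (1, 0) w (t, x))) := by
  have hw1 := contDiffOn_partialWithin hT hab (n := m - 1) (by omega) (1, 0) hw
  have hw2 := contDiffOn_partialWithin hT hab (n := m - 2) (by omega) (1, 0) hw1
  obtain ⟨M, hM, h1⟩ := exists_bddLip hT hab (m := m - 3) (by omega)
    (contDiffOn_partialWithin hT hab (n := m - 3) (by omega) (1, 0) hw2)
  have hd : ∀ x ∈ Set.Icc xa xb, ∀ r ∈ Set.Icc 0 T, HasDerivWithinAt (fun s => w (s, x)) _ _ r :=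
    fun x hx r hr => hasDerivWithinAt_time (by omega) hw hr hx
  have hd1 : ∀ x ∈ Set.Icc xa xb, ∀ r ∈ Set.Icc 0 T,
      HasDerivWithinAt (fun s => partialWithin (rect T xa xb) (1, 0) w (s, x)) _ _ r :=
    fun x hx r hr => hasDerivWithinAt_time (by omega) hw1 hr hx
  have hd2 : ∀ x ∈ Set.Icc xa xb, ∀ r ∈ Set.Icc 0 T, HasDerivWithinAt (fun s => partialWithin
      (rect T xa xb) (1, 0) (partialWithin (rect T xa xb) (1, 0) w) (s, x)) _ _ r :=
    fun x hx r hr => hasDerivWithinAt_time (by omega) hw2 hr hx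
  refine ⟨M, hM, fun t k hk ht₁ ht₂ => ⟨fun x hx => ?_, fun x hx y hy => ?_⟩⟩
  · exact norm_trapezoid_le (hd x hx) (hd1 x hx) (hd2 x hx) (fun r hr => (h1 r hr).bdd x hx)
      hk ht₁ ht₂
  · have := norm_trapezoid_le (fun r hr => (hd x hx r hr).sub (hd y hy r hr))
      (fun r hr => (hd1 x hx r hr).sub (hd1 y hy r hr))
      (fun r hr => (hd2 x hx r hr).sub (hd2 y hy r hr))
      (fun r hr => (h1 r hr).lip x hx y hy) hk ht₁ ht₂
    refine (le_of_eq (congrArg norm ?_)).trans (this.trans (le_of_eq (by ring)))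
    simp only [Pi.sub_apply]
    module

/-- The defect of the central second difference in space. -/
def laplaceDefect (T xa xb h : ℝ) (w : ℝ × ℝ → E) (t x : ℝ) : E :=
  w (t, x + h) + w (t, x - h) - (w (t, x) + w (t, x)) -
    h ^ 2 • partialWithin (rect T xa xb) (0, 1) (partialWithin (rect T xa xb) (0, 1) w) (t, x)

/-- The roles of the variables are exchanged: the Taylor estimate in x is applied to the slice at t,
to a difference of two slices and to a second difference of slices in time. The fourth space
derivative is still C² in time, and this is what uses six derivatives. -/
theorem exists_bound_laplaceDefect (hT : 0 < T) (hab : xa < xb) {w : ℝ × ℝ → E}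
    (hw : ContDiffOn ℝ (6 : ℕ) w (rect T xa xb)) :
    ∃ M, 0 ≤ M ∧ ∀ x h, 0 ≤ h → x - h ∈ Set.Icc xa xb → x + h ∈ Set.Icc xa xb →
      (∀ t ∈ Set.Icc 0 T, ‖laplaceDefect T xa xb h w t x‖ ≤ M * h ^ 4) ∧
      (∀ t ∈ Set.Icc 0 T, ∀ s ∈ Set.Icc 0 T,
        ‖laplaceDefect T xa xb h w t x - laplaceDefect T xa xb h w s x‖ ≤
          M * |t - s| * h ^ 4) ∧
      (∀ t k, 0 ≤ k → t - k ∈ Set.Icc 0 T → t + k ∈ Set.Icc 0 T →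
        ‖laplaceDefect T xa xb h w (t + k) x + laplaceDefect T xa xb h w (t - k) x -
          (laplaceDefect T xa xb h w t x + laplaceDefect T xa xb h w t x)‖ ≤
          M * k ^ 2 * h ^ 4) := by
  set D := fun w : ℝ × ℝ → E => partialWithin (rect T xa xb) (0, 1) w with hD
  have hw1 : ContDiffOn ℝ (5 : ℕ) (D w) (rect T xa xb) :=
    contDiffOn_partialWithin hT hab (by norm_num) (0, 1) hw
  have hw2 : ContDiffOn ℝ (4 : ℕ) (D (D w)) (rect T xa xb) :=
    contDiffOn_partialWithin hT hab (by norm_num) (0, 1) hw1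
  have hw3 : ContDiffOn ℝ (3 : ℕ) (D (D (D w))) (rect T xa xb) :=
    contDiffOn_partialWithin hT hab (by norm_num) (0, 1) hw2
  have hw4 : ContDiffOn ℝ (2 : ℕ) (D (D (D (D w)))) (rect T xa xb) :=
    contDiffOn_partialWithin hT hab (by norm_num) (0, 1) hw3
  obtain ⟨M₁, hM₁, b1⟩ := exists_bound_rect hw4
  obtain ⟨M₂, hM₂, b2⟩ := exists_bddLip_sub hT hab le_rfl hw4
  obtain ⟨M₃, hM₃, b3⟩ := exists_bound_centralDiff hT hab le_rfl hw4
  have d0 : ∀ t ∈ Set.Icc 0 T, ∀ y ∈ Set.Icc xa xb,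
      HasDerivWithinAt (fun y => w (t, y)) (D w (t, y)) (Set.Icc xa xb) y :=
    fun t ht y hy => hasDerivWithinAt_space (by norm_num) hw ht hy
  have d1 : ∀ t ∈ Set.Icc 0 T, ∀ y ∈ Set.Icc xa xb,
      HasDerivWithinAt (fun y => D w (t, y)) (D (D w) (t, y)) (Set.Icc xa xb) y :=
    fun t ht y hy => hasDerivWithinAt_space (by norm_num) hw1 ht hy
  have d2 : ∀ t ∈ Set.Icc 0 T, ∀ y ∈ Set.Icc xa xb,
      HasDerivWithinAt (fun y => D (D w) (t, y)) (D (D (D w)) (t, y)) (Set.Icc xa xb) y :=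
    fun t ht y hy => hasDerivWithinAt_space (by norm_num) hw2 ht hy
  have d3 : ∀ t ∈ Set.Icc 0 T, ∀ y ∈ Set.Icc xa xb,
      HasDerivWithinAt (fun y => D (D (D w)) (t, y)) (D (D (D (D w))) (t, y)) (Set.Icc xa xb) y :=
    fun t ht y hy => hasDerivWithinAt_space (by norm_num) hw3 ht hy
  refine ⟨2 * (M₁ + M₂ + M₃), by positivity, fun x h hh hx₁ hx₂ => ⟨fun t ht => ?_,
    fun t ht s hs => ?_, fun t k hk ht₁ ht₂ => ?_⟩⟩
  · refine (norm_centralDiff_sub_le (d0 t ht) (d1 t ht) (d2 t ht) (d3 t ht)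
      (fun y hy => b1 t ht y hy) hh hx₁ hx₂).trans ?_
    have : 0 ≤ h ^ 4 := by positivity
    nlinarith
  · have := norm_centralDiff_sub_le (fun y hy => (d0 t ht y hy).sub (d0 s hs y hy))
      (fun y hy => (d1 t ht y hy).sub (d1 s hs y hy))
      (fun y hy => (d2 t ht y hy).sub (d2 s hs y hy))
      (fun y hy => (d3 t ht y hy).sub (d3 s hs y hy))
      (fun y hy => (b2 t ht s hs).bdd y hy) hh hx₁ hx₂
    refine (le_of_eq (congrArg norm ?_)).trans (this.trans ?_)
    · simp only [laplaceDefect, Pi.sub_apply, hD]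
      module
    · have : 0 ≤ |t - s| * h ^ 4 := by positivity
      nlinarith
  · have ht : t ∈ Set.Icc 0 T := ⟨by linarith [ht₁.1], by linarith [ht₂.2]⟩
    have := norm_centralDiff_sub_le
      (fun y hy => ((d0 _ ht₂ y hy).add (d0 _ ht₁ y hy)).sub ((d0 t ht y hy).add (d0 t ht y hy)))
      (fun y hy => ((d1 _ ht₂ y hy).add (d1 _ ht₁ y hy)).sub ((d1 t ht y hy).add (d1 t ht y hy)))
      (fun y hy => ((d2 _ ht₂ y hy).add (d2 _ ht₁ y hy)).sub ((d2 t ht y hy).add (d2 t ht y hy)))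
      (fun y hy => ((d3 _ ht₂ y hy).add (d3 _ ht₁ y hy)).sub ((d3 t ht y hy).add (d3 t ht y hy)))
      (fun y hy => b3 t k hk ht₁ ht₂ y hy) hh hx₁ hx₂
    refine (le_of_eq (congrArg norm ?_)).trans (this.trans ?_)
    · simp only [laplaceDefect, Pi.sub_apply, Pi.add_apply, hD]
      module
    · have : 0 ≤ k ^ 2 * h ^ 4 := by positivity
      nlinarith

end Rectangle

end

end RelaxNLS

namespace RelaxNLS

noncomputable section

/-! A discrete Gronwall argument -/

/-- The recursive inequalities that couple the increments `a` of the solution error, their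
corrected version `y`, the sums `s` of the increments and the relaxation errors `p`; the
inequalities at level `n` may depend on the condition `β n`. -/
structure ErrorRecursion (N : ℕ) (K τ E : ℝ) (β : ℕ → Prop) (a y s p : ℕ → ℝ) : Prop where
  a_nonneg : ∀ n, 0 ≤ a n
  s_zero : s 0 = 0
  s_succ : ∀ n, s (n + 1) = s n + a (n + 1)
  p_zero : p 0 ≤ K * E
  p_one : 2 ≤ N → p 1 ≤ p 0 + K * (s 1 + E)
  p_step : ∀ n, 2 ≤ n → n < N → β n → p n ≤ p (n - 2) + K * (a n + τ * s n + τ * E)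
  a_le : ∀ n, 2 ≤ n → n ≤ N → a n ≤ y n + K * τ * (p (n - 1) + p (n - 2) + s n + E)
  y_step : ∀ n, 2 ≤ n → n < N → β n → y (n + 1) ≤ y n +
    K * τ * (a (n + 1) + a n + a (n - 1) + τ * (p n + p (n - 2) + s (n + 1) + E))
  a_one : a 1 ≤ K * τ * (p 0 + s 1 + E)
  y_two : 2 ≤ N → y 2 ≤ a 1 + K * τ * (p 1 + p 0 + s 2 + E)

namespace ErrorRecursion

variable {N : ℕ} {K τ E : ℝ} {β : ℕ → Prop} {a y s p : ℕ → ℝ}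

theorem s_mono (h : ErrorRecursion N K τ E β a y s p) : Monotone s :=
  monotone_nat_of_le_succ fun n => by
    rw [h.s_succ]
    linarith [h.a_nonneg (n + 1)]

theorem s_one_eq (h : ErrorRecursion N K τ E β a y s p) : s 1 = a 1 := by
  rw [h.s_succ, h.s_zero, zero_add]

/-- The first step is implicit: a 1 occurs on the right as well, with a factor Kτ ≤ 1/61, and is
absorbed. The number 61 is the value of 21 + 40K at K = 1. -/
theorem a_one_le (h : ErrorRecursion N K τ E β a y s p) (hK : 1 ≤ K) (hτ : 0 < τ) (hE : 0 < E)
    (hc : K * (21 + 40 * K) * τ ≤ 1) : a 1 ≤ 4 * K ^ 2 * τ * E ∧ a 1 ≤ E := by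
  have h1 := h.a_one
  rw [h.s_one_eq] at h1
  have hKτ : 0 < K * τ := by positivity
  have h2 : K * τ ≤ 1 / 61 := by nlinarith
  have h3 : K * τ * p 0 ≤ K * τ * (K * E) := mul_le_mul_of_nonneg_left h.p_zero hKτ.le
  have h4 : K * τ * a 1 ≤ 1 / 61 * a 1 := mul_le_mul_of_nonneg_right h2 (h.a_nonneg 1)
  have h5 : K * τ * E ≤ K * (K * τ * E) := le_mul_of_one_le_left (by positivity) hK
  have h6 : a 1 ≤ 4 * K ^ 2 * τ * E := by
    have := h.a_nonneg 1
    nlinarith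
  have h7 : 4 * K ^ 2 * τ ≤ 1 := by nlinarith
  exact ⟨h6, h6.trans (mul_le_of_le_one_left hE.le h7)⟩

theorem base (h : ErrorRecursion N K τ E β a y s p) (hK : 1 ≤ K) (hτ : 0 < τ) (hE : 0 < E)
    (hc : K * (21 + 40 * K) * τ ≤ 1) (hN : 2 ≤ N) :
    y 2 ≤ τ * (11 * K ^ 2 * E) ∧ p 0 ≤ 11 * K ^ 2 * E ∧ p 1 ≤ 11 * K ^ 2 * E ∧
      s 2 ≤ 11 * K ^ 2 * E ∧ a 2 ≤ (4 + 10 * K) * τ * (11 * K ^ 2 * E) ∧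
      a 1 ≤ (4 + 10 * K) * τ * (11 * K ^ 2 * E) := by
  obtain ⟨h1, h1'⟩ := h.a_one_le hK hτ hE hc
  have hKE : 0 < K * E := by positivity
  have hKτ : 0 < K * τ := by positivity
  have hκ : K * τ ≤ 1 / 61 := by nlinarith
  have hκ2 : K * (K * τ) ≤ 1 / 40 := by nlinarith
  have hEK : E ≤ K * E := le_mul_of_one_le_left hE.le hK
  have hEK2 : K * E ≤ K ^ 2 * E := by nlinarith
  have hp0 := h.p_zero
  have hp1 : p 1 ≤ 3 * K * E := by
    have h2 := h.p_one hN
    rw [h.s_one_eq] at h2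
    have : K * (a 1 + E) ≤ K * (E + E) := by gcongr
    linarith
  have hs2 : s 2 = a 1 + a 2 := by rw [h.s_succ 1, h.s_one_eq]
  have hy2 := h.y_two hN
  have ha2 := h.a_le 2 le_rfl hN
  simp only [Nat.reduceSub, hs2] at hy2 ha2
  have b1 : K * τ * (p 1 + p 0 + (a 1 + a 2) + E) ≤ K * τ * (6 * (K * E)) + K * τ * a 2 := by
    rw [← mul_add]
    exact mul_le_mul_of_nonneg_left (by linarith) hKτ.le
  have b2 : K * τ * a 2 ≤ 1 / 61 * a 2 := mul_le_mul_of_nonneg_right hκ (h.a_nonneg 2)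
  have e1 : K * τ * (6 * (K * E)) = 6 * (K ^ 2 * τ * E) := by ring
  have hZ : 0 < K ^ 2 * τ * E := by positivity
  have ha2' : a 2 ≤ 32 * (K ^ 2 * τ * E) := by linarith [h.a_nonneg 2]
  have hZ1 : K ^ 2 * τ * E ≤ 1 / 40 * E := by
    refine mul_le_mul_of_nonneg_right ?_ hE.le
    linarith
  have hL : 4 * (K ^ 2 * τ * E) * 11 ≤ (4 + 10 * K) * τ * (11 * K ^ 2 * E) := by
    have : 0 ≤ K * (K ^ 2 * τ * E) := by positivity
    nlinarith
  refine ⟨?_, by linarith, by linarith, by linarith, by linarith, by linarith⟩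
  have e2 : τ * (11 * K ^ 2 * E) = 11 * (K ^ 2 * τ * E) := by ring
  linarith

/-- With L = 4 + 10K the invariant reads: y is at most τM, p and s at most M, and the last two
increments at most LτM. The increments carry the larger constant L because undoing the correction
costs Kτ(p + p + s + E), which is of the order KτM. Since 21 + 40K = 4L + 5, the growth factor is
exactly what the bound for y requires once a (n + 1) ≤ LτM is inserted. -/
theorem step (h : ErrorRecursion N K τ E β a y s p) (hK : 1 ≤ K) (hτ : 0 < τ)
    (hc : K * (21 + 40 * K) * τ ≤ 1) {n : ℕ} (hn : 2 ≤ n) (hnN : n < N) (hβ : β n) {M : ℝ}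
    (hE : 0 < E) (hEM : E ≤ M) (hy : y n ≤ τ * M) (hp : ∀ k < n, p k ≤ M) (hs : s n ≤ M)
    (ha : a n ≤ (4 + 10 * K) * τ * M) (ha' : a (n - 1) ≤ (4 + 10 * K) * τ * M) :
    y (n + 1) ≤ τ * (M * (1 + K * (21 + 40 * K) * τ)) ∧ p n ≤ M * (1 + K * (21 + 40 * K) * τ) ∧
      s (n + 1) ≤ M * (1 + K * (21 + 40 * K) * τ) ∧ a (n + 1) ≤ (4 + 10 * K) * τ * M := by
  have hM : 0 < M := hE.trans_le hEM
  have hKτ : 0 < K * τ := by positivity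
  have hκ : K * τ ≤ 1 / 61 := by nlinarith
  have hτM : 0 < τ * M := by positivity
  have hKτM : 0 < K * τ * M := by positivity
  have hτ1 : τ ≤ 1 := by nlinarith
  set L := 4 + 10 * K with hL
  have hLc : K * (21 + 40 * K) = K * (4 * L + 5) := by rw [hL]; ring
  rw [hLc] at hc ⊢
  have hL0 : 0 < L := by positivity
  have p1 := hp (n - 1) (by omega)
  have p2 := hp (n - 2) (by omega)
  have hpn : p n ≤ M * (1 + K * (L + 2) * τ) := by
    have h1 := h.p_step n hn hnN hβ
    have : K * (a n + τ * s n + τ * E) ≤ K * (L * τ * M + τ * M + τ * M) := by gcongr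
    linarith
  have hpn2 : p n ≤ 2 * M := by
    refine hpn.trans ?_
    have : K * (L + 2) * τ ≤ K * (4 * L + 5) * τ := by gcongr <;> linarith
    nlinarith
  have hX0 := h.a_nonneg (n + 1)
  have hss := h.s_succ n
  set X := a (n + 1) with hX
  have hY : y (n + 1) ≤ τ * M + 2 * (K * τ * X) + K * τ * (τ * M) * (2 * L + 5) := by
    have h1 := h.y_step n hn hnN hβ
    have h2 : τ * (p n + p (n - 2) + s (n + 1) + E) ≤ τ * (2 * M + M + (M + X) + M) := by
      gcongr
      linarith
    have h3 : τ * X ≤ X := mul_le_of_le_one_left hX0 hτ1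
    have h4 : K * τ * (X + a n + a (n - 1) + τ * (p n + p (n - 2) + s (n + 1) + E)) ≤
        K * τ * (X + L * τ * M + L * τ * M + (5 * (τ * M) + X)) := by
      refine mul_le_mul_of_nonneg_left ?_ hKτ.le
      linarith
    linarith
  -- The new increment enters its own bound with total factor 3Kτ ≤ 3/61, while the remaining terms
  -- add up to at most (2 + 5K)τM; L is twice 2 + 5K, which leaves room for the absorption.
  have hXle : X ≤ L * τ * M := by
    have h1 := h.a_le (n + 1) (by omega) hnN
    have e1 : n + 1 - 1 = n := by omega
    have e2 : n + 1 - 2 = n - 1 := by omega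
    rw [e1, e2] at h1
    have h2 : K * τ * (p n + p (n - 1) + s (n + 1) + E) ≤ K * τ * (2 * M + M + (M + X) + M) := by
      gcongr
      linarith
    have h3 : K * τ * X ≤ 1 / 61 * X := mul_le_mul_of_nonneg_right hκ hX0
    have h4 : K * τ * (2 * L + 5) ≤ 1 := by nlinarith
    have h5 : K * τ * (2 * L + 5) * (τ * M) ≤ τ * M := mul_le_of_le_one_left hτM.le h4
    rw [hL]
    linarith
  have hKX : K * τ * X ≤ K * τ * (L * τ * M) := mul_le_mul_of_nonneg_left hXle hKτ.le
  refine ⟨by linarith, ?_, ?_, hXle⟩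
  · refine hpn.trans ?_
    have : K * (L + 2) * τ ≤ K * (4 * L + 5) * τ := by gcongr <;> linarith
    nlinarith
  · rw [hss]
    have : 0 ≤ (K - 1) * (L * (τ * M)) := mul_nonneg (by linarith) (by positivity)
    have : 0 ≤ K * (L * (τ * M)) := by positivity
    linarith

/-- The invariant of `step` is carried with the majorant 11K²E(1 + cτ)^n, which stays below CE up to
n = N. The condition β n is therefore available exactly when the step from n to n + 1 needs it,
because it follows from bounds already proved. -/
theorem bound (h : ErrorRecursion N K τ E β a y s p) (hK : 1 ≤ K) (hτ : 0 < τ)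
    (hc : K * (21 + 40 * K) * τ ≤ 1) (hE : 0 < E) (hN : 1 ≤ N) {C : ℝ}
    (hC : C = 11 * K ^ 2 * Real.exp (K * (21 + 40 * K) * (N * τ)))
    (hβ : ∀ n, 2 ≤ n → n < N → (∀ k ≤ n, s k ≤ C * E) → (∀ k < n, p k ≤ C * E) → β n) :
    (∀ k ≤ N, s k ≤ C * E) ∧ ∀ k < N, p k ≤ C * E := by
  set c := K * (21 + 40 * K) with hcdef
  have hc0 : 0 < c * τ := by positivity
  set M : ℕ → ℝ := fun n => 11 * K ^ 2 * E * (1 + c * τ) ^ n with hM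
  have hA : E ≤ 11 * K ^ 2 * E := le_mul_of_one_le_left hE.le (by nlinarith)
  have hAM : ∀ n, 11 * K ^ 2 * E ≤ M n := fun n =>
    le_mul_of_one_le_right (by positivity) (one_le_pow₀ (by linarith))
  have hMC : ∀ n ≤ N, M n ≤ C * E := fun n hn => by
    have h1 : (1 + c * τ) ^ n ≤ Real.exp (c * (N * τ)) := by
      calc (1 + c * τ) ^ n ≤ (1 + c * τ) ^ N := pow_le_pow_right₀ (by linarith) hn
        _ ≤ Real.exp (c * τ) ^ N := by
            refine pow_le_pow_left₀ (by positivity) ?_ N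
            linarith [Real.add_one_le_exp (c * τ)]
        _ = Real.exp (c * (N * τ)) := by
            rw [← Real.exp_nat_mul]; congr 1; ring
    rw [hC]
    have := mul_le_mul_of_nonneg_left h1 (by positivity : (0 : ℝ) ≤ 11 * K ^ 2 * E)
    linarith
  have key : ∀ n, 2 ≤ n → n ≤ N → y n ≤ τ * M n ∧ (∀ k < n, p k ≤ M n) ∧ s n ≤ M n ∧
      a n ≤ (4 + 10 * K) * τ * M n ∧ a (n - 1) ≤ (4 + 10 * K) * τ * M n := by
    intro n hn
    induction n, hn using Nat.le_induction with
    | base =>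
      intro hN2
      obtain ⟨b1, b2, b3, b4, b5, b6⟩ := h.base hK hτ hE hc hN2
      have hA2 := hAM 2
      have hLτ : 0 ≤ (4 + 10 * K) * τ := by positivity
      refine ⟨b1.trans (mul_le_mul_of_nonneg_left hA2 hτ.le), fun k hk => ?_, b4.trans hA2,
        b5.trans (mul_le_mul_of_nonneg_left hA2 hLτ), b6.trans (mul_le_mul_of_nonneg_left hA2 hLτ)⟩
      interval_cases k
      · exact b2.trans hA2
      · exact b3.trans hA2
    | succ n hn ih =>
      intro hnN
      obtain ⟨b1, b2, b3, b4, b5⟩ := ih (by omega)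
      have hMn := hMC n (by omega)
      obtain ⟨d1, d2, d3, d4⟩ := h.step hK hτ hc hn (by omega)
        (hβ n hn (by omega) (fun k hk => (h.s_mono hk).trans (b3.trans hMn))
          (fun k hk => (b2 k hk).trans hMn)) hE (hA.trans (hAM n)) b1 b2 b3 b4 b5
      have hMs : M (n + 1) = M n * (1 + c * τ) := by
        simp only [hM]; ring
      have hM0 : 0 ≤ M n := (by positivity : (0 : ℝ) ≤ 11 * K ^ 2 * E).trans (hAM n)
      have hMM : M n ≤ M (n + 1) := by
        rw [hMs]; exact le_mul_of_one_le_right hM0 (by linarith)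
      have hLτ : 0 ≤ (4 + 10 * K) * τ := by positivity
      rw [Nat.add_sub_cancel]
      refine ⟨hMs ▸ d1, fun k hk => ?_, hMs ▸ d3, d4.trans (mul_le_mul_of_nonneg_left hMM hLτ),
        b4.trans (mul_le_mul_of_nonneg_left hMM hLτ)⟩
      rcases Nat.lt_succ_iff_lt_or_eq.1 hk with hk' | rfl
      · exact (b2 k hk').trans hMM
      · exact hMs ▸ d2
  have hAC := (hAM 0).trans (hMC 0 (by omega))
  -- The invariant starts at n = 2; a computation with a single time step is covered by the estimate
  -- of the first increment.
  rcases Nat.lt_or_ge N 2 with hN2 | hN2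
  · have hN1 : N = 1 := by omega
    constructor
    · intro k hk
      refine (h.s_mono hk).trans ?_
      rw [hN1, h.s_one_eq]
      exact (h.a_one_le hK hτ hE hc).2.trans (hA.trans hAC)
    · intro k hk
      obtain rfl : k = 0 := by omega
      have : K * E ≤ 11 * K ^ 2 * E := by
        refine mul_le_mul_of_nonneg_right ?_ hE.le
        nlinarith
      exact h.p_zero.trans (this.trans hAC)
  · obtain ⟨_, b2, b3, _⟩ := key N hN2 le_rfl
    have hMN := hMC N le_rfl
    exact ⟨fun k hk => (h.s_mono hk).trans (b3.trans hMN), fun k hk => (b2 k hk).trans hMN⟩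

end ErrorRecursion

end

end RelaxNLS

namespace RelaxNLS

noncomputable section

/-! From the error equations to the recursive inequalities -/

section SecondDiffBound

variable {E G : Type*} [NormedAddCommGroup E] [NormedAddCommGroup G]

/-- The seminorm estimates for second differences of `F` along mesh functions, with
constant `K`. -/
def SecondDiffBound (F : E → G) (J : ℕ) (h M K : ℝ) : Prop :=
  ∀ τ : ℝ, 0 ≤ τ → ∀ a b x y : Fin (J + 2) → E, x 0 = 0 → y 0 = 0 →
    (∀ j, ‖incr b j‖ ≤ M * h) → (∀ j, ‖(a - b) j‖ ≤ M * τ) →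
    (∀ j, ‖incr (a - b) j‖ ≤ M * τ * h) →
      sem h (fun j => F (a j) - F (a j - x j) - (F (b j) - F (b j - y j))) ≤
        K * (τ * sem h x + τ * sem h y + sem h (x - y) * (1 + sem h y)) ∧
      sem h (fun j => F (a j) - F (a j - x j) - (F (b j) - F (b j - y j))) ≤
        K / h * (τ * sem h x + sem h (x - y))

variable {F : E → G} {J : ℕ} {h M K : ℝ}

theorem SecondDiffBound.mono (hF : SecondDiffBound F J h M K) {K' : ℝ} (hKK : K ≤ K')
    (hh : 0 < h) : SecondDiffBound F J h M K' := by
  intro τ hτ a b x y hx hy h1 h2 h3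
  obtain ⟨e1, e2⟩ := hF τ hτ a b x y hx hy h1 h2 h3
  have p1 := sem_nonneg h x
  have p2 := sem_nonneg h y
  have p3 := sem_nonneg h (x - y)
  exact ⟨e1.trans (mul_le_mul_of_nonneg_right hKK (by positivity)),
    e2.trans (mul_le_mul_of_nonneg_right (div_le_div_of_nonneg_right hKK hh.le) (by positivity))⟩

theorem SecondDiffBound.sem_diff_le (hF : SecondDiffBound F J h M K) {a x : Fin (J + 2) → E}
    (hx : x 0 = 0) (ha : ∀ j, ‖incr a j‖ ≤ M * h) :
    sem h (fun j => F (a j) - F (a j - x j)) ≤ K * sem h x := by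
  -- A first difference is the second difference with b = a, y = 0 and τ = 0; no quadratic term
  -- remains.
  have := (hF 0 le_rfl a a x 0 hx rfl ha (fun j => by simp) (fun j => by simp [incr])).1
  simpa [sem_zero] using this

/-- Both regimes give the same linear bound: if sem h y ≤ 1 the factor 1 + sem h y is at most 2, and
on a coarse mesh K/h is itself at most k. -/
theorem SecondDiffBound.sem_secondDiff_le (hF : SecondDiffBound F J h M K) {k : ℝ} {τ : ℝ}
    (hτ : 0 ≤ τ) {a b x y : Fin (J + 2) → E} (hx : x 0 = 0) (hy : y 0 = 0)
    (h1 : ∀ j, ‖incr b j‖ ≤ M * h) (h2 : ∀ j, ‖(a - b) j‖ ≤ M * τ)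
    (h3 : ∀ j, ‖incr (a - b) j‖ ≤ M * τ * h)
    (hk : 0 < K ∧ 2 * K ≤ k ∧ sem h y ≤ 1 ∨ K / h ≤ k ∧ 0 ≤ k) :
    sem h (fun j => F (a j) - F (a j - x j) - (F (b j) - F (b j - y j))) ≤
      k * (τ * sem h x + τ * sem h y + sem h (x - y)) := by
  obtain ⟨e1, e2⟩ := hF τ hτ a b x y hx hy h1 h2 h3
  have p1 := sem_nonneg h x
  have p2 := sem_nonneg h y
  have p3 := sem_nonneg h (x - y)
  rcases hk with ⟨hK, hk, hy1⟩ | ⟨hk, hk0⟩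
  · refine e1.trans ?_
    have q1 : τ * sem h x + τ * sem h y + sem h (x - y) * (1 + sem h y) ≤
        2 * (τ * sem h x + τ * sem h y + sem h (x - y)) := by
      have : 0 ≤ τ * sem h x := by positivity
      have : 0 ≤ τ * sem h y := by positivity
      nlinarith
    have q2 : 0 ≤ τ * sem h x + τ * sem h y + sem h (x - y) := by positivity
    nlinarith
  · refine (e2.trans (mul_le_mul_of_nonneg_right hk (by positivity))).trans ?_
    refine mul_le_mul_of_nonneg_left ?_ hk0
    have : 0 ≤ τ * sem h y := by positivity
    linarith

end SecondDiffBound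

theorem sem_prodMk_le {E₁ E₂ : Type*} [NormedAddCommGroup E₁] [NormedAddCommGroup E₂] {J : ℕ}
    {h : ℝ} (hh : 0 < h) (x : Fin (J + 2) → E₁) (y : Fin (J + 2) → E₂) :
    sem h (fun j => (x j, y j)) ≤ sem h x + sem h y := by
  have := sem_le_of_incr_le (c := 0) (k := 1) (d := 1) hh le_rfl zero_le_one zero_le_one
    (x := fun j => (x j, y j)) (y := x) (z := y) fun j => by
      rw [zero_mul, zero_add, one_mul, one_mul]
      exact max_le (le_add_of_nonneg_right (norm_nonneg _)) (le_add_of_nonneg_left (norm_nonneg _))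
  simpa using this

/-- The density term `g(|γ_δ(z)|²)` of the relaxation step. -/
def density (δ : ℝ) (g : ℝ → ℝ) (z : ℂ) : ℝ := g (‖cMollifier δ z‖ ^ 2)

/-- The difference of the nonlinear terms at `(G, U)` and at `(Φ, V)`. -/
def nonlinDiff {J : ℕ} (δ : ℝ) (U V : ℕ → CGrid J) (G Φ : ℕ → RGrid J) (n : ℕ) : CGrid J :=
  fun j => nonlin δ (G n j, (U (n + 1) j + U n j) / 2) - nonlin δ (Φ n j, (V (n + 1) j + V n j) / 2)

/-- The error equations of the scheme, and the size of the quantities that enter them. The error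
`U - V` is split into `ε + θ`, and `R` is the residual. -/
structure ErrorEquations {J : ℕ} (N : ℕ) (δ : ℝ) (g : ℝ → ℝ) (h τ M : ℝ)
    (U V ε θ R : ℕ → CGrid J) (G Φ : ℕ → RGrid J) : Prop where
  err_zero : ∀ n ≤ N, U n 0 - V n 0 = 0
  relax_err_zero : ∀ n < N, G n 0 - Φ n 0 = 0
  split : ∀ n ≤ N, U n - V n = ε n + θ n
  θ_zero : θ 0 = 0
  incr_U : ∀ n ≤ N, ∀ j, ‖incr (U n) j‖ ≤ M * h
  incr_G : ∀ n < N, ∀ j, ‖incr (G n) j‖ ≤ M * h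
  diff_U : ∀ n < N, ∀ j, ‖(U (n + 1) - U n) j‖ ≤ M * τ
  incr_diff_U : ∀ n < N, ∀ j, ‖incr (U (n + 1) - U n) j‖ ≤ M * τ * h
  diff_G : ∀ n, n + 2 < N → ∀ j, ‖(G (n + 2) - G n) j‖ ≤ 2 * M * τ
  incr_diff_G : ∀ n, n + 2 < N → ∀ j, ‖incr (G (n + 2) - G n) j‖ ≤ 2 * M * τ * h
  sem_relax_zero : sem h (G 0 - Φ 0) ≤ M * τ
  relax : ∀ n, n + 1 < N → ∃ ρ : RGrid J, sem h ρ ≤ M * τ ^ 2 ∧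
    (G (n + 1) - Φ (n + 1)) + (G n - Φ n) =
      (2 : ℝ) • (fun j => density δ g (U (n + 1) j) - density δ g (V (n + 1) j)) + ρ
  sem_ε : ∀ n ≤ N, sem h (ε n) ≤ M * h ^ 2
  sem_diff_ε : ∀ n < N, sem h (ε (n + 1) - ε n) ≤ M * (τ * h ^ 2)
  step : ∀ n < N, θ (n + 1) - θ n =
    (Complex.I * (τ : ℂ)) • discLaplacian h ((2⁻¹ : ℂ) • (θ (n + 1) + θ n)) +
      (Complex.I * (τ : ℂ)) • nonlinDiff δ U V G Φ n + R n
  sem_R : sem h (R 0) ≤ M * (τ * (τ + h ^ 2))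
  sem_diff_R : ∀ n, n + 1 < N → sem h (R (n + 1) - R n) ≤ M * (τ ^ 2 * (τ + h ^ 2))

namespace ErrorEquations

variable {J N : ℕ} {δ : ℝ} {g : ℝ → ℝ} {h τ M K k : ℝ} {U V ε θ R : ℕ → CGrid J}
  {G Φ : ℕ → RGrid J}

/-- The correction of the increments of `θ`. -/
def correction (δ τ : ℝ) (U V : ℕ → CGrid J) (G Φ : ℕ → RGrid J) (n : ℕ) : CGrid J :=
  (Complex.I * (τ : ℂ) / 2) • (nonlinDiff δ U V G Φ n - nonlinDiff δ U V G Φ (n - 1))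

theorem norm_I_mul_div_two (hτ : 0 ≤ τ) : ‖Complex.I * (τ : ℂ) / 2‖ = τ / 2 := by
  rw [norm_div, norm_mul, Complex.norm_I, one_mul, Complex.norm_real, Real.norm_of_nonneg hτ]
  simp

theorem norm_I_mul (hτ : 0 ≤ τ) : ‖Complex.I * (τ : ℂ)‖ = τ := by
  rw [norm_mul, Complex.norm_I, one_mul, Complex.norm_real, Real.norm_of_nonneg hτ]

/-- The partial sums of the seminorms of the increments of `θ`. -/
def incrSum (h : ℝ) (θ : ℕ → CGrid J) (n : ℕ) : ℝ :=
  ∑ i ∈ Finset.range n, sem h (θ (i + 1) - θ i)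

theorem sem_θ_le (H : ErrorEquations N δ g h τ M U V ε θ R G Φ) (n : ℕ) :
    sem h (θ n) ≤ incrSum h θ n := by
  induction n with
  | zero => rw [H.θ_zero, sem_zero, incrSum, Finset.sum_range_zero]
  | succ n ih =>
    rw [incrSum, Finset.sum_range_succ, ← incrSum]
    have : θ (n + 1) = θ n + (θ (n + 1) - θ n) := by abel
    rw [this]
    refine (sem_add_le _ _ _).trans ?_
    rw [← this]
    linarith

theorem sem_err_le (H : ErrorEquations N δ g h τ M U V ε θ R G Φ) (hM : 0 ≤ M) (hτ : 0 ≤ τ)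
    {n : ℕ} (hn : n ≤ N) : sem h (U n - V n) ≤ M * (τ + h ^ 2) + incrSum h θ n := by
  rw [H.split n hn]
  refine (sem_add_le _ _ _).trans (add_le_add ((H.sem_ε n hn).trans ?_) (H.sem_θ_le n))
  exact mul_le_mul_of_nonneg_left (by linarith) hM

theorem sem_diff_err_le (H : ErrorEquations N δ g h τ M U V ε θ R G Φ) (hM : 0 ≤ M) (hτ : 0 ≤ τ)
    {n : ℕ} (hn : n < N) : sem h ((U (n + 1) - V (n + 1)) - (U n - V n)) ≤
      M * (τ * (τ + h ^ 2)) + sem h (θ (n + 1) - θ n) := by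
  rw [H.split n hn.le, H.split (n + 1) hn, add_sub_add_comm]
  refine (sem_add_le _ _ _).trans (add_le_add ((H.sem_diff_ε n hn).trans ?_) le_rfl)
  exact mul_le_mul_of_nonneg_left (mul_le_mul_of_nonneg_left (by linarith) hτ) hM

theorem incrSum_mono (h : ℝ) (θ : ℕ → CGrid J) : Monotone (incrSum h θ) :=
  monotone_nat_of_le_succ fun n => by
    rw [incrSum, incrSum, Finset.sum_range_succ]
    exact le_add_of_nonneg_right (sem_nonneg _ _)

/-- The condition under which the second-difference estimates hold with constant `k`. -/
def SmallOrCoarse (h K k : ℝ) (U V : ℕ → CGrid J) (G Φ : ℕ → RGrid J) (n : ℕ) : Prop :=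
  0 < K ∧ 2 * K ≤ k ∧ sem h (U (n + 1) - V (n + 1)) ≤ 1 ∧
    sem h (G n - Φ n) + 2⁻¹ * (sem h (U (n + 1) - V (n + 1)) + sem h (U n - V n)) ≤ 1 ∨
  K / h ≤ k ∧ 0 ≤ k

theorem sem_half_smul_add_le (x y : CGrid J) :
    sem h ((2⁻¹ : ℂ) • (x + y)) ≤ 2⁻¹ * (sem h x + sem h y) := by
  rw [sem_smul]
  have : ‖(2⁻¹ : ℂ)‖ = 2⁻¹ := by simp
  rw [this]
  exact mul_le_mul_of_nonneg_left (sem_add_le _ _ _) (by norm_num)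

theorem sem_nonlinErr_le (hh : 0 < h) (n : ℕ) :
    sem h (fun j => (G n j - Φ n j, (2⁻¹ : ℂ) • ((U (n + 1) - V (n + 1)) + (U n - V n)) j)) ≤
      sem h (G n - Φ n) + 2⁻¹ * (sem h (U (n + 1) - V (n + 1)) + sem h (U n - V n)) :=
  (sem_prodMk_le hh (G n - Φ n) ((2⁻¹ : ℂ) • ((U (n + 1) - V (n + 1)) + (U n - V n)))).trans
    (add_le_add le_rfl (sem_half_smul_add_le _ _))

theorem nonlinDiff_eq (n : ℕ) : nonlinDiff δ U V G Φ n = fun j =>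
    nonlin δ ((fun j => (G n j, ((2⁻¹ : ℂ) • (U (n + 1) + U n)) j)) j) -
      nonlin δ ((fun j => (G n j, ((2⁻¹ : ℂ) • (U (n + 1) + U n)) j)) j -
        (fun j => (G n j - Φ n j, (2⁻¹ : ℂ) • ((U (n + 1) - V (n + 1)) + (U n - V n)) j)) j) := by
  funext j
  simp only [nonlinDiff, Pi.smul_apply, Pi.add_apply, Pi.sub_apply, smul_eq_mul, Prod.mk_sub_mk,
    sub_sub_cancel]
  congr 3 <;> ring

theorem nonlinErr_zero (H : ErrorEquations N δ g h τ M U V ε θ R G Φ) {n : ℕ} (hn : n < N) :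
    (fun j => (G n j - Φ n j, (2⁻¹ : ℂ) • ((U (n + 1) - V (n + 1)) + (U n - V n)) j)) 0 = 0 := by
  have h1 := H.err_zero n hn.le
  have h2 := H.err_zero (n + 1) hn
  simp only [H.relax_err_zero n hn, Pi.add_apply, Pi.sub_apply, h1, h2, add_zero, smul_zero]
  rfl

theorem incr_half_smul_add (x y : CGrid J) (j : Fin (J + 1)) :
    incr ((2⁻¹ : ℂ) • (x + y)) j = (2⁻¹ : ℂ) * (incr x j + incr y j) := by
  simp only [incr, Pi.smul_apply, Pi.add_apply, smul_eq_mul]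
  ring

theorem norm_half_mul_add_le {z w : ℂ} {c : ℝ} (hz : ‖z‖ ≤ c) (hw : ‖w‖ ≤ c) :
    ‖(2⁻¹ : ℂ) * (z + w)‖ ≤ c := by
  rw [norm_mul]
  have : ‖(2⁻¹ : ℂ)‖ = 2⁻¹ := by simp
  rw [this]
  have := norm_add_le z w
  linarith

theorem incr_nonlinArg_le (H : ErrorEquations N δ g h τ M U V ε θ R G Φ) (hM : 0 ≤ M)
    (hh : 0 < h) {n : ℕ} (hn : n < N) (j : Fin (J + 1)) :
    ‖incr (fun j => (G n j, ((2⁻¹ : ℂ) • (U (n + 1) + U n)) j)) j‖ ≤ 2 * M * h := by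
  have hMh : 0 ≤ M * h := by positivity
  refine max_le ((H.incr_G n hn j).trans (by linarith)) ?_
  refine (le_of_eq (congrArg norm (incr_half_smul_add (U (n + 1)) (U n) j))).trans ?_
  refine norm_half_mul_add_le ((H.incr_U _ hn j).trans (by linarith))
    ((H.incr_U _ hn.le j).trans (by linarith))

theorem sem_nonlinDiff_le (H : ErrorEquations N δ g h τ M U V ε θ R G Φ) (hM : 1 ≤ M)
    (hh : 0 < h) (hτ : 0 ≤ τ) (hK : 0 ≤ K)
    (hF : SecondDiffBound (nonlin δ) J h (2 * M) K) {n : ℕ} (hn : n < N) :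
    sem h (nonlinDiff δ U V G Φ n) ≤
      K * (sem h (G n - Φ n) + M * (τ + h ^ 2) + incrSum h θ (n + 1)) := by
  rw [nonlinDiff_eq]
  refine (hF.sem_diff_le (H.nonlinErr_zero hn) (H.incr_nonlinArg_le (by linarith) hh hn)).trans ?_
  refine mul_le_mul_of_nonneg_left ((sem_nonlinErr_le hh n).trans ?_) hK
  have h1 := H.sem_err_le (by linarith) hτ hn.le
  have h2 := H.sem_err_le (by linarith) hτ hn
  have h3 := incrSum_mono h θ (Nat.le_succ n)
  rw [Nat.succ_eq_add_one] at h3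
  linarith

/-- The difference of two consecutive relaxation relations: η^{n+1} cancels, and the right side
becomes an increment in time of the density error, that is, a second difference. It is controlled by
the increment of the solution error plus τ times the errors. -/
theorem sem_relax_step_le (H : ErrorEquations N δ g h τ M U V ε θ R G Φ) (hM : 1 ≤ M)
    (hh : 0 < h) (hτ : 0 ≤ τ) (hk : 0 ≤ k)
    (hF : SecondDiffBound (density δ g) J h (2 * M) K) {n : ℕ} (hn : n + 2 < N)
    (hβ : SmallOrCoarse h K k U V G Φ n) :
    sem h ((G (n + 2) - Φ (n + 2)) - (G n - Φ n)) ≤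
      2 * (k * (sem h (θ (n + 2) - θ (n + 1)) + 2 * (τ * incrSum h θ (n + 2)) +
        3 * (M * (τ * (τ + h ^ 2))))) + 2 * (M * τ ^ 2) := by
  obtain ⟨ρ, hρ, e1⟩ := H.relax n (by omega)
  obtain ⟨ρ', hρ', e2⟩ := H.relax (n + 1) hn
  set D₁ : RGrid J := fun j => density δ g (U (n + 1) j) - density δ g (V (n + 1) j) with hD₁
  set D₂ : RGrid J := fun j => density δ g (U (n + 1 + 1) j) - density δ g (V (n + 1 + 1) j)
    with hD₂
  have e3 : (G (n + 2) - Φ (n + 2)) - (G n - Φ n) = (2 : ℝ) • (D₂ - D₁) + (ρ' - ρ) := by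
    have : (G (n + 2) - Φ (n + 2)) - (G n - Φ n) =
        ((G (n + 1 + 1) - Φ (n + 1 + 1)) + (G (n + 1) - Φ (n + 1))) -
          ((G (n + 1) - Φ (n + 1)) + (G n - Φ n)) := by abel
    rw [this, e1, e2, smul_sub]
    abel
  have hD : sem h (D₂ - D₁) ≤ k * (τ * sem h (U (n + 2) - V (n + 2)) +
      τ * sem h (U (n + 1) - V (n + 1)) +
        sem h ((U (n + 2) - V (n + 2)) - (U (n + 1) - V (n + 1)))) := by
    have := hF.sem_secondDiff_le (k := k) hτ (a := U (n + 2)) (b := U (n + 1))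
      (x := U (n + 2) - V (n + 2)) (y := U (n + 1) - V (n + 1))
      (H.err_zero (n + 2) hn.le) (H.err_zero (n + 1) (by omega))
      (fun j => (H.incr_U (n + 1) (by omega) j).trans (by nlinarith))
      (fun j => (H.diff_U (n + 1) (by omega) j).trans (by nlinarith))
      (fun j => (H.incr_diff_U (n + 1) (by omega) j).trans (by nlinarith [mul_nonneg hτ hh.le]))
      (hβ.imp (fun hb => ⟨hb.1, hb.2.1, hb.2.2.1⟩) id)
    refine (le_of_eq (congrArg (sem h) ?_)).trans this
    funext j
    simp only [hD₁, hD₂, Pi.sub_apply, sub_sub_cancel]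
  have h1 := H.sem_err_le (by linarith) hτ hn.le
  have h2 := H.sem_err_le (by linarith) hτ (n := n + 1) (by omega)
  have h3 := H.sem_diff_err_le (by linarith) hτ (n := n + 1) (by omega)
  have h4 := incrSum_mono h θ (Nat.le_succ (n + 1))
  have hD' : sem h (D₂ - D₁) ≤ k * (sem h (θ (n + 2) - θ (n + 1)) +
      2 * (τ * incrSum h θ (n + 2)) + 3 * (M * (τ * (τ + h ^ 2)))) := by
    refine hD.trans (mul_le_mul_of_nonneg_left ?_ hk)
    have t1 := mul_le_mul_of_nonneg_left h1 hτ
    have t2 := mul_le_mul_of_nonneg_left (h2.trans (add_le_add le_rfl h4)) hτ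
    have h3' : sem h ((U (n + 2) - V (n + 2)) - (U (n + 1) - V (n + 1))) ≤
      M * (τ * (τ + h ^ 2)) + sem h (θ (n + 2) - θ (n + 1)) := h3
    have t2' : τ * sem h (U (n + 1) - V (n + 1)) ≤
      τ * (M * (τ + h ^ 2) + incrSum h θ (n + 2)) := t2
    linarith
  rw [e3]
  refine (sem_add_le _ _ _).trans ?_
  rw [sem_smul, Real.norm_of_nonneg (by norm_num)]
  have := sem_sub_le h ρ' ρ
  linarith

theorem add_weighted_le (hk : 1 ≤ k) (hM : 1 ≤ M) {A₃ A₂ A₁ a b c e : ℝ} (h₃ : 0 ≤ A₃) (h₂ : 0 ≤ A₂)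
    (h₁ : 0 ≤ A₁) (ha : 0 ≤ a) (hb : 0 ≤ b) (hc : 0 ≤ c) (he : 0 ≤ e) :
    a + b + 2 * c + 6 * (M * e) + (A₃ + A₂ + A₁) + 2 * (k * (A₂ + 2 * c + 3 * (M * e))) ≤
      12 * k * M * (A₃ + A₂ + A₁ + (a + b + c + e)) := by
  have hk0 : 0 ≤ k := by linarith
  have hM0 : 0 ≤ M := by linarith
  have hkM : 1 ≤ k * M := by nlinarith
  have hkMk : k ≤ k * M := le_mul_of_one_le_right hk0 hM
  have hkMM : M ≤ k * M := le_mul_of_one_le_left hM0 hk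
  have t1 : a + b + A₃ + A₁ ≤ k * M * (a + b + A₃ + A₁) :=
    le_mul_of_one_le_left (by positivity) hkM
  have t2 : (1 + 2 * k) * A₂ ≤ 3 * (k * M) * A₂ := mul_le_mul_of_nonneg_right (by linarith) h₂
  have t3 : (2 + 4 * k) * c ≤ 6 * (k * M) * c := mul_le_mul_of_nonneg_right (by linarith) hc
  have t4 : (6 * M + 6 * (k * M)) * e ≤ 12 * (k * M) * e :=
    mul_le_mul_of_nonneg_right (by linarith) he
  have t5 : 0 ≤ k * M * (11 * (a + b + A₃ + A₁) + 9 * A₂ + 6 * c) := by positivity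
  linarith

/-- Over two steps the relaxation error changes little, by `sem_relax_step_le`, whereas over one
step it may change sign. The nonlinear term is treated as one function of the pair (potential,
averaged solution), and the older pair plays the role of y. -/
theorem sem_nonlinDiff_sub_le (H : ErrorEquations N δ g h τ M U V ε θ R G Φ) (hM : 1 ≤ M)
    (hh : 0 < h) (hτ : 0 ≤ τ) (hk : 1 ≤ k)
    (hF : SecondDiffBound (nonlin δ) J h (2 * M) K)
    (hF' : SecondDiffBound (density δ g) J h (2 * M) K) {n : ℕ} (hn : n + 2 < N)
    (hβ : SmallOrCoarse h K k U V G Φ n) :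
    sem h (nonlinDiff δ U V G Φ (n + 2) - nonlinDiff δ U V G Φ n) ≤
      12 * k ^ 2 * M * (sem h (θ (n + 3) - θ (n + 2)) + sem h (θ (n + 2) - θ (n + 1)) +
        sem h (θ (n + 1) - θ n) + τ * (sem h (G (n + 2) - Φ (n + 2)) + sem h (G n - Φ n) +
          incrSum h θ (n + 3) + (τ + h ^ 2))) := by
  have hM0 : 0 ≤ M := by linarith
  have hk0 : 0 ≤ k := by linarith
  set x : Fin (J + 2) → ℝ × ℂ := fun j => (G (n + 2) j - Φ (n + 2) j,
    (2⁻¹ : ℂ) • ((U (n + 2 + 1) - V (n + 2 + 1)) + (U (n + 2) - V (n + 2))) j) with hx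
  set y : Fin (J + 2) → ℝ × ℂ := fun j => (G n j - Φ n j,
    (2⁻¹ : ℂ) • ((U (n + 1) - V (n + 1)) + (U n - V n)) j) with hy
  set a : Fin (J + 2) → ℝ × ℂ :=
    fun j => (G (n + 2) j, ((2⁻¹ : ℂ) • (U (n + 2 + 1) + U (n + 2))) j) with ha
  set b : Fin (J + 2) → ℝ × ℂ := fun j => (G n j, ((2⁻¹ : ℂ) • (U (n + 1) + U n)) j) with hb
  have hab : ∀ j, a j - b j = ((G (n + 2) - G n) j, (2⁻¹ : ℂ) *
      (((U (n + 3) - U (n + 2)) j + (U (n + 2) - U (n + 1)) j) +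
        ((U (n + 2) - U (n + 1)) j + (U (n + 1) - U n) j))) := fun j => by
    simp only [ha, hb, Prod.mk_sub_mk, Pi.sub_apply, Pi.smul_apply, Pi.add_apply, smul_eq_mul]
    congr 1
    ring
  have hab1 : ∀ j, ‖(a - b) j‖ ≤ 2 * M * τ := fun j => by
    rw [Pi.sub_apply, hab]
    have d1 := H.diff_U (n + 2) hn j
    have d2 := H.diff_U (n + 1) (by omega) j
    have d3 := H.diff_U n (by omega) j
    refine max_le (H.diff_G n hn j) (norm_half_mul_add_le ?_ ?_)
    · exact (norm_add_le _ _).trans ((add_le_add d1 d2).trans (le_of_eq (by ring)))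
    · exact (norm_add_le _ _).trans ((add_le_add d2 d3).trans (le_of_eq (by ring)))
  have hab2 : ∀ j, ‖incr (a - b) j‖ ≤ 2 * M * τ * h := fun j => by
    have e : incr (a - b) j = (incr (G (n + 2) - G n) j, (2⁻¹ : ℂ) *
      ((incr (U (n + 3) - U (n + 2)) j + incr (U (n + 2) - U (n + 1)) j) +
        (incr (U (n + 2) - U (n + 1)) j + incr (U (n + 1) - U n) j))) := by
      simp only [incr]
      rw [Pi.sub_apply, Pi.sub_apply, hab, hab, Prod.mk_sub_mk]
      congr 1
      ring
    rw [e]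
    have d1 := H.incr_diff_U (n + 2) hn j
    have d2 := H.incr_diff_U (n + 1) (by omega) j
    have d3 := H.incr_diff_U n (by omega) j
    refine max_le (H.incr_diff_G n hn j) (norm_half_mul_add_le ?_ ?_)
    · exact (norm_add_le _ _).trans ((add_le_add d1 d2).trans (le_of_eq (by ring)))
    · exact (norm_add_le _ _).trans ((add_le_add d2 d3).trans (le_of_eq (by ring)))
  have sx : sem h x ≤ sem h (G (n + 2) - Φ (n + 2)) +
      2⁻¹ * (sem h (U (n + 3) - V (n + 3)) + sem h (U (n + 2) - V (n + 2))) :=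
    sem_nonlinErr_le hh (n + 2)
  have sy : sem h y ≤ sem h (G n - Φ n) +
      2⁻¹ * (sem h (U (n + 1) - V (n + 1)) + sem h (U n - V n)) := sem_nonlinErr_le hh n
  have hmain := hF.sem_secondDiff_le (k := k) hτ (a := a) (b := b) (x := x) (y := y)
    (H.nonlinErr_zero hn) (H.nonlinErr_zero (by omega))
    (H.incr_nonlinArg_le hM0 hh (by omega)) hab1 hab2
    (hβ.imp (fun hb => ⟨hb.1, hb.2.1, sy.trans hb.2.2.2⟩) id)
  have hlhs : nonlinDiff δ U V G Φ (n + 2) - nonlinDiff δ U V G Φ n = fun j =>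
      nonlin δ (a j) - nonlin δ (a j - x j) - (nonlin δ (b j) - nonlin δ (b j - y j)) := by
    rw [nonlinDiff_eq (n + 2), nonlinDiff_eq n]
    rfl
  rw [hlhs]
  refine hmain.trans ?_
  set e : ℕ → CGrid J := fun i => U i - V i with he
  have sxy : sem h (x - y) ≤ sem h ((G (n + 2) - Φ (n + 2)) - (G n - Φ n)) +
      2⁻¹ * ((sem h (e (n + 3) - e (n + 2)) + sem h (e (n + 2) - e (n + 1))) +
        (sem h (e (n + 2) - e (n + 1)) + sem h (e (n + 1) - e n))) := by
    have e1 : x - y = fun j => (((G (n + 2) - Φ (n + 2)) - (G n - Φ n)) j,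
        ((2⁻¹ : ℂ) • (((e (n + 3) - e (n + 2)) + (e (n + 2) - e (n + 1))) +
          ((e (n + 2) - e (n + 1)) + (e (n + 1) - e n)))) j) := by
      funext j
      simp only [hx, hy, he, Pi.sub_apply, Pi.smul_apply, Pi.add_apply, smul_eq_mul,
        Prod.mk_sub_mk]
      congr 1
      ring
    rw [e1]
    refine (sem_prodMk_le hh _ _).trans (add_le_add le_rfl ((sem_half_smul_add_le _ _).trans ?_))
    exact mul_le_mul_of_nonneg_left (add_le_add (sem_add_le _ _ _) (sem_add_le _ _ _))
      (by norm_num)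
  have hη := H.sem_relax_step_le hM hh hτ hk0 hF' hn hβ
  have i1 : sem h (e (n + 3) - e (n + 2)) ≤
      M * (τ * (τ + h ^ 2)) + sem h (θ (n + 3) - θ (n + 2)) := H.sem_diff_err_le hM0 hτ hn
  have i2 : sem h (e (n + 2) - e (n + 1)) ≤
      M * (τ * (τ + h ^ 2)) + sem h (θ (n + 2) - θ (n + 1)) :=
    H.sem_diff_err_le hM0 hτ (n := n + 1) (by omega)
  have i3 : sem h (e (n + 1) - e n) ≤
      M * (τ * (τ + h ^ 2)) + sem h (θ (n + 1) - θ n) :=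
    H.sem_diff_err_le hM0 hτ (n := n) (by omega)
  have j0 := H.sem_err_le hM0 hτ (n := n) (by omega)
  have j1 := H.sem_err_le hM0 hτ (n := n + 1) (by omega)
  have j2 := H.sem_err_le hM0 hτ (n := n + 2) (by omega)
  have j3 := H.sem_err_le hM0 hτ (n := n + 3) (by omega)
  have m0 := incrSum_mono h θ (show n ≤ n + 3 by omega)
  have m1 := incrSum_mono h θ (show n + 1 ≤ n + 3 by omega)
  have m2 := incrSum_mono h θ (show n + 2 ≤ n + 3 by omega)
  set S := incrSum h θ (n + 3) with hS
  set P₂ := sem h (G (n + 2) - Φ (n + 2)) with hP₂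
  set P₀ := sem h (G n - Φ n) with hP₀
  set A₃ := sem h (θ (n + 3) - θ (n + 2)) with hA₃
  set A₂ := sem h (θ (n + 2) - θ (n + 1)) with hA₂
  set A₁ := sem h (θ (n + 1) - θ n) with hA₁
  have hS0 : 0 ≤ S := Finset.sum_nonneg fun _ _ => sem_nonneg _ _
  have hP20 : 0 ≤ P₂ := sem_nonneg _ _
  have hP00 : 0 ≤ P₀ := sem_nonneg _ _
  have hA30 : 0 ≤ A₃ := sem_nonneg _ _
  have hA20 : 0 ≤ A₂ := sem_nonneg _ _
  have hA10 : 0 ≤ A₁ := sem_nonneg _ _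
  set Eh := τ + h ^ 2 with hEh
  have hEτ : τ ≤ Eh := by rw [hEh]; nlinarith
  have k1 : τ * sem h x ≤ τ * (P₂ + M * Eh + S) := mul_le_mul_of_nonneg_left (by linarith) hτ
  have k2 : τ * sem h y ≤ τ * (P₀ + M * Eh + S) := mul_le_mul_of_nonneg_left (by linarith) hτ
  have hτ2 : M * τ ^ 2 ≤ M * (τ * Eh) := by
    rw [sq]
    exact mul_le_mul_of_nonneg_left (mul_le_mul_of_nonneg_left hEτ hτ) hM0
  have k4 : k * (A₂ + 2 * (τ * incrSum h θ (n + 2)) + 3 * (M * (τ * Eh))) ≤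
      k * (A₂ + 2 * (τ * S) + 3 * (M * (τ * Eh))) := by
    refine mul_le_mul_of_nonneg_left ?_ hk0
    have := mul_le_mul_of_nonneg_left m2 hτ
    linarith
  have hτS : 0 ≤ τ * S := by positivity
  have hτE : 0 ≤ τ * Eh := by positivity
  have hτP2 : 0 ≤ τ * P₂ := by positivity
  have hτP0 : 0 ≤ τ * P₀ := by positivity
  have hsum : τ * sem h x + τ * sem h y + sem h (x - y) ≤
      τ * P₂ + τ * P₀ + 2 * (τ * S) + 6 * (M * (τ * Eh)) + (A₃ + A₂ + A₁) +
        2 * (k * (A₂ + 2 * (τ * S) + 3 * (M * (τ * Eh)))) := by linarith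
  have hfin : τ * P₂ + τ * P₀ + 2 * (τ * S) + 6 * (M * (τ * Eh)) + (A₃ + A₂ + A₁) +
        2 * (k * (A₂ + 2 * (τ * S) + 3 * (M * (τ * Eh)))) ≤
      12 * k * M * (A₃ + A₂ + A₁ + τ * (P₂ + P₀ + S + Eh)) := by
    have := add_weighted_le hk hM hA30 hA20 hA10 hτP2 hτP0 hτS hτE
    exact this.trans (le_of_eq (by ring))
  refine (mul_le_mul_of_nonneg_left (hsum.trans hfin) hk0).trans (le_of_eq (by ring))

/-- The forcing of the increment equation is twice the correction. Subtracting the correction from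
the new increment and adding it to the old one absorbs this forcing and leaves their sum, hence the
argument of the Laplacian, unchanged. -/
theorem diff_step (H : ErrorEquations N δ g h τ M U V ε θ R G Φ) {n : ℕ} (hn : n + 1 < N) :
    (θ (n + 2) - θ (n + 1) - correction δ τ U V G Φ (n + 1)) -
        (θ (n + 1) - θ n + correction δ τ U V G Φ (n + 1)) =
      (Complex.I * (τ : ℂ)) • discLaplacian h ((2⁻¹ : ℂ) •
        ((θ (n + 2) - θ (n + 1) - correction δ τ U V G Φ (n + 1)) +
          (θ (n + 1) - θ n + correction δ τ U V G Φ (n + 1)))) + (R (n + 1) - R n) := by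
  have e1 := H.step n (by omega)
  have e2 := H.step (n + 1) hn
  have e3 : (2⁻¹ : ℂ) • ((θ (n + 2) - θ (n + 1) - correction δ τ U V G Φ (n + 1)) +
      (θ (n + 1) - θ n + correction δ τ U V G Φ (n + 1))) =
      (2⁻¹ : ℂ) • (θ (n + 1 + 1) + θ (n + 1)) - (2⁻¹ : ℂ) • (θ (n + 1) + θ n) := by module
  rw [e3, discLaplacian_sub]
  have e4 : correction δ τ U V G Φ (n + 1) =
      (Complex.I * (τ : ℂ) / 2) • (nonlinDiff δ U V G Φ (n + 1) - nonlinDiff δ U V G Φ n) := rfl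
  have e5 : (θ (n + 2) - θ (n + 1) - correction δ τ U V G Φ (n + 1)) -
        (θ (n + 1) - θ n + correction δ τ U V G Φ (n + 1)) =
      (θ (n + 1 + 1) - θ (n + 1)) - (θ (n + 1) - θ n) -
        (2 : ℂ) • correction δ τ U V G Φ (n + 1) := by module
  rw [e5, e1, e2, e4]
  module

theorem sem_correction_le (H : ErrorEquations N δ g h τ M U V ε θ R G Φ) (hM : 1 ≤ M)
    (hh : 0 < h) (hτ : 0 ≤ τ) (hK : 0 ≤ K)
    (hF : SecondDiffBound (nonlin δ) J h (2 * M) K) {n : ℕ} (hn : n + 1 < N) :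
    sem h (correction δ τ U V G Φ (n + 1)) ≤
      τ / 2 * (K * (sem h (G (n + 1) - Φ (n + 1)) + sem h (G n - Φ n) +
        2 * (M * (τ + h ^ 2)) + 2 * incrSum h θ (n + 2))) := by
  unfold correction
  rw [sem_smul, norm_I_mul_div_two hτ, Nat.add_sub_cancel]
  refine mul_le_mul_of_nonneg_left ((sem_sub_le _ _ _).trans ?_) (by linarith)
  have h1 := H.sem_nonlinDiff_le hM hh hτ hK hF hn
  have h2 := H.sem_nonlinDiff_le hM hh hτ hK hF (n := n) (by omega)
  have h3 := mul_le_mul_of_nonneg_left (incrSum_mono h θ (Nat.le_succ (n + 1))) hK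
  rw [Nat.succ_eq_add_one] at h3
  linarith

/-- The recursive inequalities for the error. -/
theorem errorRecursion (H : ErrorEquations N δ g h τ M U V ε θ R G Φ) (hM : 1 ≤ M) (hh : 0 < h)
    (hτ : 0 < τ) (hτ1 : τ ≤ 1) (hN : 1 ≤ N) (hK : 0 < K) (hKk : K ≤ k) (hk : 1 ≤ k)
    (hF : SecondDiffBound (nonlin δ) J h (2 * M) K)
    (hF' : SecondDiffBound (density δ g) J h (2 * M) K) :
    ErrorRecursion N (13 * k ^ 2 * M) τ (τ + h ^ 2)
      (fun n => SmallOrCoarse h K k U V G Φ (n - 2))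
      (fun n => sem h (θ n - θ (n - 1)))
      (fun n => sem h (θ n - θ (n - 1) - correction δ τ U V G Φ (n - 1)))
      (incrSum h θ) (fun n => sem h (G n - Φ n)) := by
  have hM0 : 0 ≤ M := by linarith
  have hk0 : 0 ≤ k := by linarith
  set Eh := τ + h ^ 2 with hEh
  have hh2 : 0 < h ^ 2 := by positivity
  have hE0 : 0 < Eh := by positivity
  have hEτ : τ ≤ Eh := by linarith
  have hFk := hF.mono hKk hh
  have hF'k := hF'.mono hKk hh
  have hMk : 1 ≤ k * M := by nlinarith
  have hkk : k ≤ k ^ 2 := by nlinarith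
  have hC1 : 13 * (k * M) ≤ 13 * k ^ 2 * M := by nlinarith
  have hC2 : 13 * k ≤ 13 * k ^ 2 * M := by nlinarith
  have hC3 : 13 * M ≤ 13 * k ^ 2 * M := by nlinarith
  have hC0 : 0 ≤ 13 * k ^ 2 * M := by positivity
  set C := 13 * k ^ 2 * M with hC
  have hτE : τ ^ 2 ≤ τ * Eh := by rw [sq]; exact mul_le_mul_of_nonneg_left hEτ hτ.le
  have hττ : τ * Eh ≤ Eh := mul_le_of_le_one_left hE0.le hτ1
  have hS0 : ∀ n, 0 ≤ incrSum h θ n := fun n => Finset.sum_nonneg fun _ _ => sem_nonneg _ _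
  have hQ : ∀ n, n + 1 < N → sem h (correction δ τ U V G Φ (n + 1)) ≤
      C / 13 * τ * (sem h (G (n + 1) - Φ (n + 1)) + sem h (G n - Φ n) + incrSum h θ (n + 2) +
        Eh) := by
    intro n hn
    refine (H.sem_correction_le hM hh hτ.le hk0 hFk hn).trans ?_
    have p1 := sem_nonneg h (G (n + 1) - Φ (n + 1))
    have p0 := sem_nonneg h (G n - Φ n)
    have s2 := hS0 (n + 2)
    have : k * (sem h (G (n + 1) - Φ (n + 1)) + sem h (G n - Φ n) + 2 * (M * Eh) +
        2 * incrSum h θ (n + 2)) ≤ 2 * (C / 13 * (sem h (G (n + 1) - Φ (n + 1)) +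
          sem h (G n - Φ n) + incrSum h θ (n + 2) + Eh)) := by
      have t1 := mul_le_mul_of_nonneg_right hC2 p1
      have t2 := mul_le_mul_of_nonneg_right hC2 p0
      have t3 := mul_le_mul_of_nonneg_right hC2 s2
      have t4 := mul_le_mul_of_nonneg_right hC1 hE0.le
      have t5 := mul_nonneg hC0 p1
      have t6 := mul_nonneg hC0 p0
      linarith
    have := mul_le_mul_of_nonneg_left this (by linarith : 0 ≤ τ / 2)
    linarith
  have hdR : ∀ n, n + 1 < N → sem h (R (n + 1) - R n) ≤ C / 13 * τ * (τ * Eh) := by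
    intro n hn
    refine (H.sem_diff_R n hn).trans ?_
    have : 0 ≤ τ * (τ * Eh) := by positivity
    nlinarith
  refine ⟨fun n => sem_nonneg _ _, ?_, fun n => ?_, ?_, fun h2 => ?_, fun n hn hnN hβ => ?_,
    fun n hn hnN => ?_, fun n hn hnN hβ => ?_, ?_, fun h2 => ?_⟩
  · simp [incrSum]
  · rw [incrSum, Finset.sum_range_succ, ← incrSum, Nat.add_sub_cancel]
  · refine H.sem_relax_zero.trans ?_
    nlinarith
  -- For the second relaxation value the one-step relation is good enough: the loss occurs once and
  -- does not accumulate.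
  · obtain ⟨ρ, hρ, e1⟩ := H.relax 0 h2
    have e2 : G 1 - Φ 1 = (2 : ℝ) • (fun j => density δ g (U 1 j) - density δ g (V 1 j)) + ρ -
        (G 0 - Φ 0) := by
      rw [← e1]; simp
    rw [e2]
    refine (sem_sub_le _ _ _).trans ?_
    rw [add_comm]
    refine add_le_add le_rfl ((sem_add_le _ _ _).trans ?_)
    rw [sem_smul, Real.norm_of_nonneg (by norm_num)]
    have h3 : sem h (fun j => density δ g (U 1 j) - density δ g (V 1 j)) ≤
        k * sem h (U 1 - V 1) := by
      have := hF'k.sem_diff_le (a := U 1) (x := U 1 - V 1) (H.err_zero 1 hN)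
        (fun j => (H.incr_U 1 hN j).trans (by nlinarith))
      simpa using this
    have h4 := mul_le_mul_of_nonneg_left (H.sem_err_le hM0 hτ.le hN) hk0
    have s1 := hS0 1
    have t1 := mul_le_mul_of_nonneg_right hC2 s1
    have t2 := mul_le_mul_of_nonneg_right hC1 hE0.le
    have t3 := mul_le_mul_of_nonneg_right hC3 hE0.le
    have t4 : M * τ ^ 2 ≤ M * Eh := mul_le_mul_of_nonneg_left (hτE.trans hττ) hM0
    have t5 := mul_nonneg hC0 s1
    have t6 := mul_nonneg hC0 hE0.le
    linarith
  · obtain ⟨m, rfl⟩ : ∃ m, n = m + 2 := ⟨n - 2, by omega⟩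
    have h1 := H.sem_relax_step_le hM hh hτ.le hk0 hF' hnN hβ
    have e1 : G (m + 2) - Φ (m + 2) =
        (G m - Φ m) + ((G (m + 2) - Φ (m + 2)) - (G m - Φ m)) := by abel
    simp only [Nat.add_sub_cancel, show m + 2 - 1 = m + 1 by omega]
    rw [e1]
    refine (sem_add_le _ _ _).trans (add_le_add le_rfl (h1.trans ?_))
    have a0 := sem_nonneg h (θ (m + 2) - θ (m + 1))
    have s0 : 0 ≤ τ * incrSum h θ (m + 2) := mul_nonneg hτ.le (hS0 _)
    have e0 : 0 ≤ τ * Eh := by positivity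
    have t1 := mul_le_mul_of_nonneg_right hC2 a0
    have t2 := mul_le_mul_of_nonneg_right hC2 s0
    have t3 := mul_le_mul_of_nonneg_right hC1 e0
    have t4 := mul_le_mul_of_nonneg_right hC3 e0
    have t5 := mul_le_mul_of_nonneg_left hτE hM0
    have t6 := mul_nonneg hC0 a0
    have t7 := mul_nonneg hC0 s0
    have t8 := mul_nonneg hC0 e0
    linarith
  · obtain ⟨m, rfl⟩ : ∃ m, n = m + 2 := ⟨n - 2, by omega⟩
    simp only [Nat.add_sub_cancel, show m + 2 - 1 = m + 1 by omega]
    have e1 : θ (m + 2) - θ (m + 1) =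
        (θ (m + 2) - θ (m + 1) - correction δ τ U V G Φ (m + 1)) +
          correction δ τ U V G Φ (m + 1) := by abel
    have h1 := sem_add_le h (θ (m + 2) - θ (m + 1) - correction δ τ U V G Φ (m + 1))
      (correction δ τ U V G Φ (m + 1))
    rw [← e1] at h1
    have h2 := hQ m (by omega)
    have : 0 ≤ C * τ * (sem h (G (m + 1) - Φ (m + 1)) + sem h (G m - Φ m) +
        incrSum h θ (m + 2) + Eh) := by
      have := sem_nonneg h (G (m + 1) - Φ (m + 1))
      have := sem_nonneg h (G m - Φ m)
      have := hS0 (m + 2)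
      positivity
    linarith
  · obtain ⟨m, rfl⟩ : ∃ m, n = m + 2 := ⟨n - 2, by omega⟩
    simp only [Nat.add_sub_cancel, show m + 2 - 1 = m + 1 by omega,
      show m + 2 + 1 - 1 = m + 2 by omega]
    have h1 := sem_le_of_crankNicolson hh (H.diff_step (n := m + 1) (by omega))
    simp only [show m + 1 + 2 = m + 3 by omega, show m + 1 + 1 = m + 2 by omega] at h1
    -- Two consecutive corrections telescope to a difference of the nonlinear error over two steps,
    -- so only that difference separates the starting value of the Crank–Nicolson step from the
    -- previous corrected increment.
    have e1 : θ (m + 2) - θ (m + 1) + correction δ τ U V G Φ (m + 2) =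
        (θ (m + 2) - θ (m + 1) - correction δ τ U V G Φ (m + 1)) +
          (Complex.I * (τ : ℂ) / 2) •
            (nonlinDiff δ U V G Φ (m + 2) - nonlinDiff δ U V G Φ m) := by
      simp only [correction, show m + 2 - 1 = m + 1 by omega, Nat.add_sub_cancel]
      module
    rw [e1] at h1
    have h2 := sem_add_le h (θ (m + 2) - θ (m + 1) - correction δ τ U V G Φ (m + 1))
      ((Complex.I * (τ : ℂ) / 2) • (nonlinDiff δ U V G Φ (m + 2) - nonlinDiff δ U V G Φ m))
    rw [sem_smul, norm_I_mul_div_two hτ.le] at h2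
    have h3 := H.sem_nonlinDiff_sub_le hM hh hτ.le hk hF hF' hnN hβ
    have h4 := hdR (m + 1) (by omega)
    simp only [show m + 1 + 1 = m + 2 by omega] at h4
    have a3 := sem_nonneg h (θ (m + 3) - θ (m + 2))
    have a2 := sem_nonneg h (θ (m + 2) - θ (m + 1))
    have a1 := sem_nonneg h (θ (m + 1) - θ m)
    have p2 := sem_nonneg h (G (m + 2) - Φ (m + 2))
    have p0 := sem_nonneg h (G m - Φ m)
    have s3 := hS0 (m + 3)
    set S' := sem h (θ (m + 3) - θ (m + 2)) + sem h (θ (m + 2) - θ (m + 1)) +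
        sem h (θ (m + 1) - θ m) + τ * (sem h (G (m + 2) - Φ (m + 2)) + sem h (G m - Φ m) +
          incrSum h θ (m + 3) + Eh) with hW
    have hWE : τ * Eh ≤ S' := by
      have : 0 ≤ τ * (sem h (G (m + 2) - Φ (m + 2)) + sem h (G m - Φ m) + incrSum h θ (m + 3)) := by
        positivity
      rw [hW]
      linarith
    have hW0 : 0 ≤ S' := (by positivity : 0 ≤ τ * Eh).trans hWE
    have h5 := mul_le_mul_of_nonneg_left h3 (by linarith : 0 ≤ τ / 2)
    have h6 := mul_le_mul_of_nonneg_left hWE (by positivity : 0 ≤ C / 13 * τ)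
    have h7 : 0 ≤ C * τ * S' := by positivity
    have h8 : τ / 2 * (12 * k ^ 2 * M * S') = 6 / 13 * (C * τ * S') := by rw [hC]; ring
    simp only [show m + 2 + 1 = m + 3 by omega]
    linarith
  · have e1 : θ 1 - θ 0 = (Complex.I * (τ : ℂ)) • discLaplacian h ((2⁻¹ : ℂ) • (θ 1 + θ 0)) +
        ((Complex.I * (τ : ℂ)) • nonlinDiff δ U V G Φ 0 + R 0) := by
      rw [← add_assoc]; exact H.step 0 hN
    have h1 := sem_le_of_crankNicolson hh e1
    have h0 : sem h (θ 1 - θ 0) = sem h (θ 1) := by rw [H.θ_zero, sub_zero]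
    rw [H.θ_zero, sem_zero, zero_add] at h1
    have h2 := sem_add_le h ((Complex.I * (τ : ℂ)) • nonlinDiff δ U V G Φ 0) (R 0)
    rw [sem_smul, norm_I_mul hτ.le] at h2
    have h3 := mul_le_mul_of_nonneg_left (H.sem_nonlinDiff_le hM hh hτ.le hk0 hFk hN) hτ.le
    have h4 := H.sem_R
    rw [h0]
    have p0 : 0 ≤ τ * sem h (G 0 - Φ 0) := mul_nonneg hτ.le (sem_nonneg h (G 0 - Φ 0))
    have s1 : 0 ≤ τ * incrSum h θ 1 := mul_nonneg hτ.le (hS0 1)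
    have e0 : 0 ≤ τ * Eh := by positivity
    have t1 := mul_le_mul_of_nonneg_right hC2 p0
    have t2 := mul_le_mul_of_nonneg_right hC2 s1
    have t3 := mul_le_mul_of_nonneg_right hC1 e0
    have t4 := mul_le_mul_of_nonneg_right hC3 e0
    have t6 := mul_nonneg hC0 p0
    have t7 := mul_nonneg hC0 s1
    have t8 := mul_nonneg hC0 e0
    simp only [zero_add] at h3
    linarith
  -- There is no earlier correction to telescope with; the correction is estimated by its size,
  -- which is harmless for a single step.
  · have h1 := sem_le_of_crankNicolson hh (H.diff_step (n := 0) h2)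
    have h3 := sem_add_le h (θ (0 + 1) - θ 0) (correction δ τ U V G Φ (0 + 1))
    have h4 := hQ 0 h2
    have h5 := hdR 0 h2
    simp only [zero_add] at h1 h3 h4 h5
    have p1 : 0 ≤ τ * sem h (G 1 - Φ 1) := mul_nonneg hτ.le (sem_nonneg _ _)
    have p0 : 0 ≤ τ * sem h (G 0 - Φ 0) := mul_nonneg hτ.le (sem_nonneg h (G 0 - Φ 0))
    have s1 : 0 ≤ τ * incrSum h θ 2 := mul_nonneg hτ.le (hS0 2)
    have e0 : 0 ≤ τ * Eh := by positivity
    have t5 := mul_nonneg hC0 p1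
    have t6 := mul_nonneg hC0 p0
    have t7 := mul_nonneg hC0 s1
    have t8 := mul_nonneg hC0 e0
    have t9 := mul_le_mul_of_nonneg_left hττ (by positivity : 0 ≤ C / 13 * τ)
    change sem h (θ 2 - θ 1 - correction δ τ U V G Φ 1) ≤ sem h (θ 1 - θ 0) +
      C * τ * (sem h (G 1 - Φ 1) + sem h (G 0 - Φ 0) + incrSum h θ 2 + Eh)
    linarith

end ErrorEquations

end

end RelaxNLS

namespace RelaxNLS

noncomputable section

/-! Consistency of the scheme -/

section Nodes

variable {xa xb : ℝ} {J : ℕ}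

theorem mul_meshWidth (xa xb : ℝ) (J : ℕ) : ((J : ℝ) + 1) * meshWidth xa xb J = xb - xa := by
  unfold meshWidth
  have : (J : ℝ) + 1 ≠ 0 := by positivity
  field_simp

theorem node_mem (hab : xa < xb) {j : ℕ} (hj : j ≤ J + 1) :
    node xa xb J j ∈ Set.Icc xa xb := by
  have hh := meshWidth_pos hab J
  have e := mul_meshWidth xa xb J
  have hj' : (j : ℝ) ≤ (J : ℝ) + 1 := by exact_mod_cast hj
  unfold node
  constructor
  · have : 0 ≤ (j : ℝ) * meshWidth xa xb J := by positivity
    linarith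
  · have := mul_le_mul_of_nonneg_right hj' hh.le
    linarith

theorem node_zero (xa xb : ℝ) (J : ℕ) : node xa xb J 0 = xa := by simp [node]

theorem node_last (xa xb : ℝ) (J : ℕ) : node xa xb J (J + 1) = xb := by
  have e := mul_meshWidth xa xb J
  unfold node
  push_cast
  linarith

theorem node_succ (xa xb : ℝ) (J j : ℕ) :
    node xa xb J (j + 1) = node xa xb J j + meshWidth xa xb J := by
  unfold node
  push_cast
  ring

variable {E : Type*} [NormedAddCommGroup E] {c : ℝ} {Z : ℝ → E}

theorem BddLip.norm_sample_le (hZ : BddLip xa xb c Z) (hab : xa < xb) (j : Fin (J + 2)) :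
    ‖Z (node xa xb J j)‖ ≤ c := hZ.bdd _ (node_mem hab (by omega))

theorem BddLip.norm_incr_sample_le (hZ : BddLip xa xb c Z) (hab : xa < xb) (j : Fin (J + 1)) :
    ‖incr (fun j : Fin (J + 2) => Z (node xa xb J j)) j‖ ≤ c * meshWidth xa xb J := by
  have h1 := hZ.lip _ (node_mem (J := J) hab (j := (j : ℕ) + 1) (by omega)) _
    (node_mem (J := J) hab (j := (j : ℕ)) (by omega))
  rw [node_succ, add_sub_cancel_left, abs_of_pos (meshWidth_pos hab J), ← node_succ] at h1
  simpa [incr] using h1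

theorem BddLip.sem_sample_le (hZ : BddLip xa xb c Z) (hab : xa < xb) :
    sem (meshWidth xa xb J) (fun j : Fin (J + 2) => Z (node xa xb J j)) ≤ c * √(xb - xa) := by
  have hc : 0 ≤ c := (norm_nonneg _).trans (hZ.bdd xa ⟨le_rfl, hab.le⟩)
  have := sem_le_of_incr_le_const (meshWidth_pos hab J) hc (hZ.norm_incr_sample_le hab (J := J))
  rwa [mul_meshWidth] at this

end Nodes

/-! ### Consistency error in time -/

section Residual

variable {T xa xb : ℝ}

/-- The consistency error in time of the Crank–Nicolson step with relaxed potential. -/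
def timeResidual (T xa xb : ℝ) (w : ℝ × ℝ → ℂ) (W : ℝ × ℝ → ℝ) (t k x : ℝ) : ℂ :=
  (w (t + k, x) - w (t, x) - (k / 2) • (partialWithin (rect T xa xb) (1, 0) w (t + k, x) +
    partialWithin (rect T xa xb) (1, 0) w (t, x))) +
  (Complex.I * (k : ℂ)) * ((W (t + k, x) * w (t + k, x) + W (t, x) * w (t, x)) / 2 -
    W (t + k / 2, x) * ((w (t + k, x) + w (t, x)) / 2))

/-- The trapezoidal defect is of order k³. The average of the products Ww minus the midpoint value
of W times the average of w equals a quarter of (central difference of W)(sum of w) plus a quarter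
of (increment of W)(increment of w). Each is of order k², and the prefactor ik supplies the third
power. -/
theorem exists_bddLip_timeResidual (hT : 0 < T) (hab : xa < xb) {w : ℝ × ℝ → ℂ} {W : ℝ × ℝ → ℝ}
    (hw : ContDiffOn ℝ (4 : ℕ) w (rect T xa xb)) (hW : ContDiffOn ℝ (3 : ℕ) W (rect T xa xb)) :
    ∃ c, 0 ≤ c ∧ ∀ t k, 0 ≤ k → t ∈ Set.Icc 0 T → t + k ∈ Set.Icc 0 T →
      BddLip xa xb (c * k ^ 3) (timeResidual T xa xb w W t k) := by
  obtain ⟨m₁, hm₁, b1⟩ := exists_bddLip hT hab (by norm_num) hw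
  obtain ⟨m₂, hm₂, b2⟩ := exists_bddLip_sub hT hab (by norm_num) hw
  obtain ⟨m₃, hm₃, b3⟩ := exists_bddLip_sub hT hab (by norm_num) hW
  obtain ⟨m₄, hm₄, b4⟩ := exists_bddLip_centralDiff hT hab le_rfl hW
  obtain ⟨m₅, hm₅, b5⟩ := exists_bddLip_trapezoid hT hab le_rfl hw
  refine ⟨m₅ + m₄ * m₁ + m₃ * m₂, by positivity, fun t k hk ht htk => ?_⟩
  have e1 : t + k / 2 + k / 2 = t + k := by ring
  have e2 : t + k / 2 - k / 2 = t := by ring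
  have c4 := b4 (t + k / 2) (k / 2) (by linarith) (by rwa [e2]) (by rwa [e1])
  rw [e1, e2] at c4
  have c3 := b3 (t + k) htk t ht
  have c2 := b2 (t + k) htk t ht
  rw [add_sub_cancel_left, abs_of_nonneg hk] at c2 c3
  have hsum := ((c4.ofReal.mul ((b1 (t + k) htk).add (b1 t ht))).const_mul (1 / 4)).add
    ((c3.ofReal.mul c2).const_mul (1 / 4))
  have hall := (b5 t k hk ht htk).add (hsum.const_mul (Complex.I * (k : ℂ)))
  have e : timeResidual T xa xb w W t k = fun x => (w (t + k, x) - w (t, x) -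
      (k / 2) • (partialWithin (rect T xa xb) (1, 0) w (t + k, x) +
        partialWithin (rect T xa xb) (1, 0) w (t, x))) + (Complex.I * (k : ℂ)) *
      ((1 / 4) * (((W (t + k, x) + W (t, x) - (W (t + k / 2, x) + W (t + k / 2, x)) : ℝ) : ℂ) *
        (w (t + k, x) + w (t, x))) + (1 / 4) * (((W (t + k, x) - W (t, x) : ℝ) : ℂ) *
          (w (t + k, x) - w (t, x)))) := by
    funext x
    unfold timeResidual
    push_cast
    ring
  rw [e]
  refine hall.mono ?_
  rw [ErrorEquations.norm_I_mul hk]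
  have : ‖(1 / 4 : ℂ)‖ = 1 / 4 := by simp
  rw [this]
  have q1 : 0 ≤ m₄ * m₁ * k ^ 3 := by positivity
  have q2 : 0 ≤ m₃ * m₂ * k ^ 3 := by positivity
  linarith

end Residual

/-! ### The exact solution and the error of its elliptic projection -/

section Solution

variable {T xa xb : ℝ} {g : ℝ → ℝ} {f : ℝ → ℝ → ℂ} {u₀ : ℝ → ℂ} {u : ℝ → ℝ → ℂ}

theorem contDiffOn_potential (hg : ContDiffOn ℝ 5 g (Set.Ici 0))
    (hu : ContDiffOn ℝ 6 (fun p : ℝ × ℝ => u p.1 p.2) (rect T xa xb)) :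
    ContDiffOn ℝ 5 (fun p : ℝ × ℝ => g (‖u p.1 p.2‖ ^ 2)) (rect T xa xb) :=
  hg.comp ((hu.of_le (by norm_num)).norm_sq ℝ) fun _ _ => Set.mem_Ici.2 (sq_nonneg _)

theorem norm_le_uMax (hu : ContDiffOn ℝ 6 (fun p : ℝ × ℝ => u p.1 p.2) (rect T xa xb)) {t x : ℝ}
    (ht : t ∈ Set.Icc 0 T) (hx : x ∈ Set.Icc xa xb) : ‖u t x‖ ≤ uMax T xa xb u :=
  le_csSup (isCompact_rect.image_of_continuousOn hu.continuousOn.norm).bddAbove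
    ⟨(t, x), ⟨ht, hx⟩, rfl⟩

theorem abs_le_gMax (hg : ContDiffOn ℝ 5 g (Set.Ici 0))
    (hu : ContDiffOn ℝ 6 (fun p : ℝ × ℝ => u p.1 p.2) (rect T xa xb)) {t x : ℝ}
    (ht : t ∈ Set.Icc 0 T) (hx : x ∈ Set.Icc xa xb) : |g (‖u t x‖ ^ 2)| ≤ gMax T xa xb g u :=
  le_csSup (isCompact_rect.image_of_continuousOn
    (contDiffOn_potential hg hu).continuousOn.abs).bddAbove ⟨(t, x), ⟨ht, hx⟩, rfl⟩

theorem iteratedDerivWithin_two_eq (hab : xa < xb)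
    (hT : 0 < T) (hu : ContDiffOn ℝ (6 : ℕ) (fun p : ℝ × ℝ => u p.1 p.2) (rect T xa xb)) {t x : ℝ}
    (ht : t ∈ Set.Icc 0 T) (hx : x ∈ Set.Icc xa xb) :
    iteratedDerivWithin 2 (u t) (Set.Icc xa xb) x =
      partialWithin (rect T xa xb) (0, 1)
        (partialWithin (rect T xa xb) (0, 1) (fun p : ℝ × ℝ => u p.1 p.2)) (t, x) := by
  have hD := contDiffOn_partialWithin hT hab (n := 5) (by norm_num) (0, 1) hu
  have hU := uniqueDiffOn_Icc hab
  rw [iteratedDerivWithin_succ]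
  have h1 : Set.EqOn (iteratedDerivWithin 1 (u t) (Set.Icc xa xb))
      (fun y => partialWithin (rect T xa xb) (0, 1) (fun p : ℝ × ℝ => u p.1 p.2) (t, y))
      (Set.Icc xa xb) := fun y hy => by
    rw [iteratedDerivWithin_one]
    exact (hasDerivWithinAt_space (by norm_num) hu ht hy).derivWithin (hU y hy)
  rw [derivWithin_congr h1 (h1 hx)]
  exact (hasDerivWithinAt_space (by norm_num) hD ht hx).derivWithin (hU x hx)

theorem derivWithin_time_eq (hT : 0 < T)
    (hu : ContDiffOn ℝ (6 : ℕ) (fun p : ℝ × ℝ => u p.1 p.2) (rect T xa xb)) {t x : ℝ}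
    (ht : t ∈ Set.Icc 0 T) (hx : x ∈ Set.Icc xa xb) :
    derivWithin (fun s => u s x) (Set.Icc 0 T) t =
      partialWithin (rect T xa xb) (1, 0) (fun p : ℝ × ℝ => u p.1 p.2) (t, x) :=
  (hasDerivWithinAt_time (by norm_num) hu ht hx).derivWithin (uniqueDiffOn_Icc hT t ht)

theorem partialWithin_time_boundary (hT : 0 < T)
    (hu : ContDiffOn ℝ (6 : ℕ) (fun p : ℝ × ℝ => u p.1 p.2) (rect T xa xb)) {t x : ℝ}
    (ht : t ∈ Set.Icc 0 T) (hx : x ∈ Set.Icc xa xb) (h0 : ∀ s ∈ Set.Icc 0 T, u s x = 0) :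
    partialWithin (rect T xa xb) (1, 0) (fun p : ℝ × ℝ => u p.1 p.2) (t, x) = 0 := by
  rw [← derivWithin_time_eq hT hu ht hx, derivWithin_congr h0 (h0 t ht)]
  exact congrFun (derivWithin_fun_const (Set.Icc 0 T) (0 : ℂ)) t

/-- The error of the elliptic projection at time `t`. -/
def projError (xa xb : ℝ) (J : ℕ) (u : ℝ → ℝ → ℂ) (t : ℝ) : CGrid J :=
  interp xa xb J (u t) - ellipticProj xa xb J (u t)

theorem interp_vanishes {J : ℕ} (hb : ∀ t ∈ Set.Icc 0 T, u t xa = 0 ∧ u t xb = 0) {t : ℝ}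
    (ht : t ∈ Set.Icc 0 T) : VanishesAtEnds (interp xa xb J (u t)) := by
  constructor
  · simp only [interp, Fin.val_zero, node_zero]
    exact (hb t ht).1
  · simp only [interp, Fin.val_last, node_last]
    exact (hb t ht).2

theorem VanishesAtEnds.sub {J : ℕ} {v w : CGrid J} (hv : VanishesAtEnds v) (hw : VanishesAtEnds w) :
    VanishesAtEnds (v - w) :=
  ⟨by rw [Pi.sub_apply, hv.1, hw.1, sub_zero], by rw [Pi.sub_apply, hv.2, hw.2, sub_zero]⟩

theorem VanishesAtEnds.add {J : ℕ} {v w : CGrid J} (hv : VanishesAtEnds v) (hw : VanishesAtEnds w) :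
    VanishesAtEnds (v + w) :=
  ⟨by rw [Pi.add_apply, hv.1, hw.1, add_zero], by rw [Pi.add_apply, hv.2, hw.2, add_zero]⟩

theorem discLaplacian_ellipticProj {J : ℕ} (hT : 0 < T) (hab : xa < xb)
    (hu : ContDiffOn ℝ (6 : ℕ) (fun p : ℝ × ℝ => u p.1 p.2) (rect T xa xb)) {t : ℝ}
    (ht : t ∈ Set.Icc 0 T) (i : Fin J) :
    discLaplacian (meshWidth xa xb J) (ellipticProj xa xb J (u t)) i.castSucc.succ =
      partialWithin (rect T xa xb) (0, 1)
        (partialWithin (rect T xa xb) (0, 1) (fun p : ℝ × ℝ => u p.1 p.2))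
          (t, node xa xb J (i + 1)) := by
  rw [(ellipticProj_spec hab J (u t)).2]
  unfold interp₀
  rw [if_pos (by simp)]
  exact iteratedDerivWithin_two_eq hab hT hu ht (node_mem hab (by simp))

/-- The projection reproduces u_xx at the interior nodes, so only the defect of the difference
quotient of u is left. It is linear in u, which carries bounds for its time differences over to the
projection error. -/
theorem discLaplacian_projError {J : ℕ} (hT : 0 < T) (hab : xa < xb)
    (hu : ContDiffOn ℝ (6 : ℕ) (fun p : ℝ × ℝ => u p.1 p.2) (rect T xa xb)) {t : ℝ}
    (ht : t ∈ Set.Icc 0 T) (i : Fin J) :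
    discLaplacian (meshWidth xa xb J) (projError xa xb J u t) i.castSucc.succ =
      laplaceDefect T xa xb (meshWidth xa xb J) (fun p : ℝ × ℝ => u p.1 p.2) t
        (node xa xb J (i + 1)) / (meshWidth xa xb J : ℂ) ^ 2 := by
  have hh : (meshWidth xa xb J : ℂ) ^ 2 ≠ 0 :=
    pow_ne_zero _ (Complex.ofReal_ne_zero.2 (meshWidth_pos hab J).ne')
  have e1 : discLaplacian (meshWidth xa xb J) (interp xa xb J (u t)) i.castSucc.succ =
      (u t (node xa xb J i) - 2 * u t (node xa xb J (i + 1)) + u t (node xa xb J (i + 1 + 1))) /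
        (meshWidth xa xb J : ℂ) ^ 2 := by
    unfold discLaplacian
    rw [dif_pos (by simp)]
    rfl
  have e2 : node xa xb J (i + 1) - meshWidth xa xb J = node xa xb J i := by
    rw [node_succ]; ring
  unfold projError
  rw [discLaplacian_sub, Pi.sub_apply, e1, discLaplacian_ellipticProj hT hab hu ht i,
    eq_div_iff hh, sub_mul, div_mul_cancel₀ _ hh, laplaceDefect, e2, ← node_succ, Complex.real_smul]
  push_cast
  ring

/-- The elliptic estimate turns a defect of order h⁴, divided by h², into a seminorm of order h².
The second difference in time is needed because the increment equation contains the difference of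
two consecutive residuals. -/
theorem exists_sem_projError_le (hT : 0 < T) (hab : xa < xb)
    (hu : ContDiffOn ℝ (6 : ℕ) (fun p : ℝ × ℝ => u p.1 p.2) (rect T xa xb))
    (hb : ∀ t ∈ Set.Icc 0 T, u t xa = 0 ∧ u t xb = 0) :
    ∃ c, 0 ≤ c ∧ ∀ J : ℕ,
      (∀ t ∈ Set.Icc 0 T, sem (meshWidth xa xb J) (projError xa xb J u t) ≤
        c * meshWidth xa xb J ^ 2) ∧
      (∀ t ∈ Set.Icc 0 T, ∀ s ∈ Set.Icc 0 T,
        sem (meshWidth xa xb J) (projError xa xb J u t - projError xa xb J u s) ≤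
          c * (|t - s| * meshWidth xa xb J ^ 2)) ∧
      (∀ t k, 0 ≤ k → t - k ∈ Set.Icc 0 T → t + k ∈ Set.Icc 0 T →
        sem (meshWidth xa xb J) (projError xa xb J u (t + k) + projError xa xb J u (t - k) -
          (projError xa xb J u t + projError xa xb J u t)) ≤
          c * (k ^ 2 * meshWidth xa xb J ^ 2)) := by
  obtain ⟨M, hM, hb'⟩ := exists_bound_laplaceDefect hT hab hu
  set L := xb - xa with hL
  have hL0 : 0 < L := sub_pos.2 hab
  refine ⟨L * √L * M, by positivity, fun J => ?_⟩
  set h := meshWidth xa xb J with hh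
  have hh0 : 0 < h := meshWidth_pos hab J
  have hmul : ((J : ℝ) + 1) * h = L := mul_meshWidth xa xb J
  have hv : ∀ t ∈ Set.Icc 0 T, VanishesAtEnds (projError xa xb J u t) := fun t ht =>
    (interp_vanishes hb ht).sub (ellipticProj_spec hab J (u t)).1
  have hnode : ∀ i : Fin J, node xa xb J (i + 1) - h ∈ Set.Icc xa xb ∧
      node xa xb J (i + 1) + h ∈ Set.Icc xa xb := fun i => by
    have e2 : node xa xb J (i + 1) - h = node xa xb J i := by
      rw [node_succ]; ring
    rw [e2, hh, ← node_succ]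
    exact ⟨node_mem hab (by omega), node_mem hab (by omega)⟩
  have key : ∀ (v : CGrid J) (d : Fin J → ℂ) (c : ℝ), 0 ≤ c → VanishesAtEnds v →
      (∀ i, discLaplacian h v i.castSucc.succ = d i / (h : ℂ) ^ 2) → (∀ i, ‖d i‖ ≤ M * c * h ^ 4) →
      sem h v ≤ L * √L * M * (c * h ^ 2) := by
    intro v d c hc hv hd hdc
    have h1 := sem_le_of_discLaplacian_le hh0 hv (c := M * c * h ^ 2) (fun i => by
      rw [hd i, norm_div, norm_pow, Complex.norm_real, Real.norm_of_nonneg hh0.le,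
        div_le_iff₀ (by positivity)]
      exact (hdc i).trans (le_of_eq (by ring))) (by positivity)
    rw [hmul] at h1
    exact h1.trans (le_of_eq (by ring))
  refine ⟨fun t ht => ?_, fun t ht s hs => ?_, fun t k hk ht₁ ht₂ => ?_⟩
  · have := key _ _ 1 zero_le_one (hv t ht) (fun i => discLaplacian_projError hT hab hu ht i)
      (fun i => by
        rw [mul_one]
        exact (hb' _ h hh0.le (hnode i).1 (hnode i).2).1 t ht)
    rwa [one_mul] at this
  · refine key _ (fun i => laplaceDefect T xa xb h (fun p : ℝ × ℝ => u p.1 p.2) t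
        (node xa xb J (i + 1)) - laplaceDefect T xa xb h (fun p : ℝ × ℝ => u p.1 p.2) s
        (node xa xb J (i + 1))) _ (abs_nonneg _) ((hv t ht).sub (hv s hs)) (fun i => ?_)
      (fun i => (hb' _ h hh0.le (hnode i).1 (hnode i).2).2.1 t ht s hs)
    rw [discLaplacian_sub, Pi.sub_apply, discLaplacian_projError hT hab hu ht i,
      discLaplacian_projError hT hab hu hs i, sub_div]
  · have ht : t ∈ Set.Icc 0 T := ⟨by linarith [ht₁.1], by linarith [ht₂.2]⟩
    refine key _ (fun i => laplaceDefect T xa xb h (fun p : ℝ × ℝ => u p.1 p.2) (t + k)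
        (node xa xb J (i + 1)) + laplaceDefect T xa xb h (fun p : ℝ × ℝ => u p.1 p.2) (t - k)
        (node xa xb J (i + 1)) - (laplaceDefect T xa xb h (fun p : ℝ × ℝ => u p.1 p.2) t
        (node xa xb J (i + 1)) + laplaceDefect T xa xb h (fun p : ℝ × ℝ => u p.1 p.2) t
        (node xa xb J (i + 1)))) _ (sq_nonneg k)
      (((hv _ ht₂).add (hv _ ht₁)).sub ((hv t ht).add (hv t ht))) (fun i => ?_)
      (fun i => (hb' _ h hh0.le (hnode i).1 (hnode i).2).2.2 t k hk ht₁ ht₂)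
    rw [discLaplacian_sub, discLaplacian_add, discLaplacian_add, Pi.sub_apply, Pi.add_apply,
      Pi.add_apply, discLaplacian_projError hT hab hu ht i, discLaplacian_projError hT hab hu ht₁ i,
      discLaplacian_projError hT hab hu ht₂ i, sub_div, add_div, add_div]

end Solution

end

end RelaxNLS

namespace RelaxNLS

noncomputable section

/-! The error equations of the scheme -/

section Scheme

variable {T xa xb : ℝ} {g : ℝ → ℝ} {f : ℝ → ℝ → ℂ} {u₀ : ℝ → ℂ} {u : ℝ → ℝ → ℂ} {δ : ℝ}
  {N J : ℕ} {V : ℕ → CGrid J} {Φ : ℕ → RGrid J}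

theorem nonlin_of_le {φ : ℝ} {z : ℂ} (hφ : |φ| ≤ δ) (hz : ‖z‖ ≤ δ) : nonlin δ (φ, z) = φ * z := by
  simp only [nonlin, mollifier_of_abs_le hφ, cMollifier_of_norm_le hz]

theorem nonlin_zero_right (hδ : 0 ≤ δ) (φ : ℝ) : nonlin δ (φ, 0) = 0 := by
  simp only [nonlin, cMollifier_of_norm_le (z := 0) (by simpa using hδ), mul_zero]

/-- The exact solution at the time nodes. -/
def exactGrid (T xa xb : ℝ) (N J : ℕ) (u : ℝ → ℝ → ℂ) (n : ℕ) : CGrid J :=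
  interp xa xb J (u ((n : ℝ) * timeStep T N))

/-- The exact potential at the intermediate time nodes. -/
def exactPotential (T xa xb : ℝ) (N J : ℕ) (g : ℝ → ℝ) (u : ℝ → ℝ → ℂ) (n : ℕ) : RGrid J :=
  fun j => g (‖interp xa xb J (u (((n : ℝ) + 1 / 2) * timeStep T N)) j‖ ^ 2)

/-- The residual of the error equation. -/
def residual (T xa xb : ℝ) (N J : ℕ) (g : ℝ → ℝ) (u : ℝ → ℝ → ℂ) (n : ℕ) : CGrid J :=
  -(projError xa xb J u ((n : ℝ) * timeStep T N + timeStep T N) -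
    projError xa xb J u ((n : ℝ) * timeStep T N)) +
  (fun j => timeResidual T xa xb (fun p : ℝ × ℝ => u p.1 p.2)
    (fun p : ℝ × ℝ => g (‖u p.1 p.2‖ ^ 2)) ((n : ℝ) * timeStep T N) (timeStep T N)
    (node xa xb J j) : CGrid J)

theorem timeStep_pos (hT : 0 < T) (hN : 1 ≤ N) : 0 < timeStep T N :=
  div_pos hT (by exact_mod_cast hN)

theorem natCast_mul_timeStep (hN : 1 ≤ N) : (N : ℝ) * timeStep T N = T := by
  unfold timeStep
  have : (N : ℝ) ≠ 0 := by exact_mod_cast (by omega : N ≠ 0)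
  field_simp

theorem time_mem (hT : 0 < T) (hN : 1 ≤ N) {s : ℝ} (hs : 0 ≤ s) (hsN : s ≤ N) :
    s * timeStep T N ∈ Set.Icc 0 T := by
  have hτ := timeStep_pos hT hN
  refine ⟨by positivity, ?_⟩
  calc s * timeStep T N ≤ N * timeStep T N := mul_le_mul_of_nonneg_right hsN hτ.le
    _ = T := natCast_mul_timeStep hN

theorem succ_time (T : ℝ) (N n : ℕ) :
    ((n + 1 : ℕ) : ℝ) * timeStep T N = (n : ℝ) * timeStep T N + timeStep T N := by
  push_cast; ring

theorem half_time (T : ℝ) (N n : ℕ) :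
    ((n : ℝ) + 1 / 2) * timeStep T N = (n : ℝ) * timeStep T N + timeStep T N / 2 := by
  ring

theorem forall_grid {p : Fin (J + 2) → Prop} (h0 : p 0) (h1 : p (Fin.last (J + 1)))
    (hi : ∀ i : Fin J, p i.castSucc.succ) (j : Fin (J + 2)) : p j := by
  induction j using Fin.cases with
  | zero => exact h0
  | succ k =>
    induction k using Fin.lastCases with
    | last => exact h1
    | cast i => exact hi i

theorem IsMRFD.V_step_apply (hV : IsMRFD T xa xb N J δ g f u₀ V Φ) {n : ℕ} (hn : n < N)
    (j : Fin (J + 2)) : V (n + 1) j - V n j =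
      Complex.I * (timeStep T N : ℂ) * (2⁻¹ * (discLaplacian (meshWidth xa xb J) (V (n + 1)) j +
        discLaplacian (meshWidth xa xb J) (V n) j)) +
      Complex.I * (timeStep T N : ℂ) * nonlin δ (Φ n j, (V (n + 1) j + V n j) / 2) +
      (timeStep T N : ℂ) * interp₀ xa xb J
        (fun x => (f (((n : ℝ) + 1) * timeStep T N) x + f ((n : ℝ) * timeStep T N) x) / 2) j := by
  have e : (fun k => (V (n + 1) k + V n k) / 2) = (2⁻¹ : ℂ) • (V (n + 1) + V n) := by
    funext k
    simp only [Pi.smul_apply, Pi.add_apply, smul_eq_mul]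
    ring
  rw [hV.V_step n hn j, e, discLaplacian_smul, discLaplacian_add]
  rfl

/-- The scheme is subtracted from the average of the differential equation at the two time levels.
The average of f is the one in the scheme and cancels, and Δ_h of the projection cancels u_xx; what
remains is minus the increment of the projection error plus the time residual. -/
theorem error_step (hT : 0 < T) (hab : xa < xb) (hN : 1 ≤ N)
    (hu : IsNLSSolution T xa xb g f u₀ u)
    (hu6 : ContDiffOn ℝ (6 : ℕ) (fun p : ℝ × ℝ => u p.1 p.2) (rect T xa xb)) (hδ : 0 < δ)
    (hδu : ∀ t ∈ Set.Icc 0 T, ∀ x ∈ Set.Icc xa xb, ‖u t x‖ ≤ δ)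
    (hδg : ∀ t ∈ Set.Icc 0 T, ∀ x ∈ Set.Icc xa xb, |g (‖u t x‖ ^ 2)| ≤ δ)
    (hV : IsMRFD T xa xb N J δ g f u₀ V Φ) {n : ℕ} (hn : n < N) {θ : ℕ → CGrid J}
    (hθ : ∀ n, θ n = ellipticProj xa xb J (u ((n : ℝ) * timeStep T N)) - V n) :
    θ (n + 1) - θ n = (Complex.I * (timeStep T N : ℂ)) •
        discLaplacian (meshWidth xa xb J) ((2⁻¹ : ℂ) • (θ (n + 1) + θ n)) +
      (Complex.I * (timeStep T N : ℂ)) • nonlinDiff δ (exactGrid T xa xb N J u) V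
        (exactPotential T xa xb N J g u) Φ n + residual T xa xb N J g u n := by
  have ht0 : (n : ℝ) * timeStep T N ∈ Set.Icc 0 T :=
    time_mem hT hN (by positivity) (by exact_mod_cast hn.le)
  have ht1 : (n : ℝ) * timeStep T N + timeStep T N ∈ Set.Icc 0 T := by
    rw [← succ_time]
    exact time_mem hT hN (by positivity) (by exact_mod_cast hn)
  have hth : (n : ℝ) * timeStep T N + timeStep T N / 2 ∈ Set.Icc 0 T := by
    have := timeStep_pos hT hN
    exact ⟨by linarith [ht0.1], by linarith [ht1.2]⟩
  have e1 : ((n : ℝ) + 1) * timeStep T N = (n : ℝ) * timeStep T N + timeStep T N := by ring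
  have hVs := hV.V_step_apply hn
  have hV0 := hV.vanishes n hn.le
  have hV1 := hV.vanishes (n + 1) hn
  rw [hθ, hθ, discLaplacian_smul, discLaplacian_add, discLaplacian_sub, discLaplacian_sub]
  simp only [succ_time]
  rw [e1] at hVs
  set τ := timeStep T N with hτ
  set t := (n : ℝ) * τ with ht
  set t' := t + τ with ht'
  have hsucc : ((n + 1 : ℕ) : ℝ) * τ = t' := succ_time T N n
  have hhalf : ((n : ℝ) + 1 / 2) * τ = t + τ / 2 := half_time T N n
  have hw0 := (ellipticProj_spec hab J (u t)).1
  have hw1 := (ellipticProj_spec hab J (u t')).1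
  have hend : ∀ j : Fin (J + 2), j = 0 ∨ j = Fin.last (J + 1) →
      ∀ s ∈ Set.Icc 0 T, u s (node xa xb J j) = 0 := by
    rintro j (rfl | rfl) s hs
    · simp only [Fin.val_zero, node_zero]
      exact (hu.boundary s hs).1
    · simp only [Fin.val_last, node_last]
      exact (hu.boundary s hs).2
  -- At the end nodes every term vanishes, including the time derivative of u; the differential
  -- equation is not used there, so f need not vanish at the ends.
  have hends : ∀ j : Fin (J + 2), j = 0 ∨ j = Fin.last (J + 1) →
      (ellipticProj xa xb J (u t') - V (n + 1) - (ellipticProj xa xb J (u t) - V n)) j =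
      ((Complex.I * (τ : ℂ)) • (2⁻¹ : ℂ) • (discLaplacian (meshWidth xa xb J)
        (ellipticProj xa xb J (u t')) - discLaplacian (meshWidth xa xb J) (V (n + 1)) +
        (discLaplacian (meshWidth xa xb J) (ellipticProj xa xb J (u t)) -
          discLaplacian (meshWidth xa xb J) (V n))) + (Complex.I * (τ : ℂ)) •
        nonlinDiff δ (exactGrid T xa xb N J u) V (exactPotential T xa xb N J g u) Φ n +
        residual T xa xb N J g u n) j := by
    intro j hj
    have hx : node xa xb J j ∈ Set.Icc xa xb := node_mem hab (by omega)
    have z := hend j hj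
    have zw : ellipticProj xa xb J (u t) j = 0 ∧ ellipticProj xa xb J (u t') j = 0 ∧
        V n j = 0 ∧ V (n + 1) j = 0 := by
      rcases hj with rfl | rfl
      · exact ⟨hw0.1, hw1.1, hV0.1, hV1.1⟩
      · exact ⟨hw0.2, hw1.2, hV0.2, hV1.2⟩
    have zΔ : ∀ v : CGrid J, discLaplacian (meshWidth xa xb J) v j = 0 := fun v => by
      rcases hj with rfl | rfl
      · exact discLaplacian_zero v
      · exact discLaplacian_last v
    have zt0 := partialWithin_time_boundary hT hu6 ht0 hx z
    have zt1 := partialWithin_time_boundary hT hu6 ht1 hx z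
    have u0 := z _ ht0
    have u1 := z _ ht1
    simp only [Pi.sub_apply, Pi.add_apply, Pi.smul_apply, Pi.neg_apply, zw.1, zw.2.1, zw.2.2.1,
      zw.2.2.2, zΔ, residual, projError, nonlinDiff, exactGrid, interp, timeResidual, ← hτ, ← ht, hsucc, ← ht', u0, u1, zt0, zt1, add_zero, zero_div, nonlin_zero_right hδ.le, sub_zero,
      smul_zero, mul_zero, neg_zero]
  funext j
  revert j
  refine forall_grid (hends 0 (Or.inl rfl)) (hends _ (Or.inr rfl)) fun i => ?_
  have hv : ((i.castSucc.succ : Fin (J + 2)) : ℕ) = i + 1 := by simp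
  have hx : node xa xb J (i + 1) ∈ Set.Icc xa xb := node_mem hab (by omega)
  have hs := hVs i.castSucc.succ
  have p0 := hu.pde t ht0 _ hx
  have p1 := hu.pde t' ht1 _ hx
  rw [derivWithin_time_eq hT hu6 ht0 hx, iteratedDerivWithin_two_eq hab hT hu6 ht0 hx] at p0
  rw [derivWithin_time_eq hT hu6 ht1 hx, iteratedDerivWithin_two_eq hab hT hu6 ht1 hx] at p1
  -- The average of two values of norm at most δ has norm at most δ, so the mollifiers are inactive
  -- on the exact solution.
  have hnl : nonlin δ (g (‖u (t + τ / 2) (node xa xb J (i + 1))‖ ^ 2),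
      (u t' (node xa xb J (i + 1)) + u t (node xa xb J (i + 1))) / 2) =
      (g (‖u (t + τ / 2) (node xa xb J (i + 1))‖ ^ 2) : ℂ) *
        ((u t' (node xa xb J (i + 1)) + u t (node xa xb J (i + 1))) / 2) := by
    refine nonlin_of_le (hδg _ hth _ hx) ?_
    rw [norm_div, Complex.norm_ofNat, div_le_iff₀ (by norm_num)]
    refine (norm_add_le _ _).trans ?_
    linarith [hδu _ ht0 _ hx, hδu _ ht1 _ hx]
  have hint : interp₀ xa xb J (fun x => (f t' x + f t x) / 2) i.castSucc.succ =
      (f t' (node xa xb J (i + 1)) + f t (node xa xb J (i + 1))) / 2 := by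
    unfold interp₀
    rw [if_pos (by simp)]
    simp only [hv]
  have L0 := discLaplacian_ellipticProj hT hab hu6 ht0 i
  have L1 := discLaplacian_ellipticProj hT hab hu6 ht1 i
  rw [hint] at hs
  simp only [Pi.sub_apply, Pi.add_apply, Pi.smul_apply, Pi.neg_apply, residual, projError,
    nonlinDiff, exactGrid, exactPotential, interp, timeResidual, ← hτ, ← ht,
    hsucc, hhalf, ← ht', hv, L0, L1, hnl, smul_eq_mul, Complex.real_smul]
  push_cast
  linear_combination (-1 : ℂ) * hs + ((τ : ℂ) / 2) * p0 + ((τ : ℂ) / 2) * p1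

end Scheme
end
end RelaxNLS

namespace RelaxNLS

noncomputable section

/-! ### Bounds for the data of the error equations -/

section Scheme

variable {T xa xb : ℝ} {g : ℝ → ℝ} {f : ℝ → ℝ → ℂ} {u₀ : ℝ → ℂ} {u : ℝ → ℝ → ℂ} {δ : ℝ}
  {N J : ℕ} {V : ℕ → CGrid J} {Φ : ℕ → RGrid J}

theorem exists_errorEquations (hT : 0 < T) (hab : xa < xb) (hg : ContDiffOn ℝ 5 g (Set.Ici 0))
    (hu : IsNLSSolution T xa xb g f u₀ u)
    (hu6 : ContDiffOn ℝ (6 : ℕ) (fun p : ℝ × ℝ => u p.1 p.2) (rect T xa xb)) (hδ : 0 < δ)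
    (hδu : ∀ t ∈ Set.Icc 0 T, ∀ x ∈ Set.Icc xa xb, ‖u t x‖ ≤ δ)
    (hδg : ∀ t ∈ Set.Icc 0 T, ∀ x ∈ Set.Icc xa xb, |g (‖u t x‖ ^ 2)| ≤ δ) :
    ∃ M, 1 ≤ M ∧ ∀ (N J : ℕ) (V : ℕ → CGrid J) (Φ : ℕ → RGrid J), 1 ≤ N → timeStep T N ≤ 1 →
      IsMRFD T xa xb N J δ g f u₀ V Φ → ∃ ε θ R : ℕ → CGrid J,
        ErrorEquations N δ g (meshWidth xa xb J) (timeStep T N) M (exactGrid T xa xb N J u) V ε θ R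
          (exactPotential T xa xb N J g u) Φ := by
  have hW : ContDiffOn ℝ (5 : ℕ) (fun p : ℝ × ℝ => g (‖u p.1 p.2‖ ^ 2)) (rect T xa xb) :=
    contDiffOn_potential hg hu6
  obtain ⟨m₁, hm₁, b1⟩ := exists_bddLip hT hab (by norm_num) hu6
  obtain ⟨m₂, hm₂, b2⟩ := exists_bddLip_sub hT hab (by norm_num) hu6
  obtain ⟨m₃, hm₃, b3⟩ := exists_bddLip hT hab (by norm_num) hW
  obtain ⟨m₄, hm₄, b4⟩ := exists_bddLip_sub hT hab (by norm_num) hW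
  obtain ⟨m₅, hm₅, b5⟩ := exists_bddLip_centralDiff hT hab (by norm_num) hW
  obtain ⟨m₆, hm₆, b6⟩ := exists_bddLip_timeResidual hT hab (hu6.of_le (by norm_num))
    (hW.of_le (by norm_num))
  obtain ⟨m₇, hm₇, b7⟩ := exists_sem_projError_le hT hab hu6 hu.boundary
  set ℓ := √(xb - xa) with hℓ
  have hℓ0 : 0 ≤ ℓ := Real.sqrt_nonneg _
  have hℓ4 : 0 ≤ m₄ * ℓ := by positivity
  have hℓ5 : 0 ≤ m₅ * ℓ := by positivity
  have hℓ6 : 0 ≤ m₆ * ℓ := by positivity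
  set M := 1 + m₁ + m₂ + m₃ + m₄ + m₄ * ℓ + m₅ * ℓ + 2 * (m₆ * ℓ) + m₇ with hM
  refine ⟨M, by linarith, fun N J V Φ hN hτ1 hV => ?_⟩
  set τ := timeStep T N with hτdef
  set h := meshWidth xa xb J with hhdef
  have hτ : 0 < τ := timeStep_pos hT hN
  have hh : 0 < h := meshWidth_pos hab J
  have htm : ∀ n ≤ N, (n : ℝ) * τ ∈ Set.Icc 0 T := fun n hn =>
    time_mem hT hN (by positivity) (by exact_mod_cast hn)
  have hthm : ∀ n < N, (n : ℝ) * τ + τ / 2 ∈ Set.Icc 0 T := fun n hn => by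
    have h1 := htm n hn.le
    have h2 := htm (n + 1) hn
    rw [succ_time] at h2
    exact ⟨by linarith [h1.1], by linarith [h2.2]⟩
  have hu0 : ∀ x ∈ Set.Icc xa xb, u₀ x = u 0 x := fun x hx => (hu.initial x hx).symm
  have h0T : (0 : ℝ) ∈ Set.Icc 0 T := ⟨le_rfl, hT.le⟩
  have hnode : ∀ j : Fin (J + 2), node xa xb J j ∈ Set.Icc xa xb := fun j =>
    node_mem hab (by omega)
  -- The initial value agrees with u(0, ·) only on the closed interval. The derivative in the
  -- projection is taken within that interval, so both have the same projection, and θ starts from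
  -- zero.
  have hproj0 : ellipticProj xa xb J u₀ = ellipticProj xa xb J (u 0) := by
    have hspec := ellipticProj_spec hab J u₀
    have hcongr : interp₀ xa xb J (iteratedDerivWithin 2 u₀ (Set.Icc xa xb)) =
        interp₀ xa xb J (iteratedDerivWithin 2 (u 0) (Set.Icc xa xb)) := by
      funext j
      unfold interp₀
      split_ifs
      · exact iteratedDerivWithin_congr hu0 (hnode j)
      · rfl
    refine (existsUnique_isEllipticProj hab J (u 0)).unique ⟨hspec.1, ?_⟩
      (ellipticProj_spec hab J (u 0))
    rw [hspec.2, hcongr]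
  have hgU : ∀ n (j : Fin (J + 2)), exactPotential T xa xb N J g u n j =
      g (‖u ((n : ℝ) * τ + τ / 2) (node xa xb J j)‖ ^ 2) := fun n j => by
    rw [hτdef, ← half_time]
    rfl
  have hend : ∀ t ∈ Set.Icc 0 T, u t (node xa xb J ((0 : Fin (J + 2)) : ℕ)) = 0 := fun t ht => by
    simp only [Fin.val_zero, node_zero]
    exact (hu.boundary t ht).1
  -- At an end node the recursion reads Φ ↦ 2g(0) - Φ with fixed point g(0). Hence the relaxation
  -- error vanishes at the first node, as the Sobolev inequality requires.
  have hΦ0 : ∀ n < N, Φ n 0 = g 0 := by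
    intro n
    induction n with
    | zero =>
      intro _
      rw [hV.Φ_zero]
      have : interp xa xb J u₀ 0 = 0 := by
        simp only [interp]
        rw [hu0 _ (hnode 0)]
        exact hend 0 h0T
      rw [this]
      simp
    | succ n ih =>
      intro hn
      rw [hV.Φ_step (n + 1) (by omega) hn, Nat.add_sub_cancel, ih (by omega),
        (hV.vanishes (n + 1) hn.le).1, cMollifier_of_norm_le (by simpa using hδ.le)]
      simp
      ring
  have hres : ∀ n < N, sem h (fun j : Fin (J + 2) => timeResidual T xa xb
      (fun p : ℝ × ℝ => u p.1 p.2) (fun p : ℝ × ℝ => g (‖u p.1 p.2‖ ^ 2)) ((n : ℝ) * τ) τ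
        (node xa xb J j)) ≤ m₆ * ℓ * τ ^ 3 := fun n hn => by
    have := (b6 ((n : ℝ) * τ) τ hτ.le (htm n hn.le)
      (by rw [← succ_time]; exact htm (n + 1) hn)).sem_sample_le hab (J := J)
    exact this.trans (le_of_eq (by ring))
  have hsub : ∀ t : ℝ, t + τ - t = τ := fun t => by ring
  refine ⟨fun n => projError xa xb J u ((n : ℝ) * τ),
    fun n => ellipticProj xa xb J (u ((n : ℝ) * τ)) - V n, residual T xa xb N J g u, ?_⟩
  constructor
  · intro n hn
    rw [(hV.vanishes n hn).1, sub_zero]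
    exact (interp_vanishes hu.boundary (htm n hn)).1
  · intro n hn
    rw [hΦ0 n hn, hgU, hend _ (hthm n hn)]
    simp
  · intro n _
    simp only [exactGrid, projError]
    abel
  · simp only [Nat.cast_zero, zero_mul]
    rw [hV.V_zero, hproj0, sub_self]
  · intro n hn j
    refine ((b1 _ (htm n hn)).norm_incr_sample_le hab j).trans ?_
    exact mul_le_mul_of_nonneg_right (by linarith) hh.le
  · intro n hn j
    rw [funext (hgU n)]
    refine ((b3 _ (hthm n hn)).norm_incr_sample_le hab j).trans ?_
    exact mul_le_mul_of_nonneg_right (by linarith) hh.le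
  · intro n hn j
    have := (b2 _ (htm (n + 1) hn) _ (htm n hn.le)).norm_sample_le hab j
    rw [succ_time, hsub, abs_of_pos hτ, ← succ_time] at this
    exact this.trans (mul_le_mul_of_nonneg_right (by linarith) hτ.le)
  · intro n hn j
    have := (b2 _ (htm (n + 1) hn) _ (htm n hn.le)).norm_incr_sample_le hab j
    rw [succ_time, hsub, abs_of_pos hτ, ← succ_time] at this
    refine this.trans ?_
    gcongr
    linarith
  · intro n hn j
    have := (b4 _ (hthm (n + 2) hn) _ (hthm n (by omega))).norm_sample_le hab j
    have e : ((n + 2 : ℕ) : ℝ) * τ + τ / 2 - ((n : ℝ) * τ + τ / 2) = 2 * τ := by push_cast; ring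
    rw [e, abs_of_pos (by positivity)] at this
    rw [Pi.sub_apply, hgU, hgU]
    refine this.trans ?_
    have : m₄ * τ ≤ M * τ := mul_le_mul_of_nonneg_right (by linarith) hτ.le
    linarith
  · intro n hn j
    have := (b4 _ (hthm (n + 2) hn) _ (hthm n (by omega))).norm_incr_sample_le hab j
    have e : ((n + 2 : ℕ) : ℝ) * τ + τ / 2 - ((n : ℝ) * τ + τ / 2) = 2 * τ := by push_cast; ring
    rw [e, abs_of_pos (by positivity)] at this
    have e' : exactPotential T xa xb N J g u (n + 2) - exactPotential T xa xb N J g u n =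
        fun j : Fin (J + 2) => g (‖u (((n + 2 : ℕ) : ℝ) * τ + τ / 2) (node xa xb J j)‖ ^ 2) -
          g (‖u ((n : ℝ) * τ + τ / 2) (node xa xb J j)‖ ^ 2) := by
      funext j
      rw [Pi.sub_apply, hgU, hgU]
    rw [e']
    refine this.trans ?_
    have : m₄ * (τ * h) ≤ M * (τ * h) := mul_le_mul_of_nonneg_right (by linarith) (by positivity)
    linarith
  -- The starting potential is taken at time 0 instead of τ/2: this is the first-order error of the
  -- initialization.
  · have := (b4 _ (hthm 0 hN) 0 h0T).sem_sample_le hab (J := J)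
    have e' : exactPotential T xa xb N J g u 0 - Φ 0 =
        fun j : Fin (J + 2) => g (‖u (((0 : ℕ) : ℝ) * τ + τ / 2) (node xa xb J j)‖ ^ 2) -
          g (‖u 0 (node xa xb J j)‖ ^ 2) := by
      funext j
      rw [Pi.sub_apply, hgU, hV.Φ_zero]
      simp only [interp]
      rw [hu0 _ (hnode j)]
    rw [e']
    refine this.trans ?_
    have e2 : ((0 : ℕ) : ℝ) * τ + τ / 2 - 0 = τ / 2 := by simp
    rw [e2, abs_of_pos (by positivity), ← hℓ]
    have : m₄ * ℓ * τ ≤ M * τ := mul_le_mul_of_nonneg_right (by linarith) hτ.le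
    have : 0 ≤ m₄ * ℓ * τ := by positivity
    linarith
  · intro n hn
    have hm := hthm n (by omega)
    have hm' := hthm (n + 1) hn
    have e1 : ((n + 1 : ℕ) : ℝ) * τ - τ / 2 = (n : ℝ) * τ + τ / 2 := by push_cast; ring
    -- The relaxation averages the potential at two midpoints around a time node, so its consistency
    -- error is a central difference with half-width τ/2.
    have := (b5 (((n + 1 : ℕ) : ℝ) * τ) (τ / 2) (by linarith) (by rwa [e1]) hm').sem_sample_le hab
      (J := J)
    refine ⟨_, this.trans ?_, ?_⟩
    · rw [← hℓ]
      have : m₅ * ℓ * τ ^ 2 ≤ M * τ ^ 2 := mul_le_mul_of_nonneg_right (by linarith) (by positivity)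
      have : 0 ≤ m₅ * ℓ * τ ^ 2 := by positivity
      linarith
    · funext j
      have hx := hnode j
      have hUj : exactGrid T xa xb N J u (n + 1) j = u (((n + 1 : ℕ) : ℝ) * τ) (node xa xb J j) :=
        rfl
      simp only [Pi.add_apply, Pi.sub_apply, Pi.smul_apply, smul_eq_mul]
      rw [hV.Φ_step (n + 1) (by omega) hn, Nat.add_sub_cancel, hgU, hgU, hUj]
      simp only [density]
      rw [cMollifier_of_norm_le (hδu _ (htm (n + 1) hn.le) _ hx), e1]
      ring
  · intro n hn
    refine ((b7 J).1 _ (htm n hn)).trans (mul_le_mul_of_nonneg_right (by linarith) (sq_nonneg _))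
  · intro n hn
    have := (b7 J).2.1 _ (htm (n + 1) hn) _ (htm n hn.le)
    rw [succ_time, hsub, abs_of_pos hτ, ← succ_time] at this
    exact this.trans (mul_le_mul_of_nonneg_right (by linarith) (by positivity))
  · intro n hn
    exact error_step hT hab hN hu hu6 hδ hδu hδg hV hn fun _ => rfl
  · have h1 := (b7 J).2.1 _ (htm (0 + 1) hN) _ (htm 0 (by omega))
    rw [succ_time, hsub, abs_of_pos hτ] at h1
    have h2 := hres 0 hN
    unfold residual
    refine (sem_add_le _ _ _).trans ?_
    rw [sem_neg]
    refine (add_le_add h1 h2).trans ?_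
    have t1 : m₇ * (τ * h ^ 2) ≤ M * (τ * h ^ 2) :=
      mul_le_mul_of_nonneg_right (by linarith) (by positivity)
    have t2 : m₆ * ℓ * τ ^ 3 ≤ M * τ ^ 2 := by
      refine mul_le_mul (by linarith) ?_ (by positivity) (by linarith)
      exact pow_le_pow_of_le_one hτ.le hτ1 (by norm_num)
    linarith
  · intro n hn
    have e1 : ((n + 1 : ℕ) : ℝ) * τ - τ = (n : ℝ) * τ := by push_cast; ring
    have h1 := (b7 J).2.2 (((n + 1 : ℕ) : ℝ) * τ) τ hτ.le (by rw [e1]; exact htm n (by omega))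
      (by rw [← succ_time]; exact htm (n + 1 + 1) hn)
    rw [e1] at h1
    have h2 := hres n (by omega)
    have h3 := hres (n + 1) hn
    unfold residual
    rw [← hτdef, ← succ_time T N n, ← hτdef]
    set P := projError xa xb J u
    set σ₁ : CGrid J := fun j => timeResidual T xa xb (fun p : ℝ × ℝ => u p.1 p.2)
      (fun p : ℝ × ℝ => g (‖u p.1 p.2‖ ^ 2)) (((n + 1 : ℕ) : ℝ) * τ) τ (node xa xb J j)
    set σ₀ : CGrid J := fun j => timeResidual T xa xb (fun p : ℝ × ℝ => u p.1 p.2)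
      (fun p : ℝ × ℝ => g (‖u p.1 p.2‖ ^ 2)) ((n : ℝ) * τ) τ (node xa xb J j)
    -- The projection part forms a second difference in time. The two time residuals need no
    -- cancellation, since each is of order τ³ and the target is τ²(τ + h²).
    have e2 : -(P (((n + 1 : ℕ) : ℝ) * τ + τ) - P (((n + 1 : ℕ) : ℝ) * τ)) + σ₁ -
        (-(P (((n + 1 : ℕ) : ℝ) * τ) - P ((n : ℝ) * τ)) + σ₀) =
        -(P (((n + 1 : ℕ) : ℝ) * τ + τ) + P ((n : ℝ) * τ) -
          (P (((n + 1 : ℕ) : ℝ) * τ) + P (((n + 1 : ℕ) : ℝ) * τ))) + (σ₁ - σ₀) := by abel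
    rw [e2]
    refine (sem_add_le _ _ _).trans ?_
    rw [sem_neg]
    refine (add_le_add h1 ((sem_sub_le _ _ _).trans (add_le_add h3 h2))).trans ?_
    have t1 : m₇ * (τ ^ 2 * h ^ 2) ≤ M * (τ ^ 2 * h ^ 2) :=
      mul_le_mul_of_nonneg_right (by linarith) (by positivity)
    have t2 : 2 * (m₆ * ℓ) * τ ^ 3 ≤ M * τ ^ 3 :=
      mul_le_mul_of_nonneg_right (by linarith) (by positivity)
    linarith

end Scheme

end

end RelaxNLS

namespace RelaxNLS

noncomputable section

/-! The error estimate -/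

theorem sem_ofReal {J : ℕ} (h : ℝ) (x : RGrid J) :
    sem h (fun j => (x j : ℂ)) = sem h x := by
  have : ∀ j, ‖incr (fun j => (x j : ℂ)) j‖ = ‖incr x j‖ := fun j => by
    simp only [incr]
    rw [← Complex.ofReal_sub, Complex.norm_real]
  unfold sem
  congr 1
  exact le_antisymm (norm_toLp_mono fun j => (this j).le) (norm_toLp_mono fun j => (this j).ge)

/-- The rate in the discrete Gronwall argument. -/
def gronwallRate (M k : ℝ) : ℝ := 13 * k ^ 2 * M * (21 + 40 * (13 * k ^ 2 * M))

/-- The constant produced by the discrete Gronwall argument. -/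
def gronwallConst (T M k : ℝ) : ℝ :=
  11 * (13 * k ^ 2 * M) ^ 2 * Real.exp (gronwallRate M k * T)

/-- On a fine mesh smallness is bootstrapped: the Gronwall bound on past errors, multiplied by τ +
h², is at most 1, which is the condition for the next step. In the condition for the pair, the
potential error contributes C and the averaged solution error M + C, whence M + 2C. -/
theorem ErrorEquations.bound {J N : ℕ} {δ : ℝ} {g : ℝ → ℝ} {h τ M K k T : ℝ}
    {U V ε θ R : ℕ → CGrid J} {G Φ : ℕ → RGrid J}
    (H : ErrorEquations N δ g h τ M U V ε θ R G Φ) (hM : 1 ≤ M) (hh : 0 < h)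
    (hτ : 0 < τ) (hτ1 : τ ≤ 1) (hN : 1 ≤ N) (hNT : N * τ = T) (hK : 0 < K) (hKk : 2 * K ≤ k)
    (hk : 1 ≤ k) (hF : SecondDiffBound (nonlin δ) J h (2 * M) K)
    (hF' : SecondDiffBound (density δ g) J h (2 * M) K) (hrate : gronwallRate M k * τ ≤ 1)
    (hsmall : (M + 2 * gronwallConst T M k) * (τ + h ^ 2) ≤ 1 ∨ K / h ≤ k) :
    (∀ n < N, sem h (G n - Φ n) ≤ (M + gronwallConst T M k) * (τ + h ^ 2)) ∧
      ∀ n ≤ N, sem h (U n - V n) ≤ (M + gronwallConst T M k) * (τ + h ^ 2) := by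
  have hE : 0 < τ + h ^ 2 := by positivity
  have hMk : 1 ≤ 13 * k ^ 2 * M := by nlinarith [sq_nonneg k, one_le_pow₀ hk (n := 2)]
  set C := gronwallConst T M k with hC
  have hC0 : 0 ≤ C := by
    rw [hC, gronwallConst]; positivity
  have hrec := H.errorRecursion hM hh hτ hτ1 hN hK (by linarith) hk hF hF'
  have hb := hrec.bound hMk hτ hrate hE hN (C := C) (by rw [hC, gronwallConst, hNT]; rfl) (by
    intro n hn hnN hs hp
    obtain ⟨m, rfl⟩ : ∃ m, n = m + 2 := ⟨n - 2, by omega⟩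
    rcases hsmall with hsm | hsm
    · refine Or.inl ⟨hK, hKk, ?_⟩
      simp only [Nat.add_sub_cancel]
      have s1 := (H.sem_err_le (by linarith) hτ.le (n := m + 1) (by omega)).trans
        (add_le_add le_rfl (hs (m + 1) (by omega)))
      have s0 := (H.sem_err_le (by linarith) hτ.le (n := m) (by omega)).trans
        (add_le_add le_rfl (hs m (by omega)))
      have p0 := hp m (by omega)
      have : 0 ≤ C * (τ + h ^ 2) := by positivity
      constructor <;> linarith
    · exact Or.inr ⟨hsm, by linarith⟩)
  have hME : 0 ≤ M * (τ + h ^ 2) := by positivity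
  refine ⟨fun n hn => (hb.2 n hn).trans (by linarith), fun n hn => ?_⟩
  refine (H.sem_err_le (by linarith) hτ.le hn).trans ?_
  have := hb.1 n hn
  linarith

/-- The fine-mesh constant k₁ determines D and with it the threshold 1/(2D) for h. Above the
threshold K/h < 2DK, so the coarse-mesh constant k₂ may be fixed afterwards without circularity. The
term D in A makes Dτ ≤ 1/2 and τ ≤ 1. -/
theorem ErrorEquations.exists_uniform_bound {T M K : ℝ} (hM : 1 ≤ M) (hK : 0 < K) :
    ∃ A S : ℝ, 0 < A ∧ 0 < S ∧ ∀ (N J : ℕ) (δ : ℝ) (g : ℝ → ℝ) (h τ : ℝ)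
      (U V ε θ R : ℕ → CGrid J) (G Φ : ℕ → RGrid J), 0 < h → 0 < τ → 1 ≤ N → N * τ = T →
      SecondDiffBound (nonlin δ) J h (2 * M) K → SecondDiffBound (density δ g) J h (2 * M) K →
      τ * A ≤ 1 / 2 → ErrorEquations N δ g h τ M U V ε θ R G Φ →
      (∀ n < N, sem h (G n - Φ n) ≤ S * (τ + h ^ 2)) ∧
        ∀ n ≤ N, sem h (U n - V n) ≤ S * (τ + h ^ 2) := by
  obtain ⟨k₁, hk₁1, hk₁⟩ : ∃ k₁ : ℝ, 1 ≤ k₁ ∧ 2 * K ≤ k₁ :=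
    ⟨max 1 (2 * K), le_max_left _ _, le_max_right _ _⟩
  have hC : ∀ k, 0 ≤ gronwallConst T M k := fun k => by unfold gronwallConst; positivity
  have hr : ∀ k, 0 ≤ gronwallRate M k := fun k => by unfold gronwallRate; positivity
  obtain ⟨D, hD⟩ : ∃ D, D = M + 2 * gronwallConst T M k₁ := ⟨_, rfl⟩
  have hD1 : 1 ≤ D := by linarith [hC k₁]
  obtain ⟨k₂, hk₂1, hk₂⟩ : ∃ k₂ : ℝ, k₁ ≤ k₂ ∧ K * (2 * D) ≤ k₂ :=
    ⟨max k₁ (K * (2 * D)), le_max_left _ _, le_max_right _ _⟩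
  have c1 := hC k₁
  have c2 := hC k₂
  refine ⟨gronwallRate M k₁ + gronwallRate M k₂ + D,
    M + gronwallConst T M k₁ + gronwallConst T M k₂, by linarith [hr k₁, hr k₂], by linarith,
    fun N J δ g h τ U V ε θ R G Φ hh hτ hN hNT hF hF' hA H => ?_⟩
  have hE : 0 < τ + h ^ 2 := by positivity
  have q1 := mul_nonneg (hr k₁) hτ.le
  have q2 := mul_nonneg (hr k₂) hτ.le
  have q3 := mul_le_mul_of_nonneg_right hD1 hτ.le
  rw [mul_comm, add_mul, add_mul] at hA
  have hτ1 : τ ≤ 1 := by linarith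
  -- Below the threshold h ≤ 1, so Dh² ≤ 1/2; together with Dτ ≤ 1/2 this is the smallness
  -- condition.
  rcases le_or_gt (h * (2 * D)) 1 with hsm | hsm
  · have h1 : h ≤ 1 := by
      have := mul_le_mul_of_nonneg_left (show 1 ≤ 2 * D by linarith) hh.le
      linarith
    have hDh : D * h ^ 2 ≤ 1 / 2 := by
      have := mul_le_mul hsm h1 hh.le zero_le_one
      linarith
    have hb := H.bound hM hh hτ hτ1 hN hNT hK hk₁ hk₁1 hF hF' (by linarith)
      (Or.inl (by rw [← hD]; linarith))
    have hle : (M + gronwallConst T M k₁) * (τ + h ^ 2) ≤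
        (M + gronwallConst T M k₁ + gronwallConst T M k₂) * (τ + h ^ 2) :=
      mul_le_mul_of_nonneg_right (by linarith) hE.le
    exact ⟨fun n hn => (hb.1 n hn).trans hle, fun n hn => (hb.2 n hn).trans hle⟩
  · have hcoarse : K / h ≤ k₂ := by
      refine le_trans ?_ hk₂
      rw [div_le_iff₀ hh]
      have := mul_le_mul_of_nonneg_left hsm.le hK.le
      linarith
    have hb := H.bound hM hh hτ hτ1 hN hNT hK (hk₁.trans hk₂1) (hk₁1.trans hk₂1) hF hF'
      (by linarith) (Or.inr hcoarse)
    have hle : (M + gronwallConst T M k₂) * (τ + h ^ 2) ≤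
        (M + gronwallConst T M k₁ + gronwallConst T M k₂) * (τ + h ^ 2) :=
      mul_le_mul_of_nonneg_right (by linarith) hE.le
    exact ⟨fun n hn => (hb.1 n hn).trans hle, fun n hn => (hb.2 n hn).trans hle⟩

theorem BddC3.exists_secondDiffBound {E G : Type*} [NormedAddCommGroup E] [NormedSpace ℝ E]
    [NormedAddCommGroup G] [NormedSpace ℝ G] {F : E → G} (hF : BddC3 F) {xa xb : ℝ}
    (hab : xa < xb) {M : ℝ} (hM : 0 ≤ M) :
    ∃ K₀, 0 < K₀ ∧ ∀ K, K₀ ≤ K → ∀ J, SecondDiffBound F J (meshWidth xa xb J) M K := by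
  obtain ⟨K₀, hK₀, h⟩ := hF.sem_secondDiff_le (xb - xa) hM
  refine ⟨K₀, hK₀, fun K hK J => SecondDiffBound.mono (K := K₀) (fun τ hτ => ?_) hK
    (meshWidth_pos hab J)⟩
  exact h J _ τ (meshWidth_pos hab J) (mul_meshWidth xa xb J) hτ

theorem exists_error_bound (T xa xb : ℝ) (hT : 0 < T) (hab : xa < xb)
    (g : ℝ → ℝ) (hg : ContDiffOn ℝ 5 g (Set.Ici 0))
    (f : ℝ → ℝ → ℂ) (u₀ : ℝ → ℂ) (u : ℝ → ℝ → ℂ)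
    (hu : IsNLSSolution T xa xb g f u₀ u)
    (hu_smooth : ContDiffOn ℝ 6 (fun p : ℝ × ℝ => u p.1 p.2) (rect T xa xb))
    (δ : ℝ) (hδ_pos : 0 < δ)
    (hδ : max (uMax T xa xb u) (gMax T xa xb g u) ≤ δ) :
    ∃ CA CB : ℝ, 0 < CA ∧ 0 < CB ∧
      ∀ N J : ℕ, 1 ≤ N → 1 ≤ J → timeStep T N * CA ≤ 1 / 2 →
        ∀ (V : ℕ → CGrid J) (Φ : ℕ → RGrid J),
          IsMRFD T xa xb N J δ g f u₀ V Φ →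
            (⨆ m : Fin N, normH1 (meshWidth xa xb J)
                (relaxError T xa xb N J g u Φ m)) +
              (⨆ m : Fin (N + 1), normH1 (meshWidth xa xb J)
                (nodalError T xa xb N J u V m)) ≤
            CB * (timeStep T N + meshWidth xa xb J ^ 2) := by
  have hδu : ∀ t ∈ Set.Icc 0 T, ∀ x ∈ Set.Icc xa xb, ‖u t x‖ ≤ δ := fun t ht x hx =>
    (norm_le_uMax hu_smooth ht hx).trans ((le_max_left _ _).trans hδ)
  have hδg : ∀ t ∈ Set.Icc 0 T, ∀ x ∈ Set.Icc xa xb, |g (‖u t x‖ ^ 2)| ≤ δ := fun t ht x hx =>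
    (abs_le_gMax hg hu_smooth ht hx).trans ((le_max_right _ _).trans hδ)
  have hu6 : ContDiffOn ℝ (6 : ℕ) (fun p : ℝ × ℝ => u p.1 p.2) (rect T xa xb) :=
    hu_smooth.of_le (by norm_num)
  obtain ⟨M, hM, hEq⟩ := exists_errorEquations hT hab hg hu hu6 hδ_pos hδu hδg
  have hM0 : 0 ≤ 2 * M := by linarith
  obtain ⟨K₁, hK₁, hF₁⟩ := (bddC3_nonlin hδ_pos).exists_secondDiffBound hab hM0
  obtain ⟨K₂, hK₂, hF₂⟩ := (bddC3_density hδ_pos (hg.of_le (by norm_num))).exists_secondDiffBound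
    hab hM0
  obtain ⟨K, hK, hKK₁, hKK₂⟩ : ∃ K : ℝ, 0 < K ∧ K₁ ≤ K ∧ K₂ ≤ K :=
    ⟨max K₁ K₂, lt_max_of_lt_left hK₁, le_max_left _ _, le_max_right _ _⟩
  have hF := hF₁ K hKK₁
  have hF' := hF₂ K hKK₂
  obtain ⟨A, S, hA, hS, hAS⟩ := ErrorEquations.exists_uniform_bound (T := T) hM hK
  have hL2 : 0 < 1 + 2 * (xb - xa) := by linarith
  -- The summand 1 enforces τ ≤ 1, used for the error equations. The factor 1 + 2(xb - xa) passes
  -- from the seminorm to the full norm, and 2 accounts for the two maxima.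
  refine ⟨A + 1, 2 * ((1 + 2 * (xb - xa)) * S), by linarith, by positivity,
    fun N J hN hJ hτA V Φ hV => ?_⟩
  have hτ : 0 < timeStep T N := timeStep_pos hT hN
  have hh : 0 < meshWidth xa xb J := meshWidth_pos hab J
  rw [mul_add, mul_one] at hτA
  have hτA0 := mul_pos hτ hA
  obtain ⟨ε, θ, R, H⟩ := hEq N J V Φ hN (by linarith) hV
  have hb := hAS N J δ g _ _ _ _ _ _ _ _ _ hh hτ hN (natCast_mul_timeStep hN) (hF J) (hF' J)
    (by linarith) H
  have hmul := mul_meshWidth xa xb J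
  set τ := timeStep T N
  set h := meshWidth xa xb J
  have hrelax : ∀ m : Fin N, normH1 h (relaxError T xa xb N J g u Φ m) ≤
      (1 + 2 * (xb - xa)) * (S * (τ + h ^ 2)) := fun m => by
    have e0 := H.relax_err_zero m m.2
    have h1 := normH1_le_sem hh (v := relaxError T xa xb N J g u Φ m) (by
      have : relaxError T xa xb N J g u Φ m 0 =
        ((exactPotential T xa xb N J g u m 0 - Φ m 0 : ℝ) : ℂ) := rfl
      rw [this, e0, Complex.ofReal_zero])
    rw [hmul] at h1
    refine h1.trans (mul_le_mul_of_nonneg_left ?_ hL2.le)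
    have h2 := hb.1 m m.2
    rw [← sem_ofReal] at h2
    exact h2
  have hnodal : ∀ m : Fin (N + 1), normH1 h (nodalError T xa xb N J u V m) ≤
      (1 + 2 * (xb - xa)) * (S * (τ + h ^ 2)) := fun m => by
    have h1 := normH1_le_sem hh (v := nodalError T xa xb N J u V m)
      (H.err_zero m (Nat.lt_succ_iff.1 m.2))
    rw [hmul] at h1
    exact h1.trans (mul_le_mul_of_nonneg_left (hb.2 m (Nat.lt_succ_iff.1 m.2)) hL2.le)
  have : Nonempty (Fin N) := ⟨⟨0, hN⟩⟩
  refine (add_le_add (ciSup_le hrelax) (ciSup_le hnodal)).trans (le_of_eq ?_)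
  ring

end

end RelaxNLS

theorem mainTheorem4 (T xa xb : ℝ) (hT : 0 < T) (hab : xa < xb)
    (g : ℝ → ℝ) (hg : ContDiffOn ℝ 5 g (Set.Ici 0))
    (f : ℝ → ℝ → ℂ) (u₀ : ℝ → ℂ) (u : ℝ → ℝ → ℂ)
    (hu : RelaxNLS.IsNLSSolution T xa xb g f u₀ u)
    (hu_smooth : ContDiffOn ℝ 6 (fun p : ℝ × ℝ => u p.1 p.2) (RelaxNLS.rect T xa xb))
    (δ : ℝ) (hδ_pos : 0 < δ)
    (hδ : max (RelaxNLS.uMax T xa xb u) (RelaxNLS.gMax T xa xb g u) ≤ δ) :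
    ∃ CA CB : ℝ, 0 < CA ∧ 0 < CB ∧
      ∀ N J : ℕ, 1 ≤ N → 1 ≤ J → RelaxNLS.timeStep T N * CA ≤ 1 / 2 →
        ∀ (V : ℕ → RelaxNLS.CGrid J) (Φ : ℕ → RelaxNLS.RGrid J),
          RelaxNLS.IsMRFD T xa xb N J δ g f u₀ V Φ →
            (⨆ m : Fin N, RelaxNLS.normH1 (RelaxNLS.meshWidth xa xb J)
                (RelaxNLS.relaxError T xa xb N J g u Φ m)) +
              (⨆ m : Fin (N + 1), RelaxNLS.normH1 (RelaxNLS.meshWidth xa xb J)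
                (RelaxNLS.nodalError T xa xb N J u V m)) ≤
            CB * (RelaxNLS.timeStep T N + RelaxNLS.meshWidth xa xb J ^ 2) :=
  RelaxNLS.exists_error_bound T xa xb hT hab g hg f u₀ u hu hu_smooth δ hδ_pos hδ
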